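/- **Theorem.** There is a robust linear-time algorithm for the weighted perfect edge domination problem on $P_5$-free graphs. Precisely: for a finite simple graph $G$ (not necessarily connected), an edge dominates itself and every edge sharing an endpoint with it, and a set $P \subseteq E(G)$ is a *perfect edge dominating set* if every edge of $E(G) \setminus P$ is dominated by exactly one edge of $P$. There are a random access machine program and a constant $c$ such that, for every graph $G$ with $n$ vertices and $m$ edges and every assignment $w : E(G) \to \mathbb{R}$ of (possibly negative) real edge weights, the program, given $G$ by its adjacency lists (in any order) together with the weights of the edges, halts after at most $c\,(n+m+1)$ steps and either 1. outputs a list of the edges of a perfect edge dominating set $P$ of $G$ whose weight $\sum_{e \in P} w(e)$ is minimum among all perfect edge dominating sets of $G$, or 2. outputs five vertices that form, in this order, an induced path $P_5$ in $G$. In particular, if $G$ has no induced $P_5$, the output is a minimum-weight perfect edge dominating set. The machine has scalar variables and arrays for natural numbers and for real numbers; at unit cost it can copy and compare numbers, add and subtract real numbers, form the successor or predecessor of a natural number, use natural number constants and the real constant $0$, and access an array cell at a computed index. -/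

import Mathlib

/-! ## Perfect edge domination and induced paths -/

/-- An edge dominates itself and every edge sharing an endpoint with it. -/
def EdgeDominates {V : Type*} (f e : Sym2 V) : Prop := ∃ v, v ∈ f ∧ v ∈ e

/-- `P` is a perfect edge dominating set of `G`: a set of edges such that every edge outside `P`
is dominated by exactly one edge of `P`. -/
def IsPerfectEdgeDominatingSet {V : Type*} (G : SimpleGraph V) (P : Finset (Sym2 V)) : Prop :=
  (∀ e ∈ P, e ∈ G.edgeSet) ∧
    ∀ e ∈ G.edgeSet, e ∉ P → ∃! f, f ∈ P ∧ EdgeDominates f e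

/-- `P` is a perfect edge dominating set of `G` whose total weight is least possible. -/
def IsMinWeightPerfectEdgeDominatingSet {V : Type*} (G : SimpleGraph V) (w : Sym2 V → ℝ)
    (P : Finset (Sym2 V)) : Prop :=
  IsPerfectEdgeDominatingSet G P ∧
    ∀ Q, IsPerfectEdgeDominatingSet G Q → ∑ e ∈ P, w e ≤ ∑ e ∈ Q, w e

/-! ## A random access machine with real registers

Programs are finite texts of a structured language. They use scalar variables and one-dimensional
arrays, both holding natural numbers or real numbers, and both named by numbers. The only operations
on natural numbers are successor, predecessor and comparison (so a run of `t` steps can only produce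
numbers that exceed the constants of the program and the numbers of the input by at most `t`, and no
large numbers can be packed into one cell); arrays may be indexed by any computed natural number. The
only operations on real numbers are addition, subtraction and comparison; the only real constant
is `0`. Every operation has unit cost. -/

namespace RealRAM

/-- The contents of the memory. -/
structure State where
  /-- natural number variables -/
  nat : ℕ → ℕ
  /-- natural number arrays: `natArr a i` is the cell with index `i` of the array `a` -/
  natArr : ℕ → ℕ → ℕ
  /-- real variables -/
  real : ℕ → ℝ
  /-- real arrays: `realArr a i` is the cell with index `i` of the array `a` -/
  realArr : ℕ → ℕ → ℝ

/-- Natural number expressions. -/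
inductive NatExp where
  | lit (k : ℕ)
  | var (x : ℕ)
  | get (a : ℕ) (i : NatExp)
  | succ (e : NatExp)
  | pred (e : NatExp)

/-- The value of an expression; the predecessor of `0` is `0`. -/
def NatExp.eval (s : State) : NatExp → ℕ
  | lit k => k
  | var x => s.nat x
  | get a i => s.natArr a (i.eval s)
  | succ e => e.eval s + 1
  | pred e => e.eval s - 1

/-- The time to evaluate an expression: its number of operations. -/
def NatExp.cost : NatExp → ℕ
  | lit _ => 1
  | var _ => 1
  | get _ i => i.cost + 1
  | succ e => e.cost + 1
  | pred e => e.cost + 1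

/-- Real number expressions. -/
inductive RealExp where
  | zero
  | var (x : ℕ)
  | get (a : ℕ) (i : NatExp)
  | add (e f : RealExp)
  | sub (e f : RealExp)

/-- The value of a real expression. -/
noncomputable def RealExp.eval (s : State) : RealExp → ℝ
  | zero => 0
  | var x => s.real x
  | get a i => s.realArr a (i.eval s)
  | add e f => e.eval s + f.eval s
  | sub e f => e.eval s - f.eval s

/-- The time to evaluate a real expression. -/
def RealExp.cost : RealExp → ℕ
  | zero => 1
  | var _ => 1
  | get _ i => i.cost + 1
  | add e f => e.cost + f.cost + 1
  | sub e f => e.cost + f.cost + 1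

/-- Tests: comparisons of natural numbers and of real numbers, and their Boolean combinations. -/
inductive Test where
  | eq (e f : NatExp)
  | lt (e f : NatExp)
  | realLt (e f : RealExp)
  | not (b : Test)
  | and (b c : Test)
  | or (b c : Test)

/-- The truth value of a test. -/
def Test.eval (s : State) : Test → Prop
  | eq e f => e.eval s = f.eval s
  | lt e f => e.eval s < f.eval s
  | realLt e f => e.eval s < f.eval s
  | not b => ¬ b.eval s
  | and b c => b.eval s ∧ c.eval s
  | or b c => b.eval s ∨ c.eval s

/-- The time to evaluate a test. -/
def Test.cost : Test → ℕ
  | eq e f => e.cost + f.cost + 1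
  | lt e f => e.cost + f.cost + 1
  | realLt e f => e.cost + f.cost + 1
  | not b => b.cost + 1
  | and b c => b.cost + c.cost + 1
  | or b c => b.cost + c.cost + 1

/-- Programs. -/
inductive Program where
  | skip
  /-- variable `x` := `e` -/
  | setNat (x : ℕ) (e : NatExp)
  /-- cell `i` of array `a` := `e` -/
  | storeNat (a : ℕ) (i e : NatExp)
  | setReal (x : ℕ) (e : RealExp)
  | storeReal (a : ℕ) (i : NatExp) (e : RealExp)
  | seq (p q : Program)
  | ite (b : Test) (p q : Program)
  | while (b : Test) (p : Program)

/-- The effect of the assignment of a value to a natural number variable. -/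
def State.setNat (s : State) (x v : ℕ) : State :=
  { s with nat := Function.update s.nat x v }

/-- The effect of the assignment of a value to a cell of a natural number array. -/
def State.storeNat (s : State) (a i v : ℕ) : State :=
  { s with natArr := Function.update s.natArr a (Function.update (s.natArr a) i v) }

/-- The effect of the assignment of a value to a real variable. -/
noncomputable def State.setReal (s : State) (x : ℕ) (v : ℝ) : State :=
  { s with real := Function.update s.real x v }

/-- The effect of the assignment of a value to a cell of a real array. -/
noncomputable def State.storeReal (s : State) (a i : ℕ) (v : ℝ) : State :=
  { s with realArr := Function.update s.realArr a (Function.update (s.realArr a) i v) }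

/-- `Runs p s t s'`: started in the state `s`, the program `p` halts after exactly `t` steps in the
state `s'`. -/
inductive Runs : Program → State → ℕ → State → Prop
  | skip (s : State) : Runs .skip s 1 s
  | setNat (s : State) (x : ℕ) (e : NatExp) :
      Runs (.setNat x e) s (e.cost + 1) (s.setNat x (e.eval s))
  | storeNat (s : State) (a : ℕ) (i e : NatExp) :
      Runs (.storeNat a i e) s (i.cost + e.cost + 1) (s.storeNat a (i.eval s) (e.eval s))
  | setReal (s : State) (x : ℕ) (e : RealExp) :
      Runs (.setReal x e) s (e.cost + 1) (s.setReal x (e.eval s))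
  | storeReal (s : State) (a : ℕ) (i : NatExp) (e : RealExp) :
      Runs (.storeReal a i e) s (i.cost + e.cost + 1) (s.storeReal a (i.eval s) (e.eval s))
  | seq {p q : Program} {s s' s'' : State} {t t' : ℕ} :
      Runs p s t s' → Runs q s' t' s'' → Runs (.seq p q) s (t + t') s''
  | ite_true {b : Test} {p q : Program} {s s' : State} {t : ℕ} :
      b.eval s → Runs p s t s' → Runs (.ite b p q) s (b.cost + t + 1) s'
  | ite_false {b : Test} {p q : Program} {s s' : State} {t : ℕ} :
      ¬ b.eval s → Runs q s t s' → Runs (.ite b p q) s (b.cost + t + 1) s'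
  | while_false {b : Test} {p : Program} {s : State} :
      ¬ b.eval s → Runs (.while b p) s (b.cost + 1) s
  | while_true {b : Test} {p : Program} {s s' s'' : State} {t t' : ℕ} :
      b.eval s → Runs p s t s' → Runs (.while b p) s' t' s'' →
        Runs (.while b p) s (b.cost + t + t' + 1) s''

/-- `s` is an input state for the graph `G` on the vertices `0, …, n - 1` with edge weights `w`, given
by adjacency lists in arbitrary order: variable `0` holds `n`; the cells of array `1` whose indices
lie between cell `v` (included) and cell `v + 1` (excluded) of array `0` list the neighbours of the
vertex `v`, each one once; and the same cells of the real array `0` hold the weights of the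
corresponding edges. The rest of the memory is `0`. -/
structure IsInput {n : ℕ} (G : SimpleGraph (Fin n)) (w : Sym2 (Fin n) → ℝ) (s : State) : Prop where
  size : s.nat 0 = n
  start : s.natArr 0 0 = 0
  mono : ∀ v : Fin n, s.natArr 0 v ≤ s.natArr 0 ((v : ℕ) + 1)
  neighbours : ∀ v : Fin n,
    Set.BijOn (s.natArr 1) (Set.Ico (s.natArr 0 v) (s.natArr 0 ((v : ℕ) + 1)))
      ((fun u : Fin n => (u : ℕ)) '' G.neighborSet v)
  weights : ∀ v u : Fin n, ∀ j ∈ Set.Ico (s.natArr 0 v) (s.natArr 0 ((v : ℕ) + 1)),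
    s.natArr 1 j = u → s.realArr 0 j = w s(v, u)
  nat_zero : ∀ x, x ≠ 0 → s.nat x = 0
  start_zero : ∀ i, n < i → s.natArr 0 i = 0
  neighbours_zero : ∀ j, s.natArr 0 n ≤ j → s.natArr 1 j = 0
  natArr_zero : ∀ a, 2 ≤ a → ∀ i, s.natArr a i = 0
  real_zero : ∀ x, s.real x = 0
  weights_zero : ∀ j, s.natArr 0 n ≤ j → s.realArr 0 j = 0
  realArr_zero : ∀ a, 1 ≤ a → ∀ i, s.realArr a i = 0

/-- In the state `s` the machine outputs the edge set `P`: variable `0` is `0`, variable `1` holds the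
number of edges, and the arrays `2` and `3` list the endpoints of the edges in `P`, each edge once. -/
def OutputsEdgeSet {n : ℕ} (s : State) (P : Finset (Sym2 (Fin n))) : Prop :=
  s.nat 0 = 0 ∧
    Set.BijOn (fun i => s(s.natArr 2 i, s.natArr 3 i)) (Set.Iio (s.nat 1))
      (Sym2.map (fun u : Fin n => (u : ℕ)) '' (P : Set (Sym2 (Fin n))))

/-- In the state `s` the machine outputs an induced path on five vertices of `G`: variable `0` is `1`,
and the variables `1, …, 5` hold the consecutive vertices of the path. -/
def OutputsInducedP5 {n : ℕ} (s : State) (G : SimpleGraph (Fin n)) : Prop :=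
  s.nat 0 = 1 ∧
    ∃ f : SimpleGraph.pathGraph 5 ↪g G, ∀ i : Fin 5, s.nat ((i : ℕ) + 1) = (f i : ℕ)

end RealRAM

/-! ## Reasoning about programs: frames, running times, loops -/

namespace RealRAM

-- A perfect edge dominating set is determined by the set N of the vertices that its edges cover: it
-- consists of all edges inside N. The sets N that arise are those satisfying the local condition
-- `CoverGood` at every vertex (`isPerfectEdgeDominatingSet_of_coverGood`,
-- `IsPerfectEdgeDominatingSet.mem_iff`, `IsPerfectEdgeDominatingSet.coverGood`). Condition and
-- weight split over the connected components, and an isolated vertex is never covered, so it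
-- suffices to treat a component C with an edge in time linear in its size.
--
-- The root. In a breadth first search of C, a vertex of level at least four ends an induced path
-- formed by its ancestors (`isP5_of_level`). Otherwise let a be a vertex of level two with the most
-- neighbours of level three, and r a neighbour of level one of a with the most neighbours of level
-- two. By extremality, a vertex z at distance more than two from r produces one of six explicit
-- induced paths (`eccentricity_le_two`). Testing every z would take too long, but one is enough:
-- let a₀ be, among the vertices other than r and not adjacent to r, one with the fewest common
-- neighbours with r. If a₀ has a common neighbour with r, so do all the others.
--
-- The candidates. Let y₀ be a common neighbour of r and a₀. If no induced path ends in r, y₀, a₀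
-- (`NoPathThrough`), and none does so for a neighbour b₀ of a₀ at distance two in place of a₀, then
-- N is almost determined on C. The cases are: r and all its neighbours are covered
-- (`cover_cases_root_full`); r is covered with exactly one covered neighbour
-- (`cover_cases_root_mate`); r is uncovered (`cover_cases_root_uncovered`). Together they say that
-- on C the set N is one of ten explicit sets with one arbitrary vertex m added (`Anchors.isCand`).
--
-- The evaluation. Adding m to a set affects only m and its neighbours. After one pass that
-- tabulates the set itself, the validity and the cost for each m are found in time proportional to
-- the degree of m (`Net.good_insert_iff`, `Net.cost_insert`), hence in linear time for all m
-- together.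
--
-- The algorithm is robust because these arguments use only the absence of the particular paths that
-- are tested; a test that succeeds leaves its path as the output. For the running time, `Tri`
-- bounds how often any single instruction is executed, so that constants are absorbed into the
-- fixed weight of the program text. A pass over C pays the degree plus one for each vertex, which
-- adds up to `Net.size`, and to n + 2m for the whole graph.

infixr:60 " ;; " => Program.seq

/-- Whether the program assigns to the natural number variable `x`. -/
def Program.modNat (x : ℕ) : Program → Bool
  | .setNat y _ => x == y
  | .seq p q => p.modNat x || q.modNat x
  | .ite _ p q => p.modNat x || q.modNat x
  | .while _ p => p.modNat x
  | _ => false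

/-- Whether the program assigns to cells of the natural number array `a`. -/
def Program.modNatArr (a : ℕ) : Program → Bool
  | .storeNat b _ _ => a == b
  | .seq p q => p.modNatArr a || q.modNatArr a
  | .ite _ p q => p.modNatArr a || q.modNatArr a
  | .while _ p => p.modNatArr a
  | _ => false

/-- Whether the program assigns to the real variable `x`. -/
def Program.modReal (x : ℕ) : Program → Bool
  | .setReal y _ => x == y
  | .seq p q => p.modReal x || q.modReal x
  | .ite _ p q => p.modReal x || q.modReal x
  | .while _ p => p.modReal x
  | _ => false

/-- Whether the program assigns to cells of the real array `a`. -/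
def Program.modRealArr (a : ℕ) : Program → Bool
  | .storeReal b _ _ => a == b
  | .seq p q => p.modRealArr a || q.modRealArr a
  | .ite _ p q => p.modRealArr a || q.modRealArr a
  | .while _ p => p.modRealArr a
  | _ => false

/-- The states `s` and `s'` agree on everything that `p` does not assign to. -/
structure Frame (p : Program) (s s' : State) : Prop where
  nat : ∀ x, p.modNat x = false → s'.nat x = s.nat x
  natArr : ∀ a, p.modNatArr a = false → s'.natArr a = s.natArr a
  real : ∀ x, p.modReal x = false → s'.real x = s.real x
  realArr : ∀ a, p.modRealArr a = false → s'.realArr a = s.realArr a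

theorem Frame.refl (p : Program) (s : State) : Frame p s s :=
  ⟨fun _ _ => rfl, fun _ _ => rfl, fun _ _ => rfl, fun _ _ => rfl⟩

theorem Frame.trans {p : Program} {s s' s'' : State} (h : Frame p s s') (h' : Frame p s' s'') :
    Frame p s s'' :=
  ⟨fun x hx => (h'.nat x hx).trans (h.nat x hx), fun x hx => (h'.natArr x hx).trans (h.natArr x hx),
    fun x hx => (h'.real x hx).trans (h.real x hx),
    fun x hx => (h'.realArr x hx).trans (h.realArr x hx)⟩

/-- `q` assigns to nothing that `p` does not assign to. -/
structure Frame.Le (q p : Program) : Prop where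
  nat : ∀ x, p.modNat x = false → q.modNat x = false
  natArr : ∀ x, p.modNatArr x = false → q.modNatArr x = false
  real : ∀ x, p.modReal x = false → q.modReal x = false
  realArr : ∀ x, p.modRealArr x = false → q.modRealArr x = false

theorem Frame.mono {p q : Program} (hl : Frame.Le q p) {s s' : State} (h : Frame q s s') :
    Frame p s s' :=
  ⟨fun x hx => h.nat x (hl.nat x hx), fun x hx => h.natArr x (hl.natArr x hx),
    fun x hx => h.real x (hl.real x hx), fun x hx => h.realArr x (hl.realArr x hx)⟩

theorem Frame.Le.left (p q : Program) : Frame.Le p (p ;; q) := by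
  constructor <;> intro x h <;>
    simp [Program.modNat, Program.modNatArr, Program.modReal, Program.modRealArr] at h <;> exact h.1

theorem Frame.Le.right (p q : Program) : Frame.Le q (p ;; q) := by
  constructor <;> intro x h <;>
    simp [Program.modNat, Program.modNatArr, Program.modReal, Program.modRealArr] at h <;> exact h.2

theorem Frame.Le.while (b : Test) (p : Program) : Frame.Le p (.while b p) :=
  ⟨fun _ h => h, fun _ h => h, fun _ h => h, fun _ h => h⟩

/-- What a program can change is read off its text, so for concrete programs the preservation of a
variable or an array is settled by evaluating a Boolean. -/
theorem Runs.frame {p : Program} {s s' : State} {t : ℕ} (h : Runs p s t s') : Frame p s s' := by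
  induction h with
  | skip s => exact Frame.refl _ _
  | setNat s x e =>
    refine ⟨fun y hy => ?_, fun _ _ => rfl, fun _ _ => rfl, fun _ _ => rfl⟩
    simp [Program.modNat] at hy
    simp [State.setNat, hy]
  | storeNat s x i e =>
    refine ⟨fun _ _ => rfl, fun y hy => ?_, fun _ _ => rfl, fun _ _ => rfl⟩
    simp [Program.modNatArr] at hy
    simp [State.storeNat, hy]
  | setReal s x e =>
    refine ⟨fun _ _ => rfl, fun _ _ => rfl, fun y hy => ?_, fun _ _ => rfl⟩
    simp [Program.modReal] at hy
    simp [State.setReal, hy]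
  | storeReal s x i e =>
    refine ⟨fun _ _ => rfl, fun _ _ => rfl, fun _ _ => rfl, fun y hy => ?_⟩
    simp [Program.modRealArr] at hy
    simp [State.storeReal, hy]
  | seq _ _ ih ih' => exact (ih.mono (Frame.Le.left _ _)).trans (ih'.mono (Frame.Le.right _ _))
  | ite_true _ _ ih =>
    refine ih.mono ?_
    constructor <;> intro x h <;>
      simp [Program.modNat, Program.modNatArr, Program.modReal, Program.modRealArr] at h <;>
      exact h.1
  | ite_false _ _ ih =>
    refine ih.mono ?_
    constructor <;> intro x h <;>
      simp [Program.modNat, Program.modNatArr, Program.modReal, Program.modRealArr] at h <;>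
      exact h.2
  | while_false _ => exact Frame.refl _ _
  | while_true _ _ _ ih ih' => exact (ih.mono (Frame.Le.while _ _)).trans ih'

/-- The cost of one execution of every instruction of the program. -/
def Program.weight : Program → ℕ
  | .skip => 1
  | .setNat _ e => e.cost + 1
  | .storeNat _ i e => i.cost + e.cost + 1
  | .setReal _ e => e.cost + 1
  | .storeReal _ i e => i.cost + e.cost + 1
  | .seq p q => p.weight + q.weight
  | .ite b p q => b.cost + p.weight + q.weight + 1
  | .while b p => b.cost + p.weight + 1

/-- Started in `s`, the program `p` halts in a state that satisfies `Q`, and no instruction of `p` is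
charged more than `X + 1` times. -/
def Tri (p : Program) (s : State) (X : ℕ) (Q : State → Prop) : Prop :=
  ∃ t s', Runs p s t s' ∧ t ≤ p.weight * (X + 1) ∧ Q s'

theorem Tri.wk {p : Program} {s : State} {X X' : ℕ} {Q Q' : State → Prop} (h : Tri p s X Q)
    (hX : X ≤ X') (hQ : ∀ s', Frame p s s' → Q s' → Q' s') : Tri p s X' Q' := by
  obtain ⟨t, s', hr, ht, hq⟩ := h
  exact ⟨t, s', hr, ht.trans (by gcongr), hQ s' hr.frame hq⟩

/-- Bounding the number of executions of each instruction, instead of the total number of steps,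
lets the same `X` serve both halves. The frame of the first half is passed on, so that its
postcondition need only mention what has changed. -/
theorem Tri.bind {p q : Program} {s : State} {X : ℕ} {Q R : State → Prop} (h : Tri p s X Q)
    (hq : ∀ s', Frame p s s' → Q s' → Tri q s' X R) : Tri (p ;; q) s X R := by
  obtain ⟨t, s', hr, ht, h'⟩ := h
  obtain ⟨t', s'', hr', ht', h''⟩ := hq s' hr.frame h'
  refine ⟨t + t', s'', hr.seq hr', ?_, h''⟩
  simp only [Program.weight, add_mul] at *
  omega

theorem Tri.skip {s : State} {X : ℕ} {Q : State → Prop} (h : Q s) : Tri .skip s X Q :=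
  ⟨1, s, .skip s, by simp [Program.weight], h⟩

theorem Tri.setNat {s : State} {X x : ℕ} {e : NatExp} {Q : State → Prop}
    (h : Q (s.setNat x (e.eval s))) : Tri (.setNat x e) s X Q :=
  ⟨_, _, .setNat s x e, Nat.le_mul_of_pos_right _ (by omega), h⟩

theorem Tri.storeNat {s : State} {X a : ℕ} {i e : NatExp} {Q : State → Prop}
    (h : Q (s.storeNat a (i.eval s) (e.eval s))) : Tri (.storeNat a i e) s X Q :=
  ⟨_, _, .storeNat s a i e, Nat.le_mul_of_pos_right _ (by omega), h⟩

theorem Tri.setReal {s : State} {X x : ℕ} {e : RealExp} {Q : State → Prop}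
    (h : Q (s.setReal x (e.eval s))) : Tri (.setReal x e) s X Q :=
  ⟨_, _, .setReal s x e, Nat.le_mul_of_pos_right _ (by omega), h⟩

theorem Tri.setNat_seq {s : State} {X x : ℕ} {e : NatExp} {q : Program} {Q : State → Prop}
    (h : Tri q (s.setNat x (e.eval s)) X Q) : Tri (.setNat x e ;; q) s X Q :=
  Tri.bind (Q := fun s' => s' = s.setNat x (e.eval s)) (Tri.setNat rfl)
    (fun _ _ h' => by subst h'; exact h)

theorem Tri.storeNat_seq {s : State} {X a : ℕ} {i e : NatExp} {q : Program} {Q : State → Prop}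
    (h : Tri q (s.storeNat a (i.eval s) (e.eval s)) X Q) : Tri (.storeNat a i e ;; q) s X Q :=
  Tri.bind (Q := fun s' => s' = s.storeNat a (i.eval s) (e.eval s)) (Tri.storeNat rfl)
    (fun _ _ h' => by subst h'; exact h)

theorem Tri.setReal_seq {s : State} {X x : ℕ} {e : RealExp} {q : Program} {Q : State → Prop}
    (h : Tri q (s.setReal x (e.eval s)) X Q) : Tri (.setReal x e ;; q) s X Q :=
  Tri.bind (Q := fun s' => s' = s.setReal x (e.eval s)) (Tri.setReal rfl)
    (fun _ _ h' => by subst h'; exact h)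

theorem Tri.ite {s : State} {X : ℕ} {b : Test} {p q : Program} {Q : State → Prop}
    (h : b.eval s → Tri p s X Q) (h' : ¬ b.eval s → Tri q s X Q) : Tri (.ite b p q) s X Q := by
  by_cases hb : b.eval s
  · obtain ⟨t, s', hr, ht, h⟩ := h hb
    refine ⟨_, s', .ite_true hb hr, ?_, h⟩
    have : b.cost + 1 ≤ (b.cost + 1) * (X + 1) := Nat.le_mul_of_pos_right _ (by omega)
    simp only [Program.weight, add_mul] at *
    omega
  · obtain ⟨t, s', hr, ht, h⟩ := h' hb
    refine ⟨_, s', .ite_false hb hr, ?_, h⟩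
    have : b.cost + 1 ≤ (b.cost + 1) * (X + 1) := Nat.le_mul_of_pos_right _ (by omega)
    simp only [Program.weight, add_mul] at *
    omega

/-- The amortized rule for loops: the invariant `I s φ` has a budget `φ`, and every iteration pays from
the budget. -/
theorem Tri.while {b : Test} {p : Program} {Q : State → Prop} (I : State → ℕ → Prop) (s₀ : State)
    (hstep : ∀ s φ, Frame (.while b p) s₀ s → I s φ → b.eval s →
      ∃ x φ', φ' + x + 1 ≤ φ ∧ Tri p s x (fun s' => I s' φ'))
    (hdone : ∀ s φ, Frame (.while b p) s₀ s → I s φ → ¬ b.eval s → Q s)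
    (φ : ℕ) (h : I s₀ φ) : Tri (.while b p) s₀ φ Q := by
  suffices H : ∀ φ s, Frame (.while b p) s₀ s → I s φ → Tri (.while b p) s φ Q from
    H φ s₀ (Frame.refl _ _) h
  intro φ
  -- Every iteration uses up at least one unit, so induction on the budget also yields termination.
  induction φ using Nat.strong_induction_on with
  | _ φ ih =>
    intro s hF hI
    by_cases hb : b.eval s
    · obtain ⟨x, φ', hle, t, s', hr, ht, hI'⟩ := hstep s φ hF hI hb
      obtain ⟨t', s'', hr', ht', hQ⟩ := ih φ' (by omega) s'
        (hF.trans (hr.frame.mono (Frame.Le.while _ _))) hI'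
      refine ⟨_, s'', .while_true hb hr hr', ?_, hQ⟩
      -- The remaining iterations take `φ' + 1` shares of the weight and the present one takes `x +
      -- 1`; together these fit into the `φ + 1` shares allotted.
      have h1 : (Program.while b p).weight * (φ' + 1 + (x + 1)) ≤
          (Program.while b p).weight * (φ + 1) := Nat.mul_le_mul_left _ (by omega)
      have h2 : b.cost + 1 ≤ (b.cost + 1) * (x + 1) := Nat.le_mul_of_pos_right _ (by omega)
      have h3 : (Program.while b p).weight * (φ' + 1 + (x + 1)) =
          (Program.while b p).weight * (φ' + 1) + ((b.cost + 1) * (x + 1) + p.weight * (x + 1)) := by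
        simp only [Program.weight]; ring
      omega
    · refine ⟨_, s, .while_false hb, ?_, hdone s φ hF hI hb⟩
      have h2 : b.cost + 1 ≤ (b.cost + 1) * (φ + 1) := Nat.le_mul_of_pos_right _ (by omega)
      simp only [Program.weight, add_mul] at *
      omega

/-! ### Memory contents after an assignment. -/

section State

variable (s : State) (x v y a i : ℕ) (r : ℝ)

@[simp] theorem setNat_nat : (s.setNat x v).nat y = if y = x then v else s.nat y := by
  simp [State.setNat, Function.update_apply]
@[simp] theorem setNat_natArr : (s.setNat x v).natArr = s.natArr := rfl
@[simp] theorem setNat_real : (s.setNat x v).real = s.real := rfl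
@[simp] theorem setNat_realArr : (s.setNat x v).realArr = s.realArr := rfl
@[simp] theorem storeNat_nat : (s.storeNat a i v).nat = s.nat := rfl
@[simp] theorem storeNat_natArr :
    (s.storeNat a i v).natArr y = if y = a then Function.update (s.natArr a) i v else s.natArr y := by
  simp [State.storeNat, Function.update_apply]
@[simp] theorem storeNat_real : (s.storeNat a i v).real = s.real := rfl
@[simp] theorem setReal_nat : (s.setReal x r).nat = s.nat := rfl
@[simp] theorem setReal_real : (s.setReal x r).real y = if y = x then r else s.real y := by
  simp [State.setReal, Function.update_apply]

end State

attribute [simp] NatExp.eval RealExp.eval Test.eval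

end RealRAM

/-! ## The vertices covered by a perfect edge dominating set of a `P₅`-free graph -/

section Structure

variable {V : Type*} (H : SimpleGraph V)

/-- The condition at the vertex `x` for `N` to be the set of the vertices covered by a perfect edge
dominating set: the neighbours of an uncovered vertex are covered; a covered vertex has a covered
neighbour, and only one unless all its neighbours are covered. -/
def CoverGood (N : Set V) (x : V) : Prop :=
  (x ∉ N → ∀ u, H.Adj x u → u ∈ N) ∧
    (x ∈ N → (∃ u, H.Adj x u ∧ u ∈ N) ∧ ((∀ u, H.Adj x u → u ∈ N) ∨
      ∀ u u', H.Adj x u → u ∈ N → H.Adj x u' → u' ∈ N → u = u'))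

/-- The vertices `a`, `b`, `c`, `d`, `e` form an induced path. -/
def IsP5 (a b c d e : V) : Prop :=
  (H.Adj a b ∧ H.Adj b c ∧ H.Adj c d ∧ H.Adj d e) ∧
    ¬ H.Adj a c ∧ ¬ H.Adj a d ∧ ¬ H.Adj a e ∧ ¬ H.Adj b d ∧ ¬ H.Adj b e ∧ ¬ H.Adj c e

/-- No induced path `b`, `x`, `r`, `y`, `a` with `b` not adjacent to `r`. -/
def NoPathThrough (C : Set V) (r a y : V) : Prop :=
  ∀ b ∈ C, b ≠ r → ¬ H.Adj r b → ∀ x, H.Adj r x → H.Adj b x →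
    H.Adj b a ∨ H.Adj b y ∨ H.Adj x y ∨ H.Adj x a

variable {H}

/-- An uncovered vertex lies at distance two, so `a₀` is available. Suppose `a₀` is covered. If an
uncovered `b` were not adjacent to `a₀`, then any other chord of the path `b`, `x`, `r`, `y₀`, `a₀`
would give a covered neighbour of `r` with `b` as an uncovered neighbour and two covered neighbours.
So all uncovered vertices are adjacent to `a₀`, and then `y₀` is the only covered neighbour of `a₀`.
If `a₀` is uncovered, its neighbours are covered, and the same argument with the roles of `a₀` and
`b` exchanged makes every covered vertex at distance two adjacent to `a₀`. -/
theorem cover_cases_root_full {C N : Set V} {r a₀ y₀ : V}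
    (hclosed : ∀ x ∈ C, ∀ u, H.Adj x u → u ∈ C)
    (hr : r ∈ C) (hecc : ∀ b ∈ C, b ≠ r → ¬ H.Adj r b → ∃ x, H.Adj r x ∧ H.Adj b x)
    (hgood : ∀ x ∈ C, CoverGood H N x)
    (ha₀ : (∃ b ∈ C, b ≠ r ∧ ¬ H.Adj r b) → a₀ ∈ C ∧ a₀ ≠ r ∧ ¬ H.Adj r a₀ ∧ H.Adj r y₀ ∧
      H.Adj a₀ y₀ ∧ NoPathThrough H C r a₀ y₀)
    (hrN : r ∈ N) (hfull : ∀ x, H.Adj r x → x ∈ N) :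
    (∀ x ∈ C, x ∈ N) ∨
    (∀ x ∈ C, x ∈ N ↔ ¬ (x ≠ r ∧ ¬ H.Adj r x ∧ H.Adj a₀ x)) ∨
    (∀ x ∈ C, x ∈ N ↔ x = r ∨ H.Adj r x ∨ H.Adj a₀ x) := by
  by_cases hall : ∀ x ∈ C, x ∈ N
  · exact Or.inl hall
  push Not at hall
  obtain ⟨w, hwC, hwN⟩ := hall
  have hwr : w ≠ r := by rintro rfl; exact hwN hrN
  have hw1 : ¬ H.Adj r w := fun h => hwN (hfull _ h)
  obtain ⟨haC, har, hra, hry, hay, hK⟩ := ha₀ ⟨w, hwC, hwr, hw1⟩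
  have hyC := hclosed _ hr _ hry
  have hyr := hry.symm
  have hya := hay.symm
  by_cases haN : a₀ ∈ N
  · right; left
    have key : ∀ b ∈ C, b ∉ N → H.Adj a₀ b := by
      intro b hb hbN
      have hbr : b ≠ r := by rintro rfl; exact hbN hrN
      have hb1 : ¬ H.Adj r b := fun h => hbN (hfull _ h)
      obtain ⟨x, hrx, hbx⟩ := hecc b hb hbr hb1
      have hxC := hclosed _ hr _ hrx
      have hx := ((hgood x hxC).2 (hfull _ hrx)).2
      have hy := ((hgood _ hyC).2 (hfull _ hry)).2
      rcases hK b hb hbr hb1 x hrx hbx with h | h | h | h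
      · exact h.symm
      · exfalso
        rcases hy with hy | hy
        · exact hbN (hy _ h.symm)
        · exact har (hy _ _ hya haN hyr hrN)
      · exfalso
        rcases hx with hx | hx
        · exact hbN (hx _ hbx.symm)
        · exact hry.ne' (hx _ _ h (hfull _ hry) hrx.symm hrN)
      · exfalso
        rcases hx with hx | hx
        · exact hbN (hx _ hbx.symm)
        · exact har (hx _ _ h haN hrx.symm hrN)
    intro x hx
    constructor
    · rintro hxN ⟨hxr, hx1, hax⟩
      rcases ((hgood _ haC).2 haN).2 with h | h
      · exact hwN (h _ (key w hwC hwN))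
      · exact hx1 (h _ _ hay (hfull _ hry) hax hxN ▸ hry)
    · intro h
      by_contra hxN
      exact h ⟨by rintro rfl; exact hxN hrN, fun h => hxN (hfull _ h), key x hx hxN⟩
  · right; right
    intro b hb
    constructor
    · intro hbN
      by_contra hcon
      push Not at hcon
      obtain ⟨hbr, hb1, hba⟩ := hcon
      obtain ⟨x, hrx, hbx⟩ := hecc b hb hbr hb1
      have hxC := hclosed _ hr _ hrx
      have hx := ((hgood x hxC).2 (hfull _ hrx)).2
      have hy := ((hgood _ hyC).2 (hfull _ hry)).2
      rcases hK b hb hbr hb1 x hrx hbx with h | h | h | h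
      · exact hba h.symm
      · rcases hy with hy | hy
        · exact haN (hy _ hya)
        · exact hbr (hy _ _ h.symm hbN hyr hrN)
      · rcases hy with hy | hy
        · exact haN (hy _ hya)
        · exact hrx.ne' (hy _ _ h.symm (hfull _ hrx) hyr hrN)
      · rcases hx with hx | hx
        · exact haN (hx _ h)
        · exact hbr (hx _ _ hbx.symm hbN hrx.symm hrN)
    · rintro (rfl | h | h)
      · exact hrN
      · exact hfull _ h
      · exact (hgood _ haC).1 haN _ h

/-- If all neighbours of `u` are covered, or `u` has no neighbour at distance two from `r`, then
every vertex not adjacent to `r` is covered. Otherwise `r` is the only covered neighbour of `u`, and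
the uncovered vertices at distance two are exactly the neighbours of `u` there. Now the set depends
on `u`, which has to be located: it is the only common neighbour with `r` of any uncovered vertex at
distance two (`hpriv`). It is `y₀` if it is adjacent to `a₀`, and `p` if it is adjacent to the
uncovered `y₀`. Failing both, `a₀` is covered with an uncovered neighbour, so `b₀` and `c₀` are not
both covered, and `u` is `y₁` or `y₂`. -/
theorem cover_cases_root_mate {C N : Set V} {r a₀ y₀ b₀ c₀ p y₁ y₂ u : V}
    (hclosed : ∀ x ∈ C, ∀ u, H.Adj x u → u ∈ C)
    (hr : r ∈ C) (hecc : ∀ b ∈ C, b ≠ r → ¬ H.Adj r b → ∃ x, H.Adj r x ∧ H.Adj b x)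
    (hgood : ∀ x ∈ C, CoverGood H N x)
    (ha₀ : (∃ b ∈ C, b ≠ r ∧ ¬ H.Adj r b) → a₀ ∈ C ∧ a₀ ≠ r ∧ ¬ H.Adj r a₀ ∧ H.Adj r y₀ ∧
      H.Adj a₀ y₀ ∧ NoPathThrough H C r a₀ y₀)
    (hb₀ : (∃ b, ¬ H.Adj r b ∧ H.Adj a₀ b) → ¬ H.Adj r b₀ ∧ H.Adj a₀ b₀ ∧
      H.Adj r y₁ ∧ H.Adj b₀ y₁)
    (hc₀ : (∃ b, ¬ H.Adj r b ∧ H.Adj a₀ b ∧ b ≠ b₀) → ¬ H.Adj r c₀ ∧ H.Adj a₀ c₀ ∧ c₀ ≠ b₀ ∧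
      H.Adj r y₂ ∧ H.Adj c₀ y₂)
    (hp : (∃ x, H.Adj r x ∧ H.Adj y₀ x) → H.Adj r p ∧ H.Adj y₀ p)
    (hrN : r ∈ N) (hru : H.Adj r u) (huN : u ∈ N)
    (huniq : ∀ x, H.Adj r x → x ∈ N → x = u) :
    (∀ x ∈ C, x ∈ N ↔ ¬ H.Adj r x ∨ x = u) ∨
    ((u = y₀ ∨ u = p ∨ u = y₁ ∨ u = y₂) ∧
      ∀ x ∈ C, x ∈ N ↔ x = r ∨ x = u ∨ (x ≠ r ∧ ¬ H.Adj r x ∧ ¬ H.Adj u x)) := by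
  have huC := hclosed _ hr _ hru
  have hgu := (hgood u huC).2 huN
  -- a vertex at distance two with a neighbour other than `u` at distance one is covered
  have hcov : ∀ b t, H.Adj r t → H.Adj b t → t ≠ u → b ∈ N := by
    intro b t hrt hbt htu
    exact (hgood t (hclosed _ hr _ hrt)).1 (fun h => htu (huniq _ hrt h)) _ hbt.symm
  by_cases huf : ∀ x, H.Adj u x → x ∈ N
  · left
    intro x hx
    constructor
    · intro hxN
      by_cases h : H.Adj r x
      · exact Or.inr (huniq _ h hxN)
      · exact Or.inl h
    · rintro (h | rfl)
      · by_cases hxr : x = r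
        · exact hxr ▸ hrN
        obtain ⟨t, hrt, hxt⟩ := hecc x hx hxr h
        by_cases htu : t = u
        · exact huf _ (htu ▸ hxt.symm)
        · exact hcov _ _ hrt hxt htu
      · exact huN
  have huu : ∀ x, H.Adj u x → x ∈ N → x = r := fun x hux hx =>
    (hgu.2.resolve_left huf) _ _ hux hx hru.symm hrN
  have hN : ∀ x ∈ C, x ∈ N ↔ x = r ∨ x = u ∨ (x ≠ r ∧ ¬ H.Adj r x ∧ ¬ H.Adj u x) := by
    intro x hx
    constructor
    · intro hxN
      by_cases hxr : x = r
      · exact Or.inl hxr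
      by_cases hxu : x = u
      · exact Or.inr (Or.inl hxu)
      exact Or.inr (Or.inr ⟨hxr, fun h => hxu (huniq _ h hxN), fun h => hxr (huu _ h hxN)⟩)
    · rintro (rfl | rfl | ⟨hxr, h1, h2⟩)
      · exact hrN
      · exact huN
      · obtain ⟨t, hrt, hxt⟩ := hecc x hx hxr h1
        exact hcov _ _ hrt hxt (by rintro rfl; exact h2 hxt.symm)
  by_cases hc : ∃ c, H.Adj u c ∧ ¬ H.Adj r c ∧ c ≠ r
  swap
  · left
    push Not at hc
    intro x hx
    rw [hN x hx]
    constructor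
    · rintro (rfl | rfl | h)
      · exact Or.inl (H.loopless.irrefl _)
      · exact Or.inr rfl
      · exact Or.inl h.2.1
    · rintro (h | rfl)
      · by_cases hxr : x = r
        · exact Or.inl hxr
        · exact Or.inr (Or.inr ⟨hxr, h, fun h' => hxr (hc _ h' h)⟩)
      · exact Or.inr (Or.inl rfl)
  obtain ⟨c, huc, hrc, hcr⟩ := hc
  refine Or.inr ⟨?_, hN⟩
  have hcC := hclosed _ huC _ huc
  obtain ⟨haC, har, hra, hry, hay, hK⟩ := ha₀ ⟨c, hcC, hcr, hrc⟩
  have hyC := hclosed _ hr _ hry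
  -- uncovered vertices at distance two have `u` as their only neighbour at distance one
  have hpriv : ∀ b ∈ C, b ∉ N → ∀ t, H.Adj r t → H.Adj b t → t = u := by
    intro b _ hbN t hrt hbt
    by_contra h
    exact hbN (hcov _ _ hrt hbt h)
  by_cases hua : H.Adj u a₀
  · left
    exact (hpriv a₀ haC (fun h => har (huu _ hua h)) _ hry hay).symm
  have hyu : y₀ ≠ u := by rintro rfl; exact hua hay.symm
  have hyN : y₀ ∉ N := fun h => hyu (huniq _ hry h)
  by_cases huy : H.Adj y₀ u
  · right; left
    obtain ⟨h1, h2⟩ := hp ⟨u, hru, huy⟩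
    exact (huniq _ h1 ((hgood _ hyC).1 hyN _ h2)).symm
  have hcN : c ∉ N := fun h => hcr (huu _ huc h)
  -- Of the possible chords of the path `c`, `u`, `r`, `y₀`, `a₀`, all but the one between its ends
  -- are excluded.
  have hac : H.Adj a₀ c := by
    rcases hK c hcC hcr hrc u hru huc.symm with h | h | h | h
    · exact h.symm
    · exact absurd ((hgood _ hcC).1 hcN _ h) hyN
    · exact absurd h.symm huy
    · exact absurd h hua
  have haN : a₀ ∈ N := hcov _ _ hry hay hyu
  obtain ⟨hb1, hab, hry1, hby1⟩ := hb₀ ⟨c, hrc, hac⟩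
  have hbC := hclosed _ haC _ hab
  by_cases hbN : b₀ ∈ N
  · have hcb : c ≠ b₀ := by rintro rfl; exact hcN hbN
    obtain ⟨h1, h2, h3, h4, h5⟩ := hc₀ ⟨c, hrc, hac, hcb⟩
    have hcN' : c₀ ∉ N := by
      intro h
      rcases ((hgood _ haC).2 haN).2 with h' | h'
      · exact hcN (h' _ hac)
      · exact h3 (h' _ _ h2 h hab hbN)
    exact Or.inr (Or.inr (Or.inr (hpriv _ (hclosed _ haC _ h2) hcN' _ h4 h5).symm))
  · exact Or.inr (Or.inr (Or.inl (hpriv _ hbC hbN _ hry1 hby1).symm))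

/-- All neighbours of `r` are covered and see the uncovered `r`, so each has exactly one covered
neighbour. Hence the only possible chord leaves a covered vertex at distance two adjacent to all the
others, provided that `NoPathThrough` is known for it (`hclique`). If this vertex is `a₀`, it is
alone or all its neighbours are covered. If `a₀` is uncovered but has a neighbour `b₀` at distance
two, then `b₀` is covered with an uncovered neighbour, and so it is alone. -/
theorem cover_cases_root_uncovered {C N : Set V} {r a₀ y₀ b₀ y₁ : V}
    (hclosed : ∀ x ∈ C, ∀ u, H.Adj x u → u ∈ C)
    (hr : r ∈ C) (hecc : ∀ b ∈ C, b ≠ r → ¬ H.Adj r b → ∃ x, H.Adj r x ∧ H.Adj b x)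
    (hgood : ∀ x ∈ C, CoverGood H N x) (hnb : ∃ x, H.Adj r x)
    (ha₀ : (∃ b ∈ C, b ≠ r ∧ ¬ H.Adj r b) → a₀ ∈ C ∧ a₀ ≠ r ∧ ¬ H.Adj r a₀ ∧ H.Adj r y₀ ∧
      H.Adj a₀ y₀ ∧ NoPathThrough H C r a₀ y₀)
    (hmin : ∀ b ∈ C, b ≠ r → ¬ H.Adj r b → (∀ x, H.Adj r x → H.Adj b x → H.Adj a₀ x) →
      ∀ x, H.Adj r x → H.Adj a₀ x → H.Adj b x)
    (hb₀ : (∃ b, ¬ H.Adj r b ∧ H.Adj a₀ b) → ¬ H.Adj r b₀ ∧ H.Adj a₀ b₀ ∧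
      H.Adj r y₁ ∧ H.Adj b₀ y₁ ∧ NoPathThrough H C r b₀ y₁)
    (hrN : r ∉ N) :
    (∃ m ∈ C, ∀ x ∈ C, x ∈ N ↔ H.Adj r x ∨ x = m) ∨
    (∀ x ∈ C, x ∈ N ↔ H.Adj r x ∨ x = a₀ ∨ (x ≠ r ∧ ¬ H.Adj r x ∧ H.Adj a₀ x)) := by
  have h1N : ∀ x, H.Adj r x → x ∈ N := (hgood r hr).1 hrN
  have h1u : ∀ x, H.Adj r x → ∀ u u', H.Adj x u → u ∈ N → H.Adj x u' → u' ∈ N → u = u' := by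
    intro x hx
    refine ((hgood x (hclosed _ hr _ hx)).2 (h1N _ hx)).2.resolve_left fun h => ?_
    exact hrN (h _ hx.symm)
  by_cases hM : ∃ m ∈ C, m ∈ N ∧ ¬ H.Adj r m
  swap
  · push Not at hM
    -- A neighbour of the root belongs to the set anyway, so it can play the part of the additional
    -- vertex.
    obtain ⟨x₀, hx₀⟩ := hnb
    refine Or.inl ⟨x₀, hclosed _ hr _ hx₀, fun x hx => ⟨fun h => Or.inl (hM x hx h), ?_⟩⟩
    rintro (h | rfl)
    · exact h1N _ h
    · exact h1N _ hx₀
  obtain ⟨m, hmC, hmN, hrm⟩ := hM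
  have hner : ∀ x, x ∈ N → x ≠ r := by rintro x h rfl; exact hrN h
  obtain ⟨haC, har, hra, hry, hay, hK⟩ := ha₀ ⟨m, hmC, hner m hmN, hrm⟩
  -- the covered vertices at distance two are adjacent to a given one
  have hclique : ∀ a y, a ∈ N → H.Adj r y → H.Adj a y → NoPathThrough H C r a y →
      ∀ m ∈ C, m ∈ N → ¬ H.Adj r m → m ≠ a → H.Adj a m := by
    intro a y haN hry hay hK m hmC hmN hrm hma
    obtain ⟨x, hrx, hmx⟩ := hecc m hmC (hner m hmN) hrm
    rcases hK m hmC (hner m hmN) hrm x hrx hmx with h | h | h | h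
    · exact h.symm
    · exact absurd (h1u y hry _ _ h.symm hmN hay.symm haN) hma
    · exact absurd (h1u x hrx _ _ h (h1N _ hry) hmx.symm hmN ▸ hry) hrm
    · exact absurd (h1u x hrx _ _ hmx.symm hmN h haN) hma
  have single : ∀ a ∈ C, a ∈ N → (∀ m ∈ C, m ∈ N → ¬ H.Adj r m → m = a) →
      ∃ m ∈ C, ∀ x ∈ C, x ∈ N ↔ H.Adj r x ∨ x = m := by
    intro a haC haN h
    refine ⟨a, haC, fun x hx => ⟨fun hxN => ?_, ?_⟩⟩
    · by_cases hrx : H.Adj r x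
      · exact Or.inl hrx
      · exact Or.inr (h x hx hxN hrx)
    · rintro (h | rfl)
      · exact h1N _ h
      · exact haN
  by_cases haN : a₀ ∈ N
  · have hcl := hclique a₀ y₀ haN hry hay hK
    by_cases hone : ∀ m ∈ C, m ∈ N → ¬ H.Adj r m → m = a₀
    · exact Or.inl (single _ haC haN hone)
    right
    push Not at hone
    obtain ⟨m', hmC', hmN', hrm', hma'⟩ := hone
    have hall : ∀ u, H.Adj a₀ u → u ∈ N := by
      refine ((hgood _ haC).2 haN).2.resolve_right fun h => ?_
      exact hrm' (h _ _ hay (h1N _ hry) (hcl m' hmC' hmN' hrm' hma') hmN' ▸ hry)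
    intro x hx
    constructor
    · intro hxN
      by_cases hrx : H.Adj r x
      · exact Or.inl hrx
      by_cases hxa : x = a₀
      · exact Or.inr (Or.inl hxa)
      · exact Or.inr (Or.inr ⟨hner _ hxN, hrx, hcl x hx hxN hrx hxa⟩)
    · rintro (h | rfl | ⟨-, -, h⟩)
      · exact h1N _ h
      · exact haN
      · exact hall _ h
  left
  by_cases hb : ∃ b, ¬ H.Adj r b ∧ H.Adj a₀ b
  · obtain ⟨hrb, hab, hry1, hby1, hK1⟩ := hb₀ hb
    have hbC := hclosed _ haC _ hab
    have hbN : b₀ ∈ N := (hgood _ haC).1 haN _ hab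
    refine single b₀ hbC hbN fun m' hmC' hmN' hrm' => ?_
    by_contra hmb
    have hadj := hclique b₀ y₁ hbN hry1 hby1 hK1 m' hmC' hmN' hrm' hmb
    rcases ((hgood _ hbC).2 hbN).2 with h | h
    · exact haN (h _ hab.symm)
    · exact hrm' (h _ _ hby1 (h1N _ hry1) hadj hmN' ▸ hry1)
  · push Not at hb
    -- If `m` were not adjacent to `y₀`, the missing paths would put all common neighbours of `m`
    -- and `r` among those of `a₀`; the minimality of `a₀` then returns `y₀` as a neighbour of `m`.
    have key : ∀ m ∈ C, m ∈ N → ¬ H.Adj r m → H.Adj y₀ m := by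
      intro m hmC hmN hrm
      by_contra hym
      refine hym (hmin m hmC (hner m hmN) hrm ?_ y₀ hry hay).symm
      intro x hrx hmx
      rcases hK m hmC (hner m hmN) hrm x hrx hmx with h | h | h | h
      · exact absurd h.symm (hb m hrm)
      · exact absurd h.symm hym
      · exact absurd (h1u x hrx _ _ h (h1N _ hry) hmx.symm hmN ▸ hry) hrm
      · exact h.symm
    exact single m hmC hmN fun m' hmC' hmN' hrm' =>
      h1u y₀ hry _ _ (key m' hmC' hmN' hrm') hmN' (key m hmC hmN hrm) hmN

/-- In a graph with breadth first levels `lev` at most three, a suitably chosen vertex has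
eccentricity at most two, unless there is an induced path on five vertices. -/
theorem eccentricity_le_two {C : Set V} {lev : V → ℕ} {par : V → V} {v a x z c b : V}
    {cnt3 cnt2 : V → ℕ}
    (hclosed : ∀ x ∈ C, ∀ u, H.Adj x u → u ∈ C)
    (hlev0 : ∀ x ∈ C, lev x = 0 → x = v) (hlevv : lev v = 0)
    (hlev : ∀ x ∈ C, ∀ u, H.Adj x u → lev u ≤ lev x + 1)
    (hpar : ∀ x ∈ C, x ≠ v → H.Adj x (par x) ∧ lev (par x) + 1 = lev x)
    (hle : ∀ x ∈ C, lev x ≤ 3)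
    (hcnt3 : ∀ y y', (∀ u, H.Adj y u → lev u = 3 → H.Adj y' u) →
      (∃ u, H.Adj y' u ∧ lev u = 3 ∧ ¬ H.Adj y u) → cnt3 y < cnt3 y')
    (hcnt2 : ∀ y y', (∀ u, H.Adj y u → lev u = 2 → H.Adj y' u) →
      (∃ u, H.Adj y' u ∧ lev u = 2 ∧ ¬ H.Adj y u) → cnt2 y < cnt2 y')
    (ha : (∃ a ∈ C, lev a = 2) → a ∈ C ∧ lev a = 2 ∧ ∀ a' ∈ C, lev a' = 2 → cnt3 a' ≤ cnt3 a)
    (hxC : x ∈ C) (hx : lev x = 1) (hxa : H.Adj a x)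
    (hxmax : ∀ x' ∈ C, lev x' = 1 → H.Adj a x' → cnt2 x' ≤ cnt2 x)
    (hzC : z ∈ C)
    (hc : (∃ c, H.Adj a c ∧ lev c = 3 ∧ ¬ H.Adj (par z) c) →
      H.Adj a c ∧ lev c = 3 ∧ ¬ H.Adj (par z) c)
    (hb : (∃ c, H.Adj x c ∧ lev c = 2 ∧ ¬ H.Adj (par z) c) →
      H.Adj x b ∧ lev b = 2 ∧ ¬ H.Adj (par z) b)
    (h1 : ¬ IsP5 H z (par z) v x b) (h2 : ¬ IsP5 H v x a c z) (h3 : ¬ IsP5 H v x a (par z) z)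
    (h4 : ¬ IsP5 H c a (par (par z)) (par z) z) (h5 : ¬ IsP5 H c a x (par (par z)) (par z))
    (h6 : ¬ IsP5 H c a x v (par (par z))) :
    z = x ∨ H.Adj x z ∨ ∃ y, H.Adj x y ∧ H.Adj z y := by
  by_contra! hcon
  obtain ⟨hzx, hxz, hno⟩ := hcon
  have hxv : x ≠ v := by rintro rfl; omega
  have hvx : H.Adj v x := by
    have h := hpar x hxC hxv
    have := hlev0 (par x) (hclosed _ hxC _ h.1) (by omega)
    exact (this ▸ h.1).symm
  have hfar : ∀ y ∈ C, ∀ u, lev y + 2 ≤ lev u → ¬ H.Adj y u := fun y hy u h h' => by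
    have := hlev y hy u h'; omega
  have hvC := hclosed _ hxC _ hvx.symm
  by_cases hzv : z = v
  · exact hxz (hzv ▸ hvx.symm)
  obtain ⟨hzp, hlp⟩ := hpar z hzC hzv
  have hpC := hclosed _ hzC _ hzp
  set p := par z with hpdef
  have hpx : p ≠ x := by rintro h; exact hxz (h ▸ hzp).symm
  have hxp : ¬ H.Adj x p := fun h => hno _ h hzp
  have hz3 := hle z hzC
  have hz : lev z = 1 ∨ lev z = 2 ∨ lev z = 3 := by
    have : lev z ≠ 0 := fun h => hzv (hlev0 z hzC h)
    omega
  rcases hz with hz | hz | hz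
  · have : p = v := hlev0 p hpC (by omega)
    exact hno v hvx.symm (this ▸ hzp)
  -- Level two: if the parent `p` of `z` saw all neighbours of level two of `x`, it would be
  -- adjacent to `a` and, because of `z`, beat `x`. The neighbour `b` that it misses completes the
  -- path `z`, `p`, `v`, `x`, `b`.
  · obtain ⟨haC, hla, hamax⟩ := ha ⟨z, hzC, hz⟩
    have hpv : H.Adj p v := by
      have hne : p ≠ v := by rintro h; rw [h] at hlp; omega
      have h := hpar p hpC hne
      have := hlev0 (par p) (hclosed _ hpC _ h.1) (by omega)
      exact this ▸ h.1
    have hex : ∃ c, H.Adj x c ∧ lev c = 2 ∧ ¬ H.Adj p c := by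
      by_contra! hcon
      have hpa : H.Adj p a := hcon a hxa.symm hla
      have := hxmax p hpC (by omega) hpa.symm
      have := hcnt2 x p hcon ⟨z, hzp.symm, hz, hxz⟩
      omega
    obtain ⟨hxb, hlb, hpb⟩ := hb hex
    have hbC := hclosed _ hxC _ hxb
    exact h1 ⟨⟨hzp, hpv, hvx, hxb⟩, fun h => hfar v hvC z (by omega) h.symm,
      fun h => hxz h.symm, fun h => hno _ hxb h, fun h => hxp h.symm, hpb,
      hfar v hvC b (by omega)⟩
  -- Level three: `a` is not adjacent to `z`, so by its maximality it has a neighbour `c` of level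
  -- three that `p` misses. Writing `g` for the parent of `p`, the hypotheses `h2` to `h5` exclude
  -- in turn the edges `c z`, `a p`, `a g` and `x g`; after this the path in `h6` is induced.
  · obtain ⟨haC, hla, hamax⟩ := ha ⟨p, hpC, by omega⟩
    have haz : ¬ H.Adj a z := fun h => hno a hxa.symm h.symm
    have hpv' : p ≠ v := by rintro h; rw [h] at hlp; omega
    obtain ⟨hpg, hlg⟩ := hpar p hpC hpv'
    have hgC := hclosed _ hpC _ hpg
    set g := par p
    have hgv' : g ≠ v := by rintro h; rw [h] at hlg; omega
    have hgv : H.Adj g v := by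
      have h := hpar g hgC hgv'
      have := hlev0 (par g) (hclosed _ hgC _ h.1) (by omega)
      exact this ▸ h.1
    have hex : ∃ c, H.Adj a c ∧ lev c = 3 ∧ ¬ H.Adj p c := by
      by_contra! hcon
      have := hamax p hpC (by omega)
      have := hcnt3 a p hcon ⟨z, hzp.symm, hz, haz⟩
      omega
    obtain ⟨hac, hlc, hpc⟩ := hc hex
    have hcC := hclosed _ haC _ hac
    have hva : ¬ H.Adj v a := hfar v hvC a (by omega)
    have hvc : ¬ H.Adj v c := hfar v hvC c (by omega)
    have hvz : ¬ H.Adj v z := hfar v hvC z (by omega)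
    have hvp : ¬ H.Adj v p := hfar v hvC p (by omega)
    have hxc : ¬ H.Adj x c := hfar x hxC c (by omega)
    have hgc : ¬ H.Adj g c := hfar g hgC c (by omega)
    have hgz : ¬ H.Adj g z := hfar g hgC z (by omega)
    have hcz : ¬ H.Adj c z := fun h =>
      h2 ⟨⟨hvx, hxa.symm, hac, h⟩, hva, hvc, hvz, hxc, hxz, haz⟩
    have hap : ¬ H.Adj a p := fun h =>
      h3 ⟨⟨hvx, hxa.symm, h, hzp.symm⟩, hva, hvp, hvz, hxp, hxz, haz⟩
    have hag : ¬ H.Adj a g := fun h =>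
      h4 ⟨⟨hac.symm, h, hpg.symm, hzp.symm⟩, fun h => hgc h.symm, fun h => hpc h.symm, hcz, hap,
        haz, hgz⟩
    have hxg : ¬ H.Adj x g := fun h =>
      h5 ⟨⟨hac.symm, hxa, h, hpg.symm⟩, fun h => hxc h.symm, fun h => hgc h.symm,
        fun h => hpc h.symm, hag, hap, hxp⟩
    exact h6 ⟨⟨hac.symm, hxa, hvx.symm, hgv.symm⟩, fun h => hxc h.symm, fun h => hvc h.symm,
      fun h => hgc h.symm, fun h => hva h.symm, hag, hxg⟩

/-- A vertex of level at least four is the end of an induced path on five vertices. -/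
theorem isP5_of_level {C : Set V} {lev : V → ℕ} {par : V → V} {v z : V}
    (hclosed : ∀ x ∈ C, ∀ u, H.Adj x u → u ∈ C) (hlevv : lev v = 0)
    (hlev : ∀ x ∈ C, ∀ u, H.Adj x u → lev u ≤ lev x + 1)
    (hpar : ∀ x ∈ C, x ≠ v → H.Adj x (par x) ∧ lev (par x) + 1 = lev x)
    (hz : z ∈ C) (h4 : 4 ≤ lev z) :
    IsP5 H z (par z) (par (par z)) (par (par (par z))) (par (par (par (par z)))) := by
  have hne : ∀ x, 0 < lev x → x ≠ v := by rintro x h rfl; omega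
  obtain ⟨a1, l1⟩ := hpar z hz (hne _ (by omega))
  have hc1 := hclosed _ hz _ a1
  obtain ⟨a2, l2⟩ := hpar _ hc1 (hne _ (by omega))
  have hc2 := hclosed _ hc1 _ a2
  obtain ⟨a3, l3⟩ := hpar _ hc2 (hne _ (by omega))
  have hc3 := hclosed _ hc2 _ a3
  obtain ⟨a4, l4⟩ := hpar _ hc3 (hne _ (by omega))
  have hc4 := hclosed _ hc3 _ a4
  have hfar : ∀ y ∈ C, ∀ u, lev y + 2 ≤ lev u → ¬ H.Adj u y := fun y hy u h h' => by
    have := hlev y hy u h'.symm; omega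
  exact ⟨⟨a1, a2, a3, a4⟩, hfar _ hc2 _ (by omega), hfar _ hc3 _ (by omega),
    hfar _ hc4 _ (by omega), hfar _ hc3 _ (by omega), hfar _ hc4 _ (by omega),
    hfar _ hc4 _ (by omega)⟩

end Structure

/-! ## Variables and arrays of the program -/

notation "vFlag" => (6 : ℕ)
notation "vJ" => (7 : ℕ)
notation "vU" => (8 : ℕ)
notation "vCnt" => (9 : ℕ)
notation "vLast" => (10 : ℕ)
notation "vI" => (11 : ℕ)
notation "vX" => (12 : ℕ)
notation "vLo" => (13 : ℕ)
notation "vHi" => (14 : ℕ)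
notation "vHead" => (15 : ℕ)
notation "vOk" => (16 : ℕ)
notation "vStart" => (17 : ℕ)
notation "vBad" => (18 : ℕ)
notation "vUpd" => (19 : ℕ)
notation "vHas" => (20 : ℕ)
notation "vBestAdd" => (21 : ℕ)
notation "vFound" => (22 : ℕ)
notation "vArg" => (23 : ℕ)
notation "vArgCnt" => (24 : ℕ)
notation "vFar" => (25 : ℕ)
notation "vAnc1" => (26 : ℕ)
notation "vAnc2" => (27 : ℕ)
notation "vAnc3" => (28 : ℕ)
notation "vAnc4" => (29 : ℕ)
notation "vA" => (30 : ℕ)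
notation "vRoot" => (31 : ℕ)
notation "vA₀" => (32 : ℕ)
notation "vC" => (33 : ℕ)
notation "vB" => (34 : ℕ)
notation "vY₀" => (35 : ℕ)
notation "vB₀" => (36 : ℕ)
notation "vC₀" => (37 : ℕ)
notation "vP" => (38 : ℕ)
notation "vY₁" => (39 : ℕ)
notation "vY₂" => (40 : ℕ)
notation "vKB" => (41 : ℕ)
notation "vKX" => (42 : ℕ)
notation "vOut" => (43 : ℕ)
notation "aQueue" => (4 : ℕ)
notation "aLev" => (5 : ℕ)
notation "aPar" => (6 : ℕ)
notation "aDist" => (7 : ℕ)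
notation "aMark" => (8 : ℕ)
notation "aCand" => (9 : ℕ)
notation "aBest" => (10 : ℕ)
notation "aIn" => (11 : ℕ)
notation "aOut" => (12 : ℕ)
notation "aBad" => (13 : ℕ)
notation "rSum" => (0 : ℕ)
notation "rBase" => (1 : ℕ)
notation "rCost" => (2 : ℕ)
notation "rBest" => (3 : ℕ)

namespace RealRAM

open Finset
open scoped Classical

/-! ## The input and its components -/

/-- A weighted graph on the vertices `0, …, n - 1` with its adjacency lists. -/
structure Net where
  n : ℕ
  H : SimpleGraph ℕ
  nb : ℕ → Finset ℕ
  w : ℕ → ℕ → ℝ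
  off : ℕ → ℕ
  nbr : ℕ → ℕ
  wt : ℕ → ℝ
  mem_nb : ∀ {x u}, u ∈ nb x ↔ H.Adj x u
  lt : ∀ {x u}, H.Adj x u → x < n
  w_comm : ∀ x u, w x u = w u x
  mono : ∀ x < n, off x ≤ off (x + 1)
  bij : ∀ x < n, Set.BijOn nbr (Set.Ico (off x) (off (x + 1))) (nb x)
  wt_eq : ∀ x < n, ∀ j ∈ Set.Ico (off x) (off (x + 1)), wt j = w x (nbr j)

/-- The state holds the input. -/
structure Holds (g : Net) (s : State) : Prop where
  size : s.nat 0 = g.n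
  off : s.natArr 0 = g.off
  nbr : s.natArr 1 = g.nbr
  wt : s.realArr 0 = g.wt

/-- Whether the program leaves the input intact. -/
def Program.keepsInput (p : Program) : Bool :=
  !p.modNat 0 && !p.modNatArr 0 && !p.modNatArr 1 && !p.modRealArr 0

theorem Holds.frame {g : Net} {p : Program} {s s' : State} (h : Holds g s) (F : Frame p s s')
    (hp : p.keepsInput = true) : Holds g s' := by
  simp only [Program.keepsInput, Bool.and_eq_true, Bool.not_eq_true'] at hp
  obtain ⟨⟨⟨h0, h1⟩, h2⟩, h3⟩ := hp
  exact ⟨(F.nat _ h0).trans h.size, (F.natArr _ h1).trans h.off, (F.natArr _ h2).trans h.nbr,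
    (F.realArr _ h3).trans h.wt⟩

/-- `C` is a union of connected components. -/
structure Net.Closed (g : Net) (C : Finset ℕ) : Prop where
  lt : ∀ x ∈ C, x < g.n
  adj : ∀ x ∈ C, ∀ u, g.H.Adj x u → u ∈ C

/-- The number of cells needed to describe the vertices in `C` and their neighbours. -/
def Net.size (g : Net) (C : Finset ℕ) : ℕ := ∑ x ∈ C, ((g.nb x).card + 1)

/-- The scan of one neighbourhood is thus covered by the budget of the component. -/
theorem Net.deg_le_size (g : Net) {C : Finset ℕ} {x : ℕ} (hx : x ∈ C) :
    (g.nb x).card ≤ g.size C :=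
  (Nat.le_succ _).trans (Finset.single_le_sum (f := fun x => (g.nb x).card + 1)
    (fun _ _ => Nat.zero_le _) hx)

/-- The state holds the input, and a segment of the queue lists `C`. -/
structure HoldsComp (g : Net) (C : Finset ℕ) (s : State) : Prop extends Holds g s where
  closed : g.Closed C
  queue : Set.BijOn (s.natArr aQueue) (Set.Ico (s.nat vLo) (s.nat vHi)) C

/-- Whether the program leaves the input and the list of the current component intact. -/
def Program.keepsComp (p : Program) : Bool :=
  p.keepsInput && !p.modNat vLo && !p.modNat vHi && !p.modNatArr aQueue

theorem HoldsComp.frame {g : Net} {C : Finset ℕ} {p : Program} {s s' : State}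
    (h : HoldsComp g C s) (F : Frame p s s') (hp : p.keepsComp = true) : HoldsComp g C s' := by
  simp only [Program.keepsComp, Bool.and_eq_true, Bool.not_eq_true'] at hp
  obtain ⟨⟨⟨h0, h1⟩, h2⟩, h3⟩ := hp
  refine ⟨h.toHolds.frame F h0, h.closed, ?_⟩
  rw [F.nat _ h1, F.nat _ h2, F.natArr _ h3]
  exact h.queue

/-! ## Loops over lists -/

/-- Enumeration of a finite set by a segment of an array: the prefixes of the segment. -/
theorem exists_prefix {f : ℕ → ℕ} {lo hi : ℕ} {C : Finset ℕ}
    (h : Set.BijOn f (Set.Ico lo hi) C) {j : ℕ} (hj : lo ≤ j) (hj' : j < hi) :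
    f j ∈ C ∧ f j ∉ (Finset.Ico lo j).image f ∧ (Finset.Ico lo j).image f ⊆ C ∧
      (Finset.Ico lo (j + 1)).image f = insert (f j) ((Finset.Ico lo j).image f) := by
  refine ⟨by exact_mod_cast h.mapsTo ⟨hj, hj'⟩, ?_, ?_, ?_⟩
  · intro hm
    obtain ⟨i, hi', he⟩ := Finset.mem_image.1 hm
    rw [Finset.mem_Ico] at hi'
    have := h.injOn ⟨hi'.1, by omega⟩ ⟨hj, hj'⟩ he
    omega
  · intro y hy
    obtain ⟨i, hi', rfl⟩ := Finset.mem_image.1 hy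
    rw [Finset.mem_Ico] at hi'
    exact_mod_cast h.mapsTo ⟨hi'.1, by omega⟩
  · rw [← Finset.image_insert]
    congr 1
    ext i
    simp only [Finset.mem_Ico, Finset.mem_insert]
    omega

theorem image_segment {f : ℕ → ℕ} {lo hi : ℕ} {C : Finset ℕ}
    (h : Set.BijOn f (Set.Ico lo hi) C) : (Finset.Ico lo hi).image f = C := by
  apply Finset.coe_injective
  rw [Finset.coe_image, Finset.coe_Ico, h.image_eq]

/-- Loop over the neighbours `vU` of the vertex held by the variable `x`. -/
def forNbr (x : ℕ) (body : Program) : Program :=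
  .setNat vJ (.get 0 (.var x)) ;;
  .while (.lt (.var vJ) (.get 0 (.succ (.var x))))
    (.setNat vU (.get 1 (.var vJ)) ;; body ;; .setNat vJ (.succ (.var vJ)))

/-- The invariant is indexed by the set of the neighbours already visited and not by a position in
the list, so the order of the adjacency lists plays no role afterwards. The body gets the budget
zero: it may only use a bounded number of steps. -/
theorem Tri.forNbr {g : Net} {s : State} {x v : ℕ} {body : Program} {Q : State → Prop}
    (Inv : Finset ℕ → State → Prop) (hs : Holds g s) (hv : s.nat x = v) (hvn : v < g.n)
    (hk : (forNbr x body).keepsInput = true) (hx : (RealRAM.forNbr x body).modNat x = false)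
    (hJ : body.modNat vJ = false)
    (hinv : ∀ D s k, Inv D s → Inv D (s.setNat vJ k))
    (hinv' : ∀ D s k, Inv D s → Inv D (s.setNat vU k))
    (h0 : Inv ∅ s)
    (hstep : ∀ D u s₁, Frame (forNbr x body) s s₁ → D ⊆ g.nb v → u ∈ g.nb v → u ∉ D →
      s₁.nat vU = u → s₁.realArr 0 (s₁.nat vJ) = g.w v u → Inv D s₁ →
      Tri body s₁ 0 (Inv (insert u D)))
    (hQ : ∀ s', Inv (g.nb v) s' → Q s') :
    Tri (forNbr x body) s (g.nb v).card Q := by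
  have hbij := g.bij v hvn
  have hcard : (g.nb v).card = g.off (v + 1) - g.off v := by
    rw [← image_segment hbij, Finset.card_image_of_injOn, Nat.card_Ico]
    simpa using hbij.injOn
  refine Tri.setNat_seq ?_
  have hF0 : Frame (RealRAM.forNbr x body) s (s.setNat vJ (NatExp.eval s (.get 0 (.var x)))) := by
    refine ⟨fun y hy => ?_, fun _ _ => rfl, fun _ _ => rfl, fun _ _ => rfl⟩
    simp [RealRAM.forNbr, Program.modNat] at hy
    simp [hy]
  set s₀ := s.setNat vJ (NatExp.eval s (.get 0 (.var x))) with hs₀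
  have hxs : ∀ s', Frame (RealRAM.forNbr x body) s s' → s'.nat x = v := fun s' h =>
    (h.nat x hx).trans hv
  have hFl : ∀ s', Frame (.while (.lt (.var vJ) (.get 0 (.succ (.var x))))
      (.setNat vU (.get 1 (.var vJ)) ;; body ;; .setNat vJ (.succ (.var vJ)))) s₀ s' →
      Frame (RealRAM.forNbr x body) s s' := fun s' h => hF0.trans (h.mono (Frame.Le.right _ _))
  refine Tri.while (I := fun s' φ => g.off v ≤ s'.nat vJ ∧ s'.nat vJ ≤ g.off (v + 1) ∧
    φ = g.off (v + 1) - s'.nat vJ ∧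
    Inv ((Finset.Ico (g.off v) (s'.nat vJ)).image g.nbr) s') s₀ ?_ ?_ _ ?_
  · rintro s₁ φ hF ⟨hlo, -, rfl, hI⟩ hb
    have hF := hFl _ hF
    have hc := hs.frame hF hk
    simp only [Test.eval, NatExp.eval, hxs _ hF, hc.off] at hb
    obtain ⟨hm, hn, hsub, hins⟩ := exists_prefix hbij hlo hb
    refine ⟨0, g.off (v + 1) - (s₁.nat vJ + 1), by omega, ?_⟩
    refine Tri.setNat_seq ?_
    set s₂ := s₁.setNat vU (NatExp.eval s₁ (.get 1 (.var vJ))) with hs₂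
    have hF2 : Frame (RealRAM.forNbr x body) s s₂ := by
      refine hF.trans ⟨fun y hy => ?_, fun _ _ => rfl, fun _ _ => rfl, fun _ _ => rfl⟩
      simp [RealRAM.forNbr, Program.modNat] at hy
      simp [hs₂, hy]
    have hJ2 : s₂.nat vJ = s₁.nat vJ := by simp [hs₂]
    have hbody := hstep _ _ s₂ hF2 hsub hm hn (by simp [hs₂, hc.nbr])
      (by rw [hJ2]; simp only [hs₂, setNat_realArr, hc.wt]; exact g.wt_eq v hvn _ ⟨hlo, hb⟩)
      (hinv' _ _ _ hI)
    refine hbody.bind fun s₃ hF3 hI3 => Tri.setNat ?_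
    have hJ3 : s₃.nat vJ = s₁.nat vJ := (hF3.nat _ hJ).trans hJ2
    simp only [setNat_nat, NatExp.eval, hJ3, if_true]
    refine ⟨by omega, hb, trivial, ?_⟩
    rw [hins]
    exact hinv _ _ _ hI3
  · rintro s₁ φ hF ⟨hlo, hhi, -, hI⟩ hb
    have hF := hFl _ hF
    have hc := hs.frame hF hk
    simp only [Test.eval, NatExp.eval, hxs _ hF, hc.off] at hb
    rw [show s₁.nat vJ = g.off (v + 1) by omega, image_segment hbij] at hI
    exact hQ _ hI
  · have : s₀.nat vJ = g.off v := by simp [hs₀, hs.off, hv]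
    rw [this, Finset.Ico_self, Finset.image_empty]
    exact ⟨le_rfl, g.mono v hvn, hcard, hinv _ _ _ h0⟩

/-- Loop over the vertices `vX` of the current component. -/
def forComp (body : Program) : Program :=
  .setNat vI (.var vLo) ;;
  .while (.lt (.var vI) (.var vHi))
    (.setNat vX (.get aQueue (.var vI)) ;; body ;; .setNat vI (.succ (.var vI)))

/-- The body may scan the neighbourhood of its vertex; the degree for this and one unit for the
iteration add up to `Net.size` over the component. -/
theorem Tri.forComp {g : Net} {C : Finset ℕ} {s : State} {body : Program} {Q : State → Prop}
    (Inv : Finset ℕ → State → Prop) (hs : HoldsComp g C s) (hk : (forComp body).keepsComp = true)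
    (hI : body.modNat vI = false)
    (hinv : ∀ D s k, Inv D s → Inv D (s.setNat vI k))
    (hinv' : ∀ D s k, Inv D s → Inv D (s.setNat vX k))
    (h0 : Inv ∅ s)
    (hstep : ∀ D x s₁, Frame (forComp body) s s₁ → D ⊆ C → x ∈ C → x ∉ D →
      s₁.nat vX = x → HoldsComp g C s₁ → Inv D s₁ →
      Tri body s₁ (g.nb x).card (Inv (insert x D)))
    (hQ : ∀ s', Frame (RealRAM.forComp body) s s' → Inv C s' → Q s') :
    Tri (RealRAM.forComp body) s (g.size C) Q := by
  refine Tri.setNat_seq ?_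
  have hF0 : Frame (RealRAM.forComp body) s (s.setNat vI (NatExp.eval s (.var vLo))) := by
    refine ⟨fun y hy => ?_, fun _ _ => rfl, fun _ _ => rfl, fun _ _ => rfl⟩
    simp [RealRAM.forComp, Program.modNat] at hy
    simp [hy]
  set s₀ := s.setNat vI (NatExp.eval s (.var vLo)) with hs₀
  have hFl : ∀ s', Frame (.while (.lt (.var vI) (.var vHi))
      (.setNat vX (.get aQueue (.var vI)) ;; body ;; .setNat vI (.succ (.var vI)))) s₀ s' →
      Frame (RealRAM.forComp body) s s' := fun s' h => hF0.trans (h.mono (Frame.Le.right _ _))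
  have hkk := hk
  simp only [Program.keepsComp, Bool.and_eq_true, Bool.not_eq_true'] at hkk
  obtain ⟨⟨⟨-, hlo'⟩, hhi'⟩, hq'⟩ := hkk
  have hbij := hs.queue
  -- The budget left is the size of the part not yet visited, and each visit releases the degree
  -- plus one.
  have hrest : ∀ j, s.nat vLo ≤ j → j < s.nat vHi →
      (g.size C - g.size ((Finset.Ico (s.nat vLo) (j + 1)).image (s.natArr aQueue)))
        + (g.nb (s.natArr aQueue j)).card + 1 ≤
      g.size C - g.size ((Finset.Ico (s.nat vLo) j).image (s.natArr aQueue)) := by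
    intro j hj hj'
    obtain ⟨hm, hn, hsub, hins⟩ := exists_prefix hbij hj hj'
    have h1 : g.size ((Finset.Ico (s.nat vLo) (j + 1)).image (s.natArr aQueue)) =
        (g.nb (s.natArr aQueue j)).card + 1 +
          g.size ((Finset.Ico (s.nat vLo) j).image (s.natArr aQueue)) := by
      rw [hins]; exact Finset.sum_insert hn
    have h2 : g.size ((Finset.Ico (s.nat vLo) (j + 1)).image (s.natArr aQueue)) ≤ g.size C := by
      rw [hins]
      exact Finset.sum_le_sum_of_subset (Finset.insert_subset hm hsub)
    omega
  -- The second alternative is for an empty segment, whose upper end may lie below the lower one.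
  refine Tri.while (I := fun s' φ => s.nat vLo ≤ s'.nat vI ∧ (s'.nat vI ≤ s.nat vHi ∨
      s.nat vHi ≤ s.nat vLo ∧ s'.nat vI = s.nat vLo) ∧
    φ = g.size C - g.size ((Finset.Ico (s.nat vLo) (s'.nat vI)).image (s.natArr aQueue)) ∧
    Inv ((Finset.Ico (s.nat vLo) (s'.nat vI)).image (s.natArr aQueue)) s') s₀ ?_ ?_ _ ?_
  · rintro s₁ φ hF ⟨hlo, -, rfl, hInv⟩ hb
    have hF := hFl _ hF
    have hc := hs.frame hF hk
    simp only [Test.eval, NatExp.eval, hF.nat _ hhi'] at hb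
    obtain ⟨hm, hn, hsub, hins⟩ := exists_prefix hbij hlo hb
    refine ⟨_, _, hrest _ hlo hb, ?_⟩
    refine Tri.setNat_seq ?_
    set s₂ := s₁.setNat vX (NatExp.eval s₁ (.get aQueue (.var vI))) with hs₂
    have hF2 : Frame (RealRAM.forComp body) s s₂ := by
      refine hF.trans ⟨fun y hy => ?_, fun _ _ => rfl, fun _ _ => rfl, fun _ _ => rfl⟩
      simp [RealRAM.forComp, Program.modNat] at hy
      simp [hs₂, hy]
    have hI2 : s₂.nat vI = s₁.nat vI := by simp [hs₂]
    have hbody := hstep _ _ s₂ hF2 hsub hm hn (by simp [hs₂, hF.natArr _ hq'])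
      (hs.frame hF2 hk) (hinv' _ _ _ hInv)
    refine hbody.bind fun s₃ hF3 hI3 => Tri.setNat ?_
    have hJ3 : s₃.nat vI = s₁.nat vI := (hF3.nat _ hI).trans hI2
    simp only [setNat_nat, NatExp.eval, hJ3, if_true]
    refine ⟨by omega, Or.inl hb, trivial, ?_⟩
    rw [hins]
    exact hinv _ _ _ hI3
  · rintro s₁ φ hF ⟨hlo, hhi, -, hInv⟩ hb
    have hF := hFl _ hF
    simp only [Test.eval, NatExp.eval, hF.nat _ hhi'] at hb
    refine hQ _ hF ?_
    rcases hhi with hhi | ⟨h1, h2⟩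
    · rw [show s₁.nat vI = s.nat vHi by omega, image_segment hbij] at hInv
      exact hInv
    · rw [h2, Finset.Ico_self, Finset.image_empty] at hInv
      have : C = ∅ := by rw [← image_segment hbij, Finset.Ico_eq_empty (by omega),
        Finset.image_empty]
      rw [this]; exact hInv
  · have : s₀.nat vI = s.nat vLo := by simp [hs₀]
    rw [this, Finset.Ico_self, Finset.image_empty]
    refine ⟨le_rfl, ?_, by simp [Net.size], hinv _ _ _ h0⟩
    omega

/-! ## Scanning the neighbours of a vertex -/

/-- The number of neighbours of `x` with the property `p`. -/
noncomputable def Net.count (g : Net) (x : ℕ) (p : ℕ → Prop) : ℕ := ((g.nb x).filter p).card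

/-- The total weight of the edges from `x` to neighbours with the property `p`. -/
noncomputable def Net.sum (g : Net) (x : ℕ) (p : ℕ → Prop) : ℝ := ∑ u ∈ (g.nb x).filter p, g.w x u

theorem Net.count_eq_zero {g : Net} {x : ℕ} {p : ℕ → Prop} :
    g.count x p = 0 ↔ ∀ u, g.H.Adj x u → ¬ p u := by
  rw [Net.count, Finset.card_eq_zero, Finset.filter_eq_empty_iff]
  exact ⟨fun h u hu => h (g.mem_nb.2 hu), fun h u hu => h u (g.mem_nb.1 hu)⟩

/-- Counts the neighbours `vU` of the vertex held by `x` that pass the test, adds the weights of the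
edges to them, and records the last one. -/
def scan (x : ℕ) (t : Test) : Program :=
  .setNat vCnt (.lit 0) ;; .setReal rSum .zero ;;
  forNbr x (.ite t
    (.setNat vCnt (.succ (.var vCnt)) ;; .setNat vLast (.var vU) ;;
      .setReal rSum (.add (.var rSum) (.get 0 (.var vJ))))
    .skip)

/-- The test `t` decides whether the vertex held by the variable `x` has the property `p`, in all states
that agree with `s` outside the work variables of a scan. -/
def Decides (t : Test) (x : ℕ) (s : State) (p : ℕ → Prop) : Prop :=
  ∀ s₁ : State, (∀ a, s₁.natArr a = s.natArr a) →
    (∀ y, y ≠ vJ → y ≠ vU → y ≠ vCnt → y ≠ vLast → y ≠ x → s₁.nat y = s.nat y) →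
    (t.eval s₁ ↔ p (s₁.nat x))

/-- The property `p` is fixed in advance whereas the test is read in changing states; `Decides` asks
only that they agree as long as nothing but the scan's own variables changes. -/
theorem scan_spec {g : Net} {s : State} {x v : ℕ} {t : Test} (p : ℕ → Prop) (hs : Holds g s)
    (hv : s.nat x = v) (hvn : v < g.n) (hx : (scan x t).modNat x = false)
    (ht : Decides t vU s p) :
    Tri (scan x t) s (g.nb v).card fun s' =>
      s'.nat vCnt = g.count v p ∧
      (s'.nat vCnt ≠ 0 → g.H.Adj v (s'.nat vLast) ∧ p (s'.nat vLast)) ∧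
      s'.real rSum = g.sum v p := by
  have hx' : x ≠ vJ ∧ x ≠ vU ∧ x ≠ vCnt ∧ x ≠ vLast := by
    simp [scan, forNbr, Program.modNat] at hx
    tauto
  obtain ⟨hx1, hx2, hx3, hx4⟩ := hx'
  refine Tri.setNat_seq (Tri.setReal_seq ?_)
  refine Tri.forNbr (fun D s' => s'.nat vCnt = (D.filter p).card ∧
      (s'.nat vCnt ≠ 0 → s'.nat vLast ∈ g.nb v ∧ p (s'.nat vLast)) ∧
      s'.real rSum = ∑ u ∈ D.filter p, g.w v u)
    (g := g) (v := v) ?_ ?_ hvn ?_ ?_ rfl ?_ ?_ ?_ ?_ (fun s' h => by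
      rw [g.mem_nb] at h; exact h)
  · exact ⟨hs.size, hs.off, hs.nbr, hs.wt⟩
  · simp [hx3, hv]
  · rfl
  · simpa [scan, Program.modNat] using And.right (by simpa [scan, Program.modNat] using hx)
  · exact fun _ _ _ h => h
  · exact fun _ _ _ h => h
  · simp
  · rintro D u s₁ hF - hu huD hU hw ⟨h1, h2, h3⟩
    have hev : t.eval s₁ ↔ p u := by
      rw [← hU]
      refine ht s₁ (fun a => ?_) (fun y hy1 hy2 hy3 hy4 _ => ?_)
      · rw [hF.natArr a rfl]; rfl
      · rw [hF.nat y (by simp [forNbr, Program.modNat, *])]; simp [hy3]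
    have hin : p u → (insert u D).filter p = insert u (D.filter p) := fun h => by
      rw [Finset.filter_insert, if_pos h]
    refine Tri.ite (fun h => ?_) (fun h => ?_)
    · rw [hev] at h
      refine Tri.setNat_seq (Tri.setNat_seq (Tri.setReal ?_))
      rw [hin h, Finset.card_insert_of_notMem (by simp [huD]),
        Finset.sum_insert (by simp [huD])]
      simp [h1, h3, hU, h, hu, hw, add_comm]
    · rw [hev] at h
      refine Tri.skip ?_
      rw [Finset.filter_insert, if_neg h]
      exact ⟨h1, h2, h3⟩

/-! ## Subroutines -/

/-- Records in the variable `out` a neighbour `vU` of the vertex held by `x` that passes the test. -/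
def find (x : ℕ) (t : Test) (out : ℕ) : Program :=
  scan x t ;; .ite (.eq (.var vCnt) (.lit 0)) .skip (.setNat out (.var vLast))

theorem find_spec {g : Net} {s : State} {x v out : ℕ} {t : Test} (p : ℕ → Prop) (hs : Holds g s)
    (hv : s.nat x = v) (hvn : v < g.n) (hx : (scan x t).modNat x = false)
    (ho : (scan x t).modNat out = false) (ht : Decides t vU s p) :
    Tri (find x t out) s (g.nb v).card fun s' =>
      ((∃ u, g.H.Adj v u ∧ p u) → g.H.Adj v (s'.nat out) ∧ p (s'.nat out)) ∧
      (s'.nat out = s.nat out ∨ g.H.Adj v (s'.nat out)) := by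
  refine (scan_spec p hs hv hvn hx ht).bind fun s₁ hF ⟨h1, h2, _⟩ => Tri.ite (fun h => ?_) fun h => ?_
  · refine Tri.skip ⟨?_, Or.inl (hF.nat _ ho)⟩
    rintro ⟨u, hu, hpu⟩
    simp only [Test.eval, NatExp.eval] at h
    rw [h1, g.count_eq_zero] at h
    exact absurd hpu (h u hu)
  · refine Tri.setNat ?_
    simp [h2 h]

/-- Stores `k` in the cells of the array `a` that belong to the neighbours of the vertex held by `x`. -/
def setNbrs (a x k : ℕ) : Program := forNbr x (.storeNat a (.var vU) (.lit k))

theorem setNbrs_spec {g : Net} {s : State} {a x v k : ℕ} (hs : Holds g s)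
    (hv : s.nat x = v) (hvn : v < g.n) (hk : (setNbrs a x k).keepsInput = true)
    (hx : (setNbrs a x k).modNat x = false) :
    Tri (setNbrs a x k) s (g.nb v).card fun s' =>
      ∀ u, s'.natArr a u = if g.H.Adj v u then k else s.natArr a u := by
  refine Tri.forNbr (fun D s' => ∀ u, s'.natArr a u = if u ∈ D then k else s.natArr a u)
    hs hv hvn hk hx rfl (fun _ _ _ h => h) (fun _ _ _ h => h) (by simp) ?_ ?_
  · intro D u s₁ _ _ _ _ hU _ hI
    refine Tri.storeNat fun y => ?_
    simp only [NatExp.eval, storeNat_natArr, if_true, hU, Function.update_apply,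
      Finset.mem_insert]
    by_cases h : y = u <;> simp [h, hI]
  · intro s' h u
    simp only [h, g.mem_nb]

/-- Stores `k` in the cells of the array `a` that belong to the vertices of the component. -/
def fill (a k : ℕ) : Program := forComp (.storeNat a (.var vX) (.lit k))

theorem fill_spec {g : Net} {C : Finset ℕ} {s : State} {a k : ℕ} (hs : HoldsComp g C s)
    (hk : (fill a k).keepsComp = true) :
    Tri (fill a k) s (g.size C) fun s' => ∀ u ∈ C, s'.natArr a u = k := by
  refine Tri.forComp (fun D s' => ∀ u ∈ D, s'.natArr a u = k) hs hk rfl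
    (fun _ _ _ h => h) (fun _ _ _ h => h) (by simp) ?_ (fun _ _ h => h)
  intro D x s₁ _ _ _ _ hX _ hI
  refine Tri.storeNat fun y hy => ?_
  simp only [NatExp.eval, storeNat_natArr, if_true, hX, Function.update_apply]
  split_ifs with h
  · rfl
  · exact hI y (by simpa [h] using hy)

/-- Marks the neighbours of the vertex held by `x`. -/
def mark (x : ℕ) : Program := fill aMark 0 ;; setNbrs aMark x 1

theorem mark_spec {g : Net} {C : Finset ℕ} {s : State} {x v : ℕ} (hs : HoldsComp g C s)
    (hv : s.nat x = v) (hvC : v ∈ C) (hx : (mark x).modNat x = false) :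
    Tri (mark x) s (g.size C) fun s' =>
      ∀ u ∈ C, s'.natArr aMark u = if g.H.Adj v u then 1 else 0 := by
  have hx' : x ≠ vI ∧ x ≠ vX ∧ x ≠ vJ ∧ x ≠ vU := by
    simp [mark, fill, setNbrs, forComp, forNbr, Program.modNat] at hx
    tauto
  refine (fill_spec hs rfl).bind fun s₁ hF h => ?_
  refine (setNbrs_spec (hs.frame hF rfl).toHolds (v := v) ?_ (hs.closed.lt v hvC) rfl ?_).wk
    (g.deg_le_size hvC) fun s₂ _ h2 u hu => by rw [h2, h u hu]
  · rw [hF.nat]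
    · exact hv
    · simp [fill, forComp, Program.modNat, hx']
  · simp [setNbrs, forNbr, Program.modNat, hx']

/-- Marks the neighbours of the vertices held by `x` and `y`. -/
def mark₂ (x y : ℕ) : Program := fill aMark 0 ;; setNbrs aMark x 1 ;; setNbrs aMark y 1

theorem mark₂_spec {g : Net} {C : Finset ℕ} {s : State} {x y v v' : ℕ} (hs : HoldsComp g C s)
    (hv : s.nat x = v) (hvC : v ∈ C) (hv' : s.nat y = v') (hvC' : v' ∈ C)
    (hx : (mark₂ x y).modNat x = false) (hy : (mark₂ x y).modNat y = false) :
    Tri (mark₂ x y) s (g.size C) fun s' =>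
      ∀ u ∈ C, s'.natArr aMark u = if g.H.Adj v u ∨ g.H.Adj v' u then 1 else 0 := by
  have hx' : x ≠ vI ∧ x ≠ vX ∧ x ≠ vJ ∧ x ≠ vU := by
    simp [mark₂, fill, setNbrs, forComp, forNbr, Program.modNat] at hx
    tauto
  have hy' : y ≠ vI ∧ y ≠ vX ∧ y ≠ vJ ∧ y ≠ vU := by
    simp [mark₂, fill, setNbrs, forComp, forNbr, Program.modNat] at hy
    tauto
  refine (fill_spec hs rfl).bind fun s₁ hF h => ?_
  refine ((setNbrs_spec (hs.frame hF rfl).toHolds (v := v) ?_ (hs.closed.lt v hvC) rfl ?_).wk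
    (g.deg_le_size hvC) fun s₂ _ h => h).bind fun s₂ hF2 h2 => ?_
  · rw [hF.nat]
    · exact hv
    · simp [fill, forComp, Program.modNat, hx']
  · simp [setNbrs, forNbr, Program.modNat, hx']
  refine (setNbrs_spec ((hs.frame hF rfl).frame hF2 rfl).toHolds (v := v') ?_
    (hs.closed.lt v' hvC') rfl ?_).wk (g.deg_le_size hvC') fun s₃ _ h3 u hu => ?_
  · rw [hF2.nat, hF.nat]
    · exact hv'
    · simp [fill, forComp, Program.modNat, hy']
    · simp [setNbrs, forNbr, Program.modNat, hy']
  · simp [setNbrs, forNbr, Program.modNat, hy']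
  · rw [h3, h2, h u hu]
    split_ifs <;> simp_all

/-- The order on numbers (`true`) or the reverse order (`false`). -/
def ordLe (m : Bool) (a b : ℕ) : Prop := if m then a ≤ b else b ≤ a

/-- Finds a vertex `vX` that passes the test `t` and has the largest (`m = true`) or the smallest
number of neighbours `vU` that pass the test `t'`. -/
def argBest (m : Bool) (t t' : Test) : Program :=
  .setNat vFound (.lit 0) ;; .setNat vArg (.var vStart) ;; .setNat vArgCnt (.lit 0) ;;
  forComp (.ite t
    (scan vX t' ;;
      .ite (.or (.eq (.var vFound) (.lit 0))
          (if m then .lt (.var vArgCnt) (.var vCnt) else .lt (.var vCnt) (.var vArgCnt)))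
        (.setNat vFound (.lit 1) ;; .setNat vArg (.var vX) ;; .setNat vArgCnt (.var vCnt))
        .skip)
    .skip)

/-- The default matters: it keeps the result in `C` when no vertex qualifies, and the last clause
identifies the result in that case, which the choice of the root relies on. -/
theorem argBest_spec {g : Net} {C : Finset ℕ} {s : State} {m : Bool} {t t' : Test} (p q : ℕ → Prop)
    (hs : HoldsComp g C s) (hv : s.nat vStart ∈ C)
    (ht : ∀ s₁, Frame (argBest m t t') s s₁ → (t.eval s₁ ↔ p (s₁.nat vX)))
    (ht' : ∀ s₁, Frame (argBest m t t') s s₁ → Decides t' vU s₁ q) :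
    Tri (argBest m t t') s (g.size C) fun s' =>
      s'.nat vArg ∈ C ∧ ((∃ x ∈ C, p x) → p (s'.nat vArg) ∧ ∀ x ∈ C, p x →
        ordLe m (g.count x q) (g.count (s'.nat vArg) q)) ∧
      ((∀ x ∈ C, ¬ p x) → s'.nat vArg = s.nat vStart) := by
  refine Tri.setNat_seq (Tri.setNat_seq (Tri.setNat_seq ?_))
  set s₀ := ((s.setNat vFound (NatExp.eval s (.lit 0))).setNat vArg
    (NatExp.eval (s.setNat vFound (NatExp.eval s (.lit 0))) (.var vStart))).setNat vArgCnt 0 with hs₀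
  have hF0 : Frame (argBest m t t') s s₀ := by
    refine ⟨fun y hy => ?_, fun _ _ => rfl, fun _ _ => rfl, fun _ _ => rfl⟩
    simp [argBest, Program.modNat] at hy
    simp [hs₀, hy]
  have hFl : ∀ s', Frame (forComp _) s₀ s' → Frame (argBest m t t') s s' := fun s' h =>
    hF0.trans (((h.mono (Frame.Le.right _ _)).mono (Frame.Le.right _ _)).mono (Frame.Le.right _ _))
  refine Tri.forComp (fun D s' => s'.nat vArg ∈ C ∧ (s'.nat vFound = 0 → (∀ x ∈ D, ¬ p x) ∧ s'.nat vArg = s.nat vStart) ∧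
    (s'.nat vFound ≠ 0 → p (s'.nat vArg) ∧
      s'.nat vArgCnt = (g.count (s'.nat vArg) q) ∧
      ∀ x ∈ D, p x → ordLe m (g.count x q) (s'.nat vArgCnt)))
    (hs.frame hF0 rfl) rfl rfl ?_ ?_ ?_ ?_ ?_
  · exact fun _ _ _ h => h
  · exact fun _ _ _ h => h
  · simpa [hs₀] using hv
  · rintro D x s₁ hF - hxC - hX hc ⟨h1, h2, h3⟩
    have hF := hFl _ hF
    refine Tri.ite (fun h => ?_) (fun h => ?_)
    · have hpx : p x := hX ▸ (ht _ hF).1 h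
      refine (scan_spec q hc.toHolds hX (hc.closed.lt x hxC) rfl (ht' _ hF)).bind
        fun s₂ hF2 ⟨hcnt, _, _⟩ => ?_
      have e1 : s₂.nat vX = x := (hF2.nat _ rfl).trans hX
      have e2 : s₂.nat vArg = s₁.nat vArg := hF2.nat _ rfl
      have e3 : s₂.nat vArgCnt = s₁.nat vArgCnt := hF2.nat _ rfl
      have e4 : s₂.nat vFound = s₁.nat vFound := hF2.nat _ rfl
      have hev : (Test.or (.eq (.var vFound) (.lit 0))
          (if m then .lt (.var vArgCnt) (.var vCnt) else .lt (.var vCnt) (.var vArgCnt))).eval s₂ ↔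
          s₁.nat vFound = 0 ∨ ¬ ordLe m (g.count x q) (s₁.nat vArgCnt) := by
        cases m <;> simp [ordLe, e3, e4, hcnt]
      refine Tri.ite (fun h => ?_) (fun h => ?_)
      · rw [hev] at h
        refine Tri.setNat_seq (Tri.setNat_seq (Tri.setNat ?_))
        simp only [setNat_nat, NatExp.eval, Nat.reduceEqDiff, if_true, if_false, e1, hcnt]
        refine ⟨hxC, by simp, fun _ => ⟨hpx, trivial, fun y hy hpy => ?_⟩⟩
        rcases Finset.mem_insert.1 hy with rfl | hy
        · cases m <;> simp [ordLe]
        · rcases h with h | h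
          · exact absurd hpy ((h2 h).1 y hy)
          · by_cases h0 : s₁.nat vFound = 0
            · exact absurd hpy ((h2 h0).1 y hy)
            · have := (h3 h0).2.2 y hy hpy
              revert this h
              cases m <;> simp [ordLe] <;> omega
      · rw [hev] at h
        push Not at h
        refine Tri.skip ?_
        rw [e2, e3, e4]
        refine ⟨h1, fun h0 => absurd h0 h.1, fun h0 => ⟨(h3 h0).1, (h3 h0).2.1, fun y hy hpy => ?_⟩⟩
        rcases Finset.mem_insert.1 hy with rfl | hy
        · exact h.2
        · exact (h3 h0).2.2 y hy hpy
    · have hpx : ¬ p x := hX ▸ fun h' => h ((ht _ hF).2 h')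
      refine Tri.skip ⟨h1, fun h0 => ⟨fun y hy => ?_, (h2 h0).2⟩, fun h0 => ⟨(h3 h0).1, (h3 h0).2.1, fun y hy hpy => ?_⟩⟩
      · rcases Finset.mem_insert.1 hy with rfl | hy
        · exact hpx
        · exact (h2 h0).1 y hy
      · rcases Finset.mem_insert.1 hy with rfl | hy
        · exact absurd hpy hpx
        · exact (h3 h0).2.2 y hy hpy
  · rintro s' - ⟨h1, h2, h3⟩
    refine ⟨h1, fun ⟨x, hx, hpx⟩ => ?_, fun h => (h2 ?_).2⟩
    · have h0 : s'.nat vFound ≠ 0 := fun h => (h2 h).1 x hx hpx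
      obtain ⟨h4, h5, h6⟩ := h3 h0
      exact ⟨h4, h5 ▸ h6⟩
    · by_contra h0
      exact h _ h1 (h3 h0).1

/-! ## Induced paths -/

/-- Either no induced path has been found, or one is stored. -/
def StoresP5 (g : Net) (s : State) : Prop :=
  s.nat vFlag = 0 ∨
    s.nat vFlag = 1 ∧ IsP5 g.H (s.nat 1) (s.nat 2) (s.nat 3) (s.nat 4) (s.nat 5)

/-- Whether the program leaves the stored path intact. -/
def Program.keepsP5 (p : Program) : Bool :=
  !p.modNat vFlag && !p.modNat 1 && !p.modNat 2 && !p.modNat 3 && !p.modNat 4 && !p.modNat 5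

theorem StoresP5.frame {g : Net} {p : Program} {s s' : State} (h : StoresP5 g s)
    (F : Frame p s s') (hp : p.keepsP5 = true) : StoresP5 g s' := by
  simp only [Program.keepsP5, Bool.and_eq_true, Bool.not_eq_true'] at hp
  obtain ⟨⟨⟨⟨⟨h0, h1⟩, h2⟩, h3⟩, h4⟩, h5⟩ := hp
  unfold StoresP5
  rw [F.nat _ h0, F.nat _ h1, F.nat _ h2, F.nat _ h3, F.nat _ h4, F.nat _ h5]
  exact h

/-- Clears `vOk` unless the adjacency of the vertices held by `x` and `y` is as wanted. -/
def checkAdj (x y : ℕ) (want : Bool) : Program :=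
  scan x (.eq (.var vU) (.var y)) ;;
  .ite (if want then .eq (.var vCnt) (.lit 0) else .not (.eq (.var vCnt) (.lit 0)))
    (.setNat vOk (.lit 0)) .skip

/-- Adjacency is only visible in an adjacency list, so one check costs a degree, and a component can
afford only a bounded number of checks. The bounds by `16` keep the arguments clear of `vOk` and of
the variables of the scan. -/
theorem checkAdj_spec {g : Net} {C : Finset ℕ} {s : State} {x y : ℕ} {b : Bool} (hc : g.Closed C)
    (hs : Holds g s) (hx : 16 < x) (hy : 16 < y) (hxC : s.nat x ∈ C) :
    Tri (checkAdj x y b) s (g.size C) fun s' => (∀ z, 16 < z → s'.nat z = s.nat z) ∧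
      (s'.nat vOk = 1 ↔ s.nat vOk = 1 ∧ (g.H.Adj (s.nat x) (s.nat y) ↔ b = true)) := by
  have hscan : ∀ z, 16 ≤ z → (scan x (.eq (.var vU) (.var y))).modNat z = false := by
    intro z hz
    simp [scan, forNbr, Program.modNat]
    omega
  refine ((scan_spec (fun u => u = s.nat y) hs rfl (hc.lt _ hxC) (hscan x hx.le)
    (fun s₁ _ h => ?_)).wk (g.deg_le_size hxC) fun _ _ h => h).bind fun s₁ hF ⟨h1, _, _⟩ => ?_
  · simp [h y (by omega) (by omega) (by omega) (by omega) (by omega)]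
  have hcnt : s₁.nat vCnt = 0 ↔ ¬ g.H.Adj (s.nat x) (s.nat y) := by
    rw [h1, g.count_eq_zero]
    constructor
    · exact fun h h' => h _ h' rfl
    · rintro h u hu rfl; exact h hu
  have hz : ∀ z, 16 ≤ z → s₁.nat z = s.nat z := fun z hz => hF.nat _ (hscan z hz)
  refine Tri.ite (fun h => ?_) (fun h => ?_)
  · refine Tri.setNat ⟨fun z hz' => ?_, ?_⟩
    · rw [setNat_nat, if_neg (by omega), hz z hz'.le]
    · cases b <;> simp [hcnt] at h ⊢ <;> simp [h]
  · refine Tri.skip ⟨fun z hz' => hz z hz'.le, ?_⟩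
    rw [hz _ le_rfl]
    cases b <;> simp [hcnt] at h ⊢ <;> simp [h]

/-- Stores the path of the vertices held by the five variables, if it is induced. -/
def tryP5 (a b c d e : ℕ) : Program :=
  .setNat vOk (.lit 1) ;;
  checkAdj a b true ;; checkAdj b c true ;; checkAdj c d true ;; checkAdj d e true ;;
  checkAdj a c false ;; checkAdj a d false ;; checkAdj a e false ;;
  checkAdj b d false ;; checkAdj b e false ;; checkAdj c e false ;;
  .ite (.eq (.var vOk) (.lit 1))
    (.setNat vFlag (.lit 1) ;; .setNat 1 (.var a) ;; .setNat 2 (.var b) ;; .setNat 3 (.var c) ;;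
      .setNat 4 (.var d) ;; .setNat 5 (.var e))
    .skip

/-- Every reported path passes through this check of all ten pairs, so the searches that propose
paths need no proof of soundness. The flag is never cleared: if it is zero afterwards, it was zero
before, which allows the outcomes of successive tests to be chained. -/
theorem tryP5_spec {g : Net} {C : Finset ℕ} {s : State} {a b c d e : ℕ} (hc : g.Closed C)
    (hs : Holds g s) (hP : StoresP5 g s)
    (ha : 16 < a ∧ s.nat a ∈ C) (hb : 16 < b ∧ s.nat b ∈ C) (hcc : 16 < c ∧ s.nat c ∈ C)
    (hd : 16 < d ∧ s.nat d ∈ C) (he : 16 < e ∧ s.nat e ∈ C) :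
    Tri (tryP5 a b c d e) s (g.size C) fun s' => StoresP5 g s' ∧
      (s'.nat vFlag = 0 → s.nat vFlag = 0 ∧
        ¬ IsP5 g.H (s.nat a) (s.nat b) (s.nat c) (s.nat d) (s.nat e)) := by
  refine Tri.setNat_seq ?_
  -- one check, given the outcome `P` of the previous ones
  have step : ∀ (x y : ℕ) (w : Bool) (P : Prop) (q : Program) (R : State → Prop) (s₁ : State),
      (16 < x ∧ s.nat x ∈ C) → (16 < y ∧ s.nat y ∈ C) →
      (Holds g s₁ ∧ (∀ z, 16 < z → s₁.nat z = s.nat z) ∧ (∀ z, z < 7 → s₁.nat z = s.nat z) ∧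
        (s₁.nat vOk = 1 ↔ P)) →
      (∀ s₂, (Holds g s₂ ∧ (∀ z, 16 < z → s₂.nat z = s.nat z) ∧
        (∀ z, z < 7 → s₂.nat z = s.nat z) ∧
        (s₂.nat vOk = 1 ↔ P ∧ (g.H.Adj (s.nat x) (s.nat y) ↔ w = true))) →
        Tri q s₂ (g.size C) R) →
      Tri (checkAdj x y w ;; q) s₁ (g.size C) R := by
    rintro x y w P q R s₁ ⟨hx, hxC⟩ ⟨hy, -⟩ ⟨h1, h2, h3, h4⟩ hq
    refine (checkAdj_spec hc h1 hx hy (by rwa [h2 x hx])).bind fun s₂ hF ⟨h5, h6⟩ => hq _ ?_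
    refine ⟨h1.frame hF rfl, fun z hz => (h5 z hz).trans (h2 z hz), fun z hz => ?_, ?_⟩
    · rw [hF.nat z, h3 z hz]
      simp [checkAdj, scan, forNbr, Program.modNat]
      omega
    · rw [h6, h4, h2 x hx, h2 y hy]
  refine step a b true True _ _ _ ha hb ?_ fun s₁ h => ?_
  · refine ⟨⟨hs.size, hs.off, hs.nbr, hs.wt⟩, fun z hz => ?_, fun z hz => ?_, by simp⟩ <;>
      rw [setNat_nat, if_neg (by omega)]
  refine step _ _ _ _ _ _ _ hb hcc h fun s₂ h => ?_
  refine step _ _ _ _ _ _ _ hcc hd h fun s₃ h => ?_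
  refine step _ _ _ _ _ _ _ hd he h fun s₄ h => ?_
  refine step _ _ _ _ _ _ _ ha hcc h fun s₅ h => ?_
  refine step _ _ _ _ _ _ _ ha hd h fun s₆ h => ?_
  refine step _ _ _ _ _ _ _ ha he h fun s₇ h => ?_
  refine step _ _ _ _ _ _ _ hb hd h fun s₈ h => ?_
  refine step _ _ _ _ _ _ _ hb he h fun s₉ h => ?_
  refine step _ _ _ _ _ _ _ hcc he h fun s₁₀ h => ?_
  obtain ⟨-, h2, h3, h4⟩ := h
  have hiff : s₁₀.nat vOk = 1 ↔ IsP5 g.H (s.nat a) (s.nat b) (s.nat c) (s.nat d) (s.nat e) := by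
    rw [h4]; simp only [IsP5, true_and, iff_true, Bool.false_eq_true, iff_false, and_assoc]
  refine Tri.ite (fun h => ?_) (fun h => ?_)
  · refine Tri.setNat_seq (Tri.setNat_seq (Tri.setNat_seq (Tri.setNat_seq (Tri.setNat_seq
      (Tri.setNat ⟨Or.inr ?_, ?_⟩)))))
    · have h := hiff.1 h
      have n6 : ∀ z i, 16 < z → i ≤ 6 → ¬ (z = i) := by intros; omega
      simpa [n6 b _ hb.1, n6 c _ hcc.1, n6 d _ hd.1, n6 e _ he.1, n6 a _ ha.1, h2 a ha.1,
        h2 b hb.1, h2 c hcc.1, h2 d hd.1, h2 e he.1] using h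
    · simp
  · refine Tri.skip ⟨?_, fun h0 => ⟨?_, fun h' => h (hiff.2 h')⟩⟩
    · unfold StoresP5
      rw [h3 _ (by omega), h3 _ (by omega), h3 _ (by omega), h3 _ (by omega), h3 _ (by omega),
        h3 _ (by omega)]
      exact hP
    · rwa [h3 _ (by omega)] at h0

/-- Looks for an induced path `b`, `x`, root, `y`, `a` through the vertices held by the variables `y`
and `a`. -/
def checkPaths (a y : ℕ) : Program :=
  mark₂ a y ;; .setNat vKB (.var vStart) ;; .setNat vKX (.var vStart) ;;
  forComp (.ite (.and (.eq (.get aDist (.var vX)) (.lit 2)) (.eq (.get aMark (.var vX)) (.lit 0)))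
    (scan vX (.and (.eq (.get aDist (.var vU)) (.lit 1)) (.eq (.get aMark (.var vU)) (.lit 0))) ;;
      .ite (.eq (.var vCnt) (.lit 0)) .skip (.setNat vKB (.var vX) ;; .setNat vKX (.var vLast)))
    .skip) ;;
  tryP5 vKB vKX vRoot y a

/-- The array `aDist` holds the distances `0`, `1` and `2` (for "at least two") from `r`. -/
def HoldsDist (g : Net) (C : Finset ℕ) (r : ℕ) (s : State) : Prop :=
  ∀ u ∈ C, s.natArr aDist u = if u = r then 0 else if g.H.Adj r u then 1 else 2

theorem HoldsDist.eq_two {g : Net} {C : Finset ℕ} {r : ℕ} {s : State} (h : HoldsDist g C r s)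
    {u : ℕ} (hu : u ∈ C) : s.natArr aDist u = 2 ↔ u ≠ r ∧ ¬ g.H.Adj r u := by
  rw [h u hu]; split_ifs <;> simp_all

theorem HoldsDist.eq_one {g : Net} {C : Finset ℕ} {r : ℕ} {s : State} (h : HoldsDist g C r s)
    {u : ℕ} (hu : u ∈ C) : s.natArr aDist u = 1 ↔ g.H.Adj r u := by
  rw [h u hu]; split_ifs <;> simp_all

/-- Once the neighbours of `a` and `y` are marked, the four non-adjacencies required of `b` and `x`
become two lookups, so one pass over the component finds a suitable pair if there is one. Any such
pair completes an induced path, so it does not matter which one is kept for the final test. -/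
theorem checkPaths_spec {g : Net} {C : Finset ℕ} {s : State} {a y r : ℕ} (hs : HoldsComp g C s)
    (hP : StoresP5 g s) (hv : s.nat vStart ∈ C) (hr : s.nat vRoot = r) (hrC : r ∈ C)
    (hd : HoldsDist g C r s) (ha : s.nat a ∈ C) (hy : s.nat y ∈ C)
    (haa : 16 < a ∧ (checkPaths a y).modNat a = false)
    (hyy : 16 < y ∧ (checkPaths a y).modNat y = false) :
    Tri (checkPaths a y) s (g.size C) fun s' => StoresP5 g s' ∧
      (s'.nat vFlag = 0 → s.nat vFlag = 0 ∧
        (g.H.Adj r (s.nat y) → g.H.Adj (s.nat a) (s.nat y) → ¬ g.H.Adj r (s.nat a) →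
          NoPathThrough g.H C r (s.nat a) (s.nat y))) := by
  obtain ⟨ha16, hamod⟩ := haa
  obtain ⟨hy16, hymod⟩ := hyy
  have hm : ∀ z, 16 < z → (mark₂ a y).modNat z = false := by
    intro z hz
    simp [mark₂, fill, setNbrs, forComp, forNbr, Program.modNat]
    omega
  have haKB : a ≠ vKB ∧ a ≠ vKX := by
    simp [checkPaths, forComp, scan, forNbr, Program.modNat] at hamod; tauto
  have hyKB : y ≠ vKB ∧ y ≠ vKX := by
    simp [checkPaths, forComp, scan, forNbr, Program.modNat] at hymod; tauto
  refine (mark₂_spec hs rfl ha rfl hy (hm a ha16) (hm y hy16)).bind fun s₁ hF1 hmark => ?_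
  refine Tri.setNat_seq (Tri.setNat_seq ?_)
  set s₂ := (s₁.setNat vKB (NatExp.eval s₁ (.var vStart))).setNat vKX
    (NatExp.eval (s₁.setNat vKB (NatExp.eval s₁ (.var vStart))) (.var vStart)) with hs2
  have hc2 : HoldsComp g C s₂ := by
    have h := hs.frame hF1 rfl
    exact ⟨⟨h.size, h.off, h.nbr, h.wt⟩, h.closed, h.queue⟩
  have hz2 : ∀ z, 16 < z → z ≠ vKB → z ≠ vKX → s₂.nat z = s.nat z := by
    intro z hz h1 h2
    simp only [hs2, setNat_nat, if_neg h1, if_neg h2, hF1.nat z (hm z hz)]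
  have hflag2 : ∀ z, z < 7 → s₂.nat z = s.nat z := by
    intro z hz
    have : s₁.nat z = s.nat z := hF1.nat z (by
      simp [mark₂, fill, setNbrs, forComp, forNbr, Program.modNat]; omega)
    simp only [hs2, setNat_nat, if_neg (show z ≠ vKB by omega), if_neg (show z ≠ vKX by omega), this]
  have hd2 : HoldsDist g C r s₂ := fun u hu => by
    rw [← hd u hu]; exact congrFun (hF1.natArr aDist rfl) u
  have hm2 : ∀ u ∈ C, s₂.natArr aMark u = 0 ↔ ¬ g.H.Adj u (s.nat a) ∧ ¬ g.H.Adj u (s.nat y) := by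
    intro u hu
    have : s₂.natArr aMark u = s₁.natArr aMark u := rfl
    rw [this, hmark u hu, g.H.adj_comm u, g.H.adj_comm u]
    by_cases h : g.H.Adj (s.nat a) u <;> by_cases h' : g.H.Adj (s.nat y) u <;> simp [h, h']
  have hst1 : s₁.nat vStart = s.nat vStart := hF1.nat _ (hm _ (by omega))
  refine Tri.bind (Q := fun s' =>
    ((s'.nat vKB ∈ C ∧ s'.nat vKX ∈ C) ∧ ((s'.nat vKB ≠ r ∧ ¬ g.H.Adj r (s'.nat vKB) ∧
      g.H.Adj r (s'.nat vKX) ∧ g.H.Adj (s'.nat vKB) (s'.nat vKX) ∧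
      (¬ g.H.Adj (s'.nat vKB) (s.nat a) ∧ ¬ g.H.Adj (s'.nat vKB) (s.nat y)) ∧
      ¬ g.H.Adj (s'.nat vKX) (s.nat a) ∧ ¬ g.H.Adj (s'.nat vKX) (s.nat y)) ∨
      NoPathThrough g.H C r (s.nat a) (s.nat y)))) ?_ ?_
  · refine Tri.forComp (fun D s' => (s'.nat vKB ∈ C ∧ s'.nat vKX ∈ C) ∧
      ((s'.nat vKB ≠ r ∧ ¬ g.H.Adj r (s'.nat vKB) ∧
      g.H.Adj r (s'.nat vKX) ∧ g.H.Adj (s'.nat vKB) (s'.nat vKX) ∧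
      (¬ g.H.Adj (s'.nat vKB) (s.nat a) ∧ ¬ g.H.Adj (s'.nat vKB) (s.nat y)) ∧
      ¬ g.H.Adj (s'.nat vKX) (s.nat a) ∧ ¬ g.H.Adj (s'.nat vKX) (s.nat y)) ∨
      NoPathThrough g.H (D : Set ℕ) r (s.nat a) (s.nat y))) hc2 rfl rfl
      (fun _ _ _ h => h) (fun _ _ _ h => h) ?_ ?_ (fun _ _ h => h)
    · simp [hs2, hst1, hv, NoPathThrough]
    · rintro D x s₃ hF3 hD hxC - hX hc ⟨⟨hb, hx⟩, hI⟩
      have eD : s₃.natArr aDist = s₂.natArr aDist := hF3.natArr _ rfl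
      have eM : s₃.natArr aMark = s₂.natArr aMark := hF3.natArr _ rfl
      have hdone : (∀ z, g.H.Adj r z → g.H.Adj x z → x ≠ r → ¬ g.H.Adj r x →
          g.H.Adj x (s.nat a) ∨ g.H.Adj x (s.nat y) ∨ g.H.Adj z (s.nat y) ∨ g.H.Adj z (s.nat a)) →
          NoPathThrough g.H (D : Set ℕ) r (s.nat a) (s.nat y) →
          NoPathThrough g.H ((insert x D : Finset ℕ) : Set ℕ) r (s.nat a) (s.nat y) := by
        intro h h' b hb hbr hrb z hrz hbz
        simp only [Finset.coe_insert, Set.mem_insert_iff] at hb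
        rcases hb with rfl | hb
        · exact h z hrz hbz hbr hrb
        · exact h' b hb hbr hrb z hrz hbz
      refine Tri.ite (fun h => ?_) (fun h => ?_)
      · simp only [Test.eval, NatExp.eval, hX, eD, eM, hd2.eq_two hxC, hm2 x hxC] at h
        refine (scan_spec (fun u => s₂.natArr aDist u = 1 ∧ s₂.natArr aMark u = 0) hc.toHolds hX
          (hc.closed.lt x hxC) rfl (fun s' h1 _ => ?_)).bind fun s₄ hF4 ⟨h1, h2, _⟩ => ?_
        · simp [h1, eD, eM]
        have e1 : s₄.nat vKB = s₃.nat vKB := hF4.nat _ rfl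
        have e2 : s₄.nat vKX = s₃.nat vKX := hF4.nat _ rfl
        have e3 : s₄.nat vX = x := (hF4.nat _ rfl).trans hX
        refine Tri.ite (fun h0 => ?_) (fun h0 => ?_)
        · refine Tri.skip ?_
          rw [e1, e2]
          refine ⟨⟨hb, hx⟩, hI.imp_right (hdone fun z hrz hxz _ _ => ?_)⟩
          simp only [Test.eval, NatExp.eval] at h0
          rw [h1, g.count_eq_zero] at h0
          have hzC := hc.closed.adj x hxC z hxz
          have := h0 z hxz
          rw [hd2.eq_one hzC, hm2 z hzC] at this
          by_contra! hn
          exact this ⟨hrz, hn.2.2.2, hn.2.2.1⟩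
        · obtain ⟨h4, h5, h6⟩ := h2 h0
          have hlC := hc.closed.adj x hxC _ h4
          rw [hd2.eq_one hlC] at h5
          rw [hm2 _ hlC] at h6
          refine Tri.setNat_seq (Tri.setNat ?_)
          simp only [setNat_nat, NatExp.eval, Nat.reduceEqDiff, if_true, if_false, e3]
          exact ⟨⟨hxC, hlC⟩, Or.inl ⟨h.1.1, h.1.2, h5, h4, h.2, h6⟩⟩
      · simp only [Test.eval, NatExp.eval, hX, eD, eM, hd2.eq_two hxC, hm2 x hxC] at h
        exact Tri.skip ⟨⟨hb, hx⟩, hI.imp_right (hdone fun z _ _ hxr hrx => by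
          by_contra! hn
          exact h ⟨⟨hxr, hrx⟩, hn.1, hn.2.1⟩)⟩
  · rintro s₃ hF3 ⟨⟨hb, hx⟩, hI⟩
    have hz3 : ∀ z, 16 < z → z ≠ vKB → z ≠ vKX → s₃.nat z = s.nat z := by
      intro z hz h1 h2
      rw [hF3.nat z, hz2 z hz h1 h2]
      simp [forComp, scan, forNbr, Program.modNat]
      omega
    have hf3 : ∀ z, z < 7 → s₃.nat z = s.nat z := by
      intro z hz
      rw [hF3.nat z, hflag2 z hz]
      simp [forComp, scan, forNbr, Program.modNat]
      omega
    have ea := hz3 a ha16 haKB.1 haKB.2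
    have ey := hz3 y hy16 hyKB.1 hyKB.2
    have er : s₃.nat vRoot = r := (hz3 _ (by omega) (by omega) (by omega)).trans hr
    refine (tryP5_spec hs.closed (hc2.frame hF3 rfl).toHolds ?_ ⟨by omega, hb⟩ ⟨by omega, hx⟩
      ⟨by omega, er ▸ hrC⟩ ⟨hy16, ey ▸ hy⟩ ⟨ha16, ea ▸ ha⟩).wk le_rfl
      fun s₄ _ ⟨h1, h2⟩ => ⟨h1, fun h0 => ?_⟩
    · unfold StoresP5
      rw [hf3 _ (by omega), hf3 _ (by omega), hf3 _ (by omega), hf3 _ (by omega),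
        hf3 _ (by omega), hf3 _ (by omega)]
      exact hP
    · obtain ⟨h3, h4⟩ := h2 h0
      rw [hf3 _ (by omega)] at h3
      refine ⟨h3, fun hry hay hra => hI.resolve_left ?_⟩
      rintro ⟨-, i2, i3, i4, ⟨i5, i6⟩, i7, i8⟩
      rw [er, ea, ey] at h4
      exact h4 ⟨⟨i4, i3.symm, hry, hay.symm⟩, fun h => i2 h.symm, i6, i5, i8, i7, hra⟩

/-! ## Breadth first search -/

/-- Connectedness is put as an induction principle: what holds at `v` and is inherited along edges
holds on all of `C`. No walks are needed later. -/
theorem Net.exists_component (g : Net) {v : ℕ} (hv : v < g.n) :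
    ∃ C, g.Closed C ∧ v ∈ C ∧
      ∀ S : Set ℕ, v ∈ S → (∀ x ∈ S, ∀ u, g.H.Adj x u → u ∈ S) → ∀ x ∈ C, x ∈ S := by
  refine ⟨(Finset.range g.n).filter (g.H.Reachable v), ⟨fun x hx => ?_, fun x hx u hu => ?_⟩, ?_, ?_⟩
  · simpa using (Finset.mem_filter.1 hx).1
  · have hx := (Finset.mem_filter.1 hx).2
    exact Finset.mem_filter.2 ⟨by simpa using g.lt hu.symm, hx.trans hu.reachable⟩
  · exact Finset.mem_filter.2 ⟨by simpa using hv, SimpleGraph.Reachable.refl _⟩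
  · intro S hvS hS x hx
    obtain ⟨p⟩ := (Finset.mem_filter.1 hx).2
    have : ∀ a b (p : g.H.Walk a b), a ∈ S → b ∈ S := by
      intro a b p
      induction p with
      | nil => exact id
      | cons h _ ih => exact fun ha => ih (hS _ ha _ h)
    exact this _ _ p hvS

/-- The state of a breadth first search from `v` in the component `C`: `q` is the queue, `L` holds the
levels plus one and `P` the parents; `D` is the set of the vertices visited before the search. -/
structure BfsInv (g : Net) (C D : Finset ℕ) (v lo h hi : ℕ) (q L P : ℕ → ℕ) : Prop where
  lo_le : lo ≤ h
  le_hi : h ≤ hi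
  inj : Set.InjOn q (Set.Ico lo hi)
  mem : ∀ i, lo ≤ i → i < hi → q i ∈ C
  seen : ∀ x, L x ≠ 0 ↔ x ∈ D ∨ ∃ i, lo ≤ i ∧ i < hi ∧ q i = x
  start : L v = 1
  start_par : P v = v
  par : ∀ i, lo ≤ i → i < hi → q i ≠ v →
    g.H.Adj (q i) (P (q i)) ∧ L (P (q i)) + 1 = L (q i) ∧ L (P (q i)) ≠ 0
  mono : ∀ i j, lo ≤ i → i ≤ j → j < hi → L (q i) ≤ L (q j)
  front : ∀ i j, h ≤ i → i < hi → lo ≤ j → j < hi → L (q j) ≤ L (q i) + 1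
  done : ∀ i, lo ≤ i → i < h → ∀ u, g.H.Adj (q i) u → L u ≠ 0 ∧ L u ≤ L (q i) + 1

/-- The new vertex gets the level of the head plus one. By `front` this is at least every level in
the queue, so the levels remain monotone along it. -/
theorem BfsInv.push {g : Net} {C D : Finset ℕ} {v lo h hi : ℕ} {q L P : ℕ → ℕ}
    (I : BfsInv g C D v lo h hi q L P) (hh : h < hi) (hC : g.Closed C) {u : ℕ} (hu : L u = 0)
    (hadj : g.H.Adj (q h) u) :
    BfsInv g C D v lo h (hi + 1) (Function.update q hi u) (Function.update L u (L (q h) + 1))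
      (Function.update P u (q h)) := by
  have hLq : ∀ i, lo ≤ i → i < hi → L (q i) ≠ 0 := fun i h1 h2 =>
    (I.seen _).2 (Or.inr ⟨i, h1, h2, rfl⟩)
  have hne : ∀ i, lo ≤ i → i < hi → q i ≠ u := fun i h1 h2 h => hLq i h1 h2 (h ▸ hu)
  have hq : ∀ i, i < hi → Function.update q hi u i = q i := fun i hi' =>
    Function.update_of_ne (by omega) _ _
  have hqn : Function.update q hi u hi = u := Function.update_self _ _ _
  have hLn : Function.update L u (L (q h) + 1) u = L (q h) + 1 := Function.update_self _ _ _
  have hL : ∀ x, L x ≠ 0 → Function.update L u (L (q h) + 1) x = L x := fun x hx =>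
    Function.update_of_ne (by rintro rfl; exact hx hu) _ _
  have hvu : v ≠ u := by rintro rfl; have := I.start; omega
  have hqh := hLq h I.lo_le hh
  have hlo := I.lo_le
  constructor
  · exact I.lo_le
  · exact I.le_hi.trans (Nat.le_succ _)
  · intro i hi1 j hj1 he
    simp only [Set.mem_Ico] at hi1 hj1
    rcases Nat.lt_succ_iff_lt_or_eq.1 hi1.2 with hi2 | rfl <;>
      rcases Nat.lt_succ_iff_lt_or_eq.1 hj1.2 with hj2 | rfl
    · rw [hq _ hi2, hq _ hj2] at he
      exact I.inj ⟨hi1.1, hi2⟩ ⟨hj1.1, hj2⟩ he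
    · rw [hq _ hi2, hqn] at he
      exact absurd he (hne _ hi1.1 hi2)
    · rw [hq _ hj2, hqn] at he
      exact absurd he.symm (hne _ hj1.1 hj2)
    · rfl
  · intro i h1 h2
    rcases Nat.lt_succ_iff_lt_or_eq.1 h2 with h2 | rfl
    · rw [hq _ h2]; exact I.mem i h1 h2
    · rw [hqn]; exact hC.adj _ (I.mem h I.lo_le hh) _ hadj
  · intro x
    by_cases hx : x = u
    · subst hx
      rw [hLn]
      exact ⟨fun _ => Or.inr ⟨hi, by omega, by omega, hqn⟩, fun _ => by omega⟩
    · rw [Function.update_of_ne hx, I.seen]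
      refine or_congr Iff.rfl ⟨?_, ?_⟩
      · rintro ⟨i, h1, h2, h3⟩
        exact ⟨i, h1, by omega, (hq _ h2).trans h3⟩
      · rintro ⟨i, h1, h2, h3⟩
        rcases Nat.lt_succ_iff_lt_or_eq.1 h2 with h2 | rfl
        · exact ⟨i, h1, h2, (hq _ h2) ▸ h3⟩
        · exact absurd (hqn ▸ h3).symm hx
  · rw [Function.update_of_ne hvu, I.start]
  · rw [Function.update_of_ne hvu, I.start_par]
  · intro i h1 h2 h3
    rcases Nat.lt_succ_iff_lt_or_eq.1 h2 with h2 | rfl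
    · rw [hq _ h2] at h3 ⊢
      obtain ⟨h4, h5, h6⟩ := I.par i h1 h2 h3
      rw [Function.update_of_ne (hne i h1 h2), hL _ h6, hL _ (hLq i h1 h2)]
      exact ⟨h4, h5, h6⟩
    · rw [hqn, Function.update_self, hL _ hqh, hLn]
      exact ⟨hadj.symm, rfl, hqh⟩
  · intro i j h1 h2 h3
    rcases Nat.lt_succ_iff_lt_or_eq.1 h3 with h3 | rfl
    · rw [hq _ h3, hq i (by omega), hL _ (hLq _ h1 (by omega)), hL _ (hLq _ (by omega) h3)]
      exact I.mono i j h1 h2 h3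
    · rw [hqn, hLn]
      rcases Nat.lt_or_eq_of_le h2 with h2 | rfl
      · rw [hq _ h2, hL _ (hLq _ h1 h2)]
        exact I.front h i le_rfl hh h1 h2
      · rw [hqn, hLn]
  · intro i j h1 h2 h3 h4
    have hLi : L (q h) ≤ Function.update L u (L (q h) + 1) (Function.update q hi u i) := by
      rcases Nat.lt_succ_iff_lt_or_eq.1 h2 with h2 | rfl
      · rw [hq _ h2, hL _ (hLq _ (by omega) h2)]
        exact I.mono h i I.lo_le h1 h2
      · rw [hqn, hLn]; omega
    rcases Nat.lt_succ_iff_lt_or_eq.1 h4 with h4 | rfl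
    · rw [hq _ h4, hL _ (hLq _ h3 h4)]
      have := I.front h j le_rfl hh h3 h4
      omega
    · rw [hqn, hLn]; omega
  · intro i h1 h2 x hx
    have h2' : i < hi := by omega
    rw [hq _ h2'] at hx ⊢
    obtain ⟨h3, h4⟩ := I.done i h1 h2 x hx
    rw [hL _ h3, hL _ (hLq _ h1 h2')]
    exact ⟨h3, h4⟩

/-- Breadth first search from the vertex held by `vStart`. -/
def bfs : Program :=
  .setNat vLo (.var vHi) ;; .storeNat aQueue (.var vHi) (.var vStart) ;;
  .setNat vHi (.succ (.var vHi)) ;; .storeNat aLev (.var vStart) (.lit 1) ;;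
  .storeNat aPar (.var vStart) (.var vStart) ;; .setNat vHead (.var vLo) ;;
  .while (.lt (.var vHead) (.var vHi))
    (.setNat vX (.get aQueue (.var vHead)) ;;
      forNbr vX (.ite (.eq (.get aLev (.var vU)) (.lit 0))
        (.storeNat aLev (.var vU) (.succ (.get aLev (.var vX))) ;;
          .storeNat aPar (.var vU) (.var vX) ;;
          .storeNat aQueue (.var vHi) (.var vU) ;; .setNat vHi (.succ (.var vHi)))
        .skip) ;;
      .setNat vHead (.succ (.var vHead)))

/-- The result of a breadth first search from `v` in the component `C`: levels plus one, and parents. -/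
structure IsBfs (g : Net) (C : Finset ℕ) (v : ℕ) (L P : ℕ → ℕ) : Prop where
  start_mem : v ∈ C
  start : L v = 1
  start_par : P v = v
  pos : ∀ x ∈ C, L x ≠ 0
  eq_start : ∀ x ∈ C, L x = 1 → x = v
  adj : ∀ x ∈ C, ∀ u, g.H.Adj x u → L u ≤ L x + 1
  par : ∀ x ∈ C, x ≠ v → g.H.Adj x (P x) ∧ L (P x) + 1 = L x

/-- The levels are stored plus one, so that zero marks the unvisited vertices, and they are never
reset; the queue only grows, so each component keeps a segment of its own. Thus no time is spent on
clearing memory. -/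
theorem bfs_spec {g : Net} {s : State} {C D : Finset ℕ} {v : ℕ} (hs : Holds g s)
    (hv : s.nat vStart = v) (hvC : v ∈ C) (hC : g.Closed C) (hD : g.Closed D) (hvD : v ∉ D)
    (hCmin : ∀ S : Set ℕ, v ∈ S → (∀ x ∈ S, ∀ u, g.H.Adj x u → u ∈ S) → ∀ x ∈ C, x ∈ S)
    (hseen : ∀ x, s.natArr aLev x ≠ 0 ↔ x ∈ D) :
    Tri bfs s (g.size C) fun s' => HoldsComp g C s' ∧ Disjoint D C ∧
      (∀ x, s'.natArr aLev x ≠ 0 ↔ x ∈ D ∪ C) ∧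
      IsBfs g C v (s'.natArr aLev) (s'.natArr aPar) := by
  have hCD : ∀ x ∈ C, x ∉ D := hCmin {x | x ∉ D} hvD
    fun x hx u hu huD => hx (hD.adj u huD x hu.symm)
  have hC0 : ∀ x ∈ C, s.natArr aLev x = 0 := fun x hx => by
    by_contra h; exact hCD x hx ((hseen x).1 h)
  refine Tri.setNat_seq (Tri.storeNat_seq (Tri.setNat_seq (Tri.storeNat_seq (Tri.storeNat_seq
    (Tri.setNat_seq ?_)))))
  simp only [NatExp.eval, setNat_nat, storeNat_nat, Nat.reduceEqDiff, if_true, if_false, hv]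
  set lo := s.nat vHi with hlo
  generalize hs₁ : (State.setNat (State.storeNat (State.storeNat (State.setNat (State.storeNat
    (State.setNat s vLo lo) aQueue lo v) vHi (lo + 1)) aLev v 1) aPar v v) vHead lo) = s₁
  have hh1 : Holds g s₁ := by
    subst hs₁
    exact ⟨hs.size, hs.off, hs.nbr, hs.wt⟩
  have hI1 : BfsInv g C D v lo lo (lo + 1) (s₁.natArr aQueue) (s₁.natArr aLev)
      (s₁.natArr aPar) := by
    have e1 : s₁.natArr aQueue lo = v := by subst hs₁; simp
    have e2 : s₁.natArr aLev = Function.update (s.natArr aLev) v 1 := by subst hs₁; simp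
    have e3 : s₁.natArr aPar v = v := by subst hs₁; simp
    have e4 : ∀ i, lo ≤ i → i < lo + 1 → i = lo := by intros; omega
    constructor
    · exact le_rfl
    · omega
    · intro i hi j hj _
      rw [e4 i hi.1 hi.2, e4 j hj.1 hj.2]
    · intro i h1 h2
      rw [e4 i h1 h2, e1]; exact hvC
    · intro x
      rw [e2]
      by_cases hx : x = v
      · subst hx
        simp only [Function.update_self]
        exact ⟨fun _ => Or.inr ⟨lo, le_rfl, by omega, e1⟩, fun _ => by omega⟩
      · rw [Function.update_of_ne hx, hseen]
        refine ⟨Or.inl, ?_⟩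
        rintro (h | ⟨i, h1, h2, h3⟩)
        · exact h
        · rw [e4 i h1 h2, e1] at h3
          exact absurd h3.symm hx
    · rw [e2, Function.update_self]
    · exact e3
    · intro i h1 h2 h3
      rw [e4 i h1 h2, e1] at h3
      exact absurd rfl h3
    · intro i j h1 h2 h3
      rw [e4 i h1 (by omega), e4 j (by omega) h3]
    · intro i j h1 h2 h3 h4
      rw [e4 i h1 h2, e4 j h3 h4]
      omega
    · intro i h1 h2
      omega
  -- The budget is the size of the part of `C` that has not yet left the queue.
  refine Tri.while (I := fun s' φ => s'.nat vLo = lo ∧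
    BfsInv g C D v lo (s'.nat vHead) (s'.nat vHi) (s'.natArr aQueue) (s'.natArr aLev)
      (s'.natArr aPar) ∧
    φ = g.size C - g.size ((Finset.Ico lo (s'.nat vHead)).image (s'.natArr aQueue))) s₁ ?_ ?_ _ ?_
  · rintro s₂ φ hF ⟨hl2, I2, rfl⟩ hb
    have hh2 := hh1.frame hF rfl
    simp only [Test.eval, NatExp.eval] at hb
    have hx : s₂.natArr aQueue (s₂.nat vHead) ∈ C := I2.mem _ I2.lo_le hb
    obtain ⟨x, hxdef⟩ : ∃ x, x = s₂.natArr aQueue (s₂.nat vHead) := ⟨_, rfl⟩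
    rw [← hxdef] at hx
    set h := s₂.nat vHead with hhead
    have hins : (Finset.Ico lo (h + 1)).image (s₂.natArr aQueue) =
        insert x ((Finset.Ico lo h).image (s₂.natArr aQueue)) := by
      have := I2.lo_le
      rw [hxdef, ← Finset.image_insert]
      congr 1
      ext i
      simp only [Finset.mem_Ico, Finset.mem_insert]
      omega
    have hnot : x ∉ (Finset.Ico lo h).image (s₂.natArr aQueue) := by
      intro hm
      obtain ⟨i, hi, he⟩ := Finset.mem_image.1 hm
      rw [Finset.mem_Ico] at hi
      have := I2.inj ⟨hi.1, by omega⟩ ⟨I2.lo_le, hb⟩ (he.trans hxdef)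
      omega
    have hsub : (Finset.Ico lo (h + 1)).image (s₂.natArr aQueue) ⊆ C := by
      intro y hy
      obtain ⟨i, hi, rfl⟩ := Finset.mem_image.1 hy
      rw [Finset.mem_Ico] at hi
      exact I2.mem i hi.1 (by omega)
    have hsize : g.size ((Finset.Ico lo (h + 1)).image (s₂.natArr aQueue)) =
        (g.nb x).card + 1 + g.size ((Finset.Ico lo h).image (s₂.natArr aQueue)) := by
      rw [hins]; exact Finset.sum_insert hnot
    have hle : g.size ((Finset.Ico lo (h + 1)).image (s₂.natArr aQueue)) ≤ g.size C :=
      Finset.sum_le_sum_of_subset hsub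
    refine ⟨(g.nb x).card, g.size C - g.size ((Finset.Ico lo (h + 1)).image (s₂.natArr aQueue)),
      by omega, ?_⟩
    refine Tri.setNat_seq ?_
    simp only [NatExp.eval, ← hhead, ← hxdef]
    refine Tri.bind (Q := fun s' => s'.nat vLo = lo ∧ s'.nat vHead = h ∧ h < s'.nat vHi ∧
      s'.natArr aQueue h = x ∧
      (∀ i ≤ h, s'.natArr aQueue i = s₂.natArr aQueue i) ∧
      BfsInv g C D v lo h (s'.nat vHi) (s'.natArr aQueue) (s'.natArr aLev) (s'.natArr aPar) ∧
      ∀ u ∈ g.nb x, s'.natArr aLev u ≠ 0 ∧ s'.natArr aLev u ≤ s'.natArr aLev x + 1) ?_ ?_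
    · refine Tri.forNbr (g := g) (v := x) (fun N s' => s'.nat vLo = lo ∧ s'.nat vHead = h ∧
        h < s'.nat vHi ∧ s'.natArr aQueue h = x ∧
        (∀ i ≤ h, s'.natArr aQueue i = s₂.natArr aQueue i) ∧
        BfsInv g C D v lo h (s'.nat vHi) (s'.natArr aQueue) (s'.natArr aLev) (s'.natArr aPar) ∧
        ∀ u ∈ N, s'.natArr aLev u ≠ 0 ∧ s'.natArr aLev u ≤ s'.natArr aLev x + 1)
        ⟨hh2.size, hh2.off, hh2.nbr, hh2.wt⟩ rfl (hC.lt x hx) rfl rfl rfl (fun _ _ _ h => h)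
        (fun _ _ _ h => h) ?_ ?_ (fun _ h => h)
      · exact ⟨hl2, hhead.symm, hb, hxdef.symm, fun _ _ => rfl, I2, by simp⟩
      · rintro N u s₃ hF3 - hu - hU - ⟨i1, i2, i3, i4, i5, i6, i7⟩
        have hX : s₃.nat vX = x := hF3.nat _ rfl
        rw [g.mem_nb] at hu
        have hLx : s₃.natArr aLev x ≠ 0 :=
          (i6.seen x).2 (Or.inr ⟨h, i6.lo_le, i3, i4⟩)
        refine Tri.ite (fun h0 => ?_) (fun h0 => ?_)
        · simp only [Test.eval, NatExp.eval, hU] at h0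
          have hux : u ≠ x := by rintro rfl; exact hLx h0
          refine Tri.storeNat_seq (Tri.storeNat_seq (Tri.storeNat_seq (Tri.setNat ?_)))
          simp only [NatExp.eval, setNat_nat, storeNat_nat, setNat_natArr, storeNat_natArr,
            Nat.reduceEqDiff, if_true, if_false, hU, hX]
          refine ⟨i1, i2, by omega, ?_, fun i hi => ?_, ?_, fun y hy => ?_⟩
          · rw [Function.update_of_ne (by omega), i4]
          · rw [Function.update_of_ne (by omega), i5 i hi]
          · have := i6.push i3 hC h0 (by rw [i4]; exact hu)
            rw [i4] at this
            exact this
          · rw [Function.update_of_ne hux.symm]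
            by_cases hyu : y = u
            · subst hyu
              simp
            · rw [Function.update_of_ne hyu]
              exact i7 y (by simpa [hyu] using hy)
        · simp only [Test.eval, NatExp.eval, hU] at h0
          refine Tri.skip ⟨i1, i2, i3, i4, i5, i6, fun y hy => ?_⟩
          rcases Finset.mem_insert.1 hy with rfl | hy
          · refine ⟨h0, ?_⟩
            -- A neighbour seen before is in the queue, where no level exceeds that of the head by
            -- more than one.
            rcases (i6.seen y).1 h0 with hyD | ⟨j, h1, h2, h3⟩
            · exact absurd hyD (hCD y (hC.adj x hx y hu))
            · rw [← h3, ← i4]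
              exact i6.front h j le_rfl i3 h1 h2
          · exact i7 y hy
    · rintro s₃ - ⟨i1, i2, i3, i4, i5, i6, i7⟩
      refine Tri.setNat ?_
      simp only [NatExp.eval, setNat_nat, setNat_natArr, Nat.reduceEqDiff, if_true, if_false, i2]
      refine ⟨i1, ⟨by have := i6.lo_le; omega, i3, i6.inj, i6.mem, i6.seen, i6.start,
        i6.start_par, i6.par, i6.mono, fun i j h1 => i6.front i j (by omega), ?_⟩, ?_⟩
      · intro i h1 h2 u hu
        rcases Nat.lt_succ_iff_lt_or_eq.1 h2 with h2 | rfl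
        · exact i6.done i h1 h2 u hu
        · rw [i4] at hu ⊢
          exact i7 u (g.mem_nb.2 hu)
      · congr 2
        refine Finset.image_congr fun i hi => (i5 i ?_).symm
        simp only [Finset.coe_Ico, Set.mem_Ico] at hi
        omega
  · rintro s₂ φ hF ⟨hl2, I, rfl⟩ hb
    simp only [Test.eval, NatExp.eval] at hb
    have heq : s₂.nat vHead = s₂.nat vHi := by have := I.le_hi; omega
    have hqL : ∀ i, lo ≤ i → i < s₂.nat vHi → s₂.natArr aLev (s₂.natArr aQueue i) ≠ 0 :=
      fun i h1 h2 => (I.seen _).2 (Or.inr ⟨i, h1, h2, rfl⟩)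
    -- All queued vertices have been processed, so the set of these vertices is closed under
    -- adjacency and contains `C`.
    have hall : ∀ x ∈ C, ∃ i, lo ≤ i ∧ i < s₂.nat vHi ∧ s₂.natArr aQueue i = x := by
      refine hCmin _ ?_ ?_
      · have := (I.seen v).1 (by rw [I.start]; omega)
        exact this.resolve_left hvD
      · rintro x ⟨i, h1, h2, rfl⟩ u hu
        have h3 := (I.done i h1 (by omega) u hu).1
        exact ((I.seen u).1 h3).resolve_left (hCD u (hC.adj _ (I.mem i h1 h2) u hu))
    refine ⟨⟨hh1.frame hF rfl, hC, ?_⟩, ?_, fun x => ?_, hvC, I.start, I.start_par, ?_, ?_, ?_, ?_⟩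
    · rw [hl2]
      refine ⟨fun i hi => I.mem i hi.1 hi.2, I.inj, fun x hx => ?_⟩
      obtain ⟨i, h1, h2, h3⟩ := hall x hx
      exact ⟨i, ⟨h1, h2⟩, h3⟩
    · exact Finset.disjoint_right.2 hCD
    · rw [I.seen, Finset.mem_union]
      refine or_congr Iff.rfl ⟨?_, hall x⟩
      rintro ⟨i, h1, h2, rfl⟩
      exact I.mem i h1 h2
    · intro x hx
      obtain ⟨i, h1, h2, rfl⟩ := hall x hx
      exact hqL i h1 h2
    · intro x hx hL
      obtain ⟨i, h1, h2, rfl⟩ := hall x hx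
      by_contra hne
      have := I.par i h1 h2 hne
      omega
    · intro x hx u hu
      obtain ⟨i, h1, h2, rfl⟩ := hall x hx
      exact (I.done i h1 (by omega) u hu).2
    · intro x hx hne
      obtain ⟨i, h1, h2, rfl⟩ := hall x hx
      have := I.par i h1 h2 hne
      exact ⟨this.1, this.2.1⟩
  · subst hs₁
    refine ⟨by simp, hI1, by simp [Net.size]⟩

/-! ## Evaluation of a candidate for the set of covered vertices -/

theorem Net.count_def (g : Net) (x : ℕ) (p : ℕ → Prop) [DecidablePred p] :
    g.count x p = ((g.nb x).filter p).card := by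
  unfold Net.count; congr

theorem Net.sum_def (g : Net) (x : ℕ) (p : ℕ → Prop) [DecidablePred p] :
    g.sum x p = ∑ u ∈ (g.nb x).filter p, g.w x u := by
  unfold Net.sum; congr

theorem Net.count_congr {g : Net} {x : ℕ} {p q : ℕ → Prop} (h : ∀ u, g.H.Adj x u → (p u ↔ q u)) :
    g.count x p = g.count x q := by
  unfold Net.count
  congr 1
  exact Finset.filter_congr fun u hu => h u (g.mem_nb.1 hu)

theorem Net.sum_congr {g : Net} {x : ℕ} {p q : ℕ → Prop} (h : ∀ u, g.H.Adj x u → (p u ↔ q u)) :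
    g.sum x p = g.sum x q := by
  unfold Net.sum
  exact Finset.sum_congr (Finset.filter_congr fun u hu => h u (g.mem_nb.1 hu)) fun _ _ => rfl

theorem Net.count_eq_one {g : Net} {x : ℕ} {p : ℕ → Prop} :
    g.count x p = 1 ↔ (∃ u, g.H.Adj x u ∧ p u) ∧
      ∀ u u', g.H.Adj x u → p u → g.H.Adj x u' → p u' → u = u' := by
  rw [Net.count, Finset.card_eq_one]
  constructor
  · rintro ⟨a, ha⟩
    have h : ∀ u, g.H.Adj x u ∧ p u ↔ u = a := fun u => by
      rw [← g.mem_nb, ← Finset.mem_filter, ha, Finset.mem_singleton]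
    exact ⟨⟨a, (h a).2 rfl⟩, fun u u' h1 h2 h3 h4 =>
      ((h u).1 ⟨h1, h2⟩).trans ((h u').1 ⟨h3, h4⟩).symm⟩
  · rintro ⟨⟨a, h1, h2⟩, h3⟩
    refine ⟨a, Finset.ext fun u => ?_⟩
    rw [Finset.mem_filter, Finset.mem_singleton, g.mem_nb]
    exact ⟨fun h => h3 _ _ h.1 h.2 h1 h2, by rintro rfl; exact ⟨h1, h2⟩⟩

/-- `CoverGood` in terms of the numbers `a` and `b` of covered and uncovered neighbours. -/
def OkCounts (c : Prop) (a b : ℕ) : Prop := (¬ c ∧ b = 0) ∨ (c ∧ (a = 1 ∨ (b = 0 ∧ a ≠ 0)))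

/-- In this form the condition can be tested from two stored numbers, and updated when a neighbour
changes sides. -/
theorem coverGood_iff {g : Net} {N : Set ℕ} {x : ℕ} :
    CoverGood g.H N x ↔ OkCounts (x ∈ N) (g.count x (· ∈ N)) (g.count x (· ∉ N)) := by
  have h0 : g.count x (· ∈ N) ≠ 0 ↔ ∃ u, g.H.Adj x u ∧ u ∈ N := by
    rw [Ne, g.count_eq_zero]; push Not; rfl
  have h1 : g.count x (· ∉ N) = 0 ↔ ∀ u, g.H.Adj x u → u ∈ N := by
    rw [g.count_eq_zero]; simp
  unfold CoverGood OkCounts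
  rw [h0, h1, g.count_eq_one]
  by_cases hx : x ∈ N
  · simp only [hx, not_true_eq_false, false_imp_iff, true_imp_iff, true_and, false_and, false_or]
    constructor
    · rintro ⟨h2, h3 | h3⟩
      · exact Or.inr ⟨h3, h2⟩
      · exact Or.inl ⟨h2, h3⟩
    · rintro (⟨h2, h3⟩ | ⟨h2, h3⟩)
      · exact ⟨h2, Or.inr h3⟩
      · exact ⟨h3, Or.inl h2⟩
  · simp [hx]

/-- Every vertex of `C` is in order for the covered set `N`. -/
def Net.Good (g : Net) (C : Finset ℕ) (N : Set ℕ) : Prop := ∀ x ∈ C, CoverGood g.H N x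

/-- Twice the weight of the edges of `C` between covered vertices. -/
noncomputable def Net.cost (g : Net) (C : Finset ℕ) (N : Set ℕ) : ℝ :=
  ∑ x ∈ C.filter (· ∈ N), g.sum x (· ∈ N)

theorem Net.cost_def (g : Net) (C : Finset ℕ) (N : Set ℕ) [DecidablePred (· ∈ N)] :
    g.cost C N = ∑ x ∈ C.filter (· ∈ N), g.sum x (· ∈ N) := by
  unfold Net.cost; congr

theorem Net.Good.congr {g : Net} {C : Finset ℕ} {N M : Set ℕ} (hC : g.Closed C)
    (h : ∀ x ∈ C, (x ∈ N ↔ x ∈ M)) (hN : g.Good C N) : g.Good C M := by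
  intro x hx
  have h' := hN x hx
  rw [coverGood_iff] at h' ⊢
  rwa [h x hx, g.count_congr fun u hu => h u (hC.adj x hx u hu),
    g.count_congr fun u hu => not_congr (h u (hC.adj x hx u hu))] at h'

theorem Net.good_congr {g : Net} {C : Finset ℕ} {N M : Set ℕ} (hC : g.Closed C)
    (h : ∀ x ∈ C, (x ∈ N ↔ x ∈ M)) : g.Good C N ↔ g.Good C M :=
  ⟨Net.Good.congr hC h, Net.Good.congr hC fun x hx => (h x hx).symm⟩

theorem Net.cost_congr {g : Net} {C : Finset ℕ} {N M : Set ℕ} (hC : g.Closed C)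
    (h : ∀ x ∈ C, (x ∈ N ↔ x ∈ M)) : g.cost C N = g.cost C M := by
  unfold Net.cost
  rw [Finset.filter_congr h]
  refine Finset.sum_congr rfl fun x hx => g.sum_congr fun u hu => ?_
  exact h u (hC.adj x (Finset.mem_filter.1 hx).1 u hu)

/-- Adding `m` changes the status of `m` and, at each of its neighbours, moves one vertex from the
uncovered to the covered count; the two other clauses are `OkCounts` for the new numbers. Elsewhere
the old verdict stands, so there must be no bad vertex there. This is the equation of cardinalities:
all the bad vertices are among `m` and its neighbours. It is what replaces a pass over `C` for each
`m`. -/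
theorem Net.good_insert_iff {g : Net} {C : Finset ℕ} {N : Set ℕ} {m : ℕ} (hC : g.Closed C)
    (hm : m ∈ C) (hmN : m ∉ N) :
    g.Good C (insert m N) ↔
      (g.count m (fun u => ¬ CoverGood g.H N u) + if CoverGood g.H N m then 0 else 1) =
        (C.filter fun u => ¬ CoverGood g.H N u).card ∧
      (∀ u, g.H.Adj m u → (u ∉ N ∧ g.count u (· ∉ N) = 1) ∨
        (u ∈ N ∧ (g.count u (· ∈ N) = 0 ∨ g.count u (· ∉ N) = 1))) ∧
      (g.count m (· ∈ N) = 1 ∨ (g.count m (· ∉ N) = 0 ∧ g.count m (· ∈ N) ≠ 0)) := by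
  -- the condition at the vertices far from `m`
  have hfar : ∀ x, x ≠ m → ¬ g.H.Adj m x →
      (CoverGood g.H (insert m N) x ↔ CoverGood g.H N x) := by
    intro x hxm hx
    have hu : ∀ u, g.H.Adj x u → (u ∈ insert m N ↔ u ∈ N) := fun u hu => by
      have : u ≠ m := by rintro rfl; exact hx hu.symm
      simp [this]
    rw [coverGood_iff, coverGood_iff, g.count_congr hu, g.count_congr fun u h => not_congr (hu u h)]
    simp [hxm]
  have hself : CoverGood g.H (insert m N) m ↔
      (g.count m (· ∈ N) = 1 ∨ (g.count m (· ∉ N) = 0 ∧ g.count m (· ∈ N) ≠ 0)) := by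
    have hu : ∀ u, g.H.Adj m u → (u ∈ insert m N ↔ u ∈ N) := fun u hu => by
      have : u ≠ m := hu.ne'
      simp [this]
    rw [coverGood_iff, g.count_congr hu, g.count_congr fun u h => not_congr (hu u h)]
    simp [OkCounts]
  have hnear : ∀ x, g.H.Adj m x → (CoverGood g.H (insert m N) x ↔
      (x ∉ N ∧ g.count x (· ∉ N) = 1) ∨
        (x ∈ N ∧ (g.count x (· ∈ N) = 0 ∨ g.count x (· ∉ N) = 1))) := by
    intro x hx
    have hmx : m ∈ g.nb x := g.mem_nb.2 hx.symm
    have h1 : g.count x (· ∈ insert m N) = g.count x (· ∈ N) + 1 := by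
      rw [g.count_def, g.count_def, show (g.nb x).filter (· ∈ insert m N) = insert m ((g.nb x).filter (· ∈ N)) by
        ext u
        simp only [Finset.mem_filter, Finset.mem_insert, Set.mem_insert_iff]
        constructor
        · rintro ⟨h1, h2 | h2⟩
          · exact Or.inl h2
          · exact Or.inr ⟨h1, h2⟩
        · rintro (rfl | h)
          · exact ⟨hmx, Or.inl rfl⟩
          · exact ⟨h.1, Or.inr h.2⟩, Finset.card_insert_of_notMem (by simp [hmN])]
    have h2 : g.count x (· ∉ N) = g.count x (· ∉ insert m N) + 1 := by
      rw [g.count_def, g.count_def, show (g.nb x).filter (· ∉ N) = insert m ((g.nb x).filter (· ∉ insert m N)) by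
        ext u
        simp only [Finset.mem_filter, Finset.mem_insert, Set.mem_insert_iff, not_or]
        constructor
        · rintro ⟨h1, h2⟩
          by_cases h : u = m
          · exact Or.inl h
          · exact Or.inr ⟨h1, h, h2⟩
        · rintro (rfl | h)
          · exact ⟨hmx, hmN⟩
          · exact ⟨h.1, h.2.2⟩, Finset.card_insert_of_notMem (by simp)]
    have hxm : x ≠ m := hx.ne'
    rw [coverGood_iff, h1, h2]
    simp only [OkCounts, Set.mem_insert_iff, hxm, false_or]
    by_cases hxN : x ∈ N <;> simp [hxN]
  -- all vertices in bad order are `m` and its neighbours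
  have hbad : (g.count m (fun u => ¬ CoverGood g.H N u) + if CoverGood g.H N m then 0 else 1) =
        (C.filter fun u => ¬ CoverGood g.H N u).card ↔
      ∀ x ∈ C, x ≠ m → ¬ g.H.Adj m x → CoverGood g.H N x := by
    set B := C.filter fun u => ¬ CoverGood g.H N u with hB
    set B' := (insert m (g.nb m)).filter fun u => ¬ CoverGood g.H N u with hB'
    have hcard : (g.count m (fun u => ¬ CoverGood g.H N u) +
        if CoverGood g.H N m then 0 else 1) = B'.card := by
      rw [g.count_def, hB', Finset.filter_insert]
      have hm' : m ∉ g.nb m := by rw [g.mem_nb]; exact g.H.loopless.irrefl m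
      by_cases h : CoverGood g.H N m
      · simp [h]
      · rw [if_neg h, if_pos h, Finset.card_insert_of_notMem (by simp [hm'])]
    have hsub : B' ⊆ B := by
      intro u hu
      rw [hB', Finset.mem_filter, Finset.mem_insert, g.mem_nb] at hu
      rw [hB, Finset.mem_filter]
      refine ⟨?_, hu.2⟩
      rcases hu.1 with rfl | h
      · exact hm
      · exact hC.adj m hm u h
    rw [hcard]
    constructor
    · intro h x hx hxm hadj
      by_contra hg
      have : x ∈ B' := by
        rw [Finset.eq_of_subset_of_card_le hsub h.ge, hB, Finset.mem_filter]
        exact ⟨hx, hg⟩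
      rw [hB', Finset.mem_filter, Finset.mem_insert, g.mem_nb] at this
      exact this.1.elim hxm hadj
    · intro h
      congr 1
      refine hsub.antisymm fun x hx => ?_
      rw [hB, Finset.mem_filter] at hx
      rw [hB', Finset.mem_filter, Finset.mem_insert, g.mem_nb]
      refine ⟨?_, hx.2⟩
      by_contra! hcon
      exact hx.2 (h x hx.1 hcon.1 hcon.2)
  rw [hbad, ← hself]
  constructor
  · intro h
    exact ⟨fun x hx h1 h2 => (hfar x h1 h2).1 (h x hx),
      fun u hu => (hnear u hu).1 (h u (hC.adj m hm u hu)), h m hm⟩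
  · rintro ⟨h1, h2, h3⟩ x hx
    by_cases hxm : x = m
    · exact hxm ▸ h3
    by_cases hadj : g.H.Adj m x
    · exact (hnear x hadj).2 (h2 x hadj)
    · exact (hfar x hxm hadj).2 (h1 x hx hxm hadj)

/-- The cost is a sum over ordered pairs, so the new edges enter once from `m` and once from their
other ends. The resulting factor two does no harm, as costs are only compared. -/
theorem Net.cost_insert {g : Net} {C : Finset ℕ} {N : Set ℕ} {m : ℕ} (hC : g.Closed C)
    (hm : m ∈ C) (hmN : m ∉ N) :
    g.cost C (insert m N) = g.cost C N + g.sum m (· ∈ N) + g.sum m (· ∈ N) := by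
  have h1 : C.filter (· ∈ insert m N) = insert m (C.filter (· ∈ N)) := by
    ext u
    simp only [Finset.mem_filter, Finset.mem_insert, Set.mem_insert_iff]
    constructor
    · rintro ⟨h1, h2 | h2⟩
      · exact Or.inl h2
      · exact Or.inr ⟨h1, h2⟩
    · rintro (rfl | h)
      · exact ⟨hm, Or.inl rfl⟩
      · exact ⟨h.1, Or.inr h.2⟩
  have h2 : ∀ x ∈ C.filter (· ∈ N), g.sum x (· ∈ insert m N) =
      g.sum x (· ∈ N) + if g.H.Adj m x then g.w m x else 0 := by
    intro x _
    by_cases hx : g.H.Adj m x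
    · rw [if_pos hx]
      rw [g.sum_def, g.sum_def, show (g.nb x).filter (· ∈ insert m N) = insert m ((g.nb x).filter (· ∈ N)) by
        ext u
        simp only [Finset.mem_filter, Finset.mem_insert, Set.mem_insert_iff]
        constructor
        · rintro ⟨h1, h2 | h2⟩
          · exact Or.inl h2
          · exact Or.inr ⟨h1, h2⟩
        · rintro (rfl | h)
          · exact ⟨g.mem_nb.2 hx.symm, Or.inl rfl⟩
          · exact ⟨h.1, Or.inr h.2⟩, Finset.sum_insert (by simp [hmN]), g.w_comm x m, add_comm]
    · rw [if_neg hx, add_zero]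
      refine g.sum_congr fun u hu => ?_
      have : u ≠ m := by rintro rfl; exact hx hu.symm
      simp [this]
  have h3 : g.sum m (· ∈ insert m N) = g.sum m (· ∈ N) := by
    refine g.sum_congr fun u hu => ?_
    have : u ≠ m := hu.ne'
    simp [this]
  have h4 : (∑ x ∈ C.filter (· ∈ N), if g.H.Adj m x then g.w m x else 0) = g.sum m (· ∈ N) := by
    rw [← Finset.sum_filter, g.sum_def]
    refine Finset.sum_congr (Finset.ext fun u => ?_) fun _ _ => rfl
    simp only [Finset.mem_filter, g.mem_nb]
    exact ⟨fun h => ⟨h.2, h.1.2⟩, fun h => ⟨⟨hC.adj m hm u h.1, h.2⟩, h.1⟩⟩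
  rw [g.cost_def, g.cost_def, h1, Finset.sum_insert (by simp [hmN]), h3, Finset.sum_congr rfl h2, Finset.sum_add_distrib, h4]
  ring

/-- The test whether the vertex held by `x` is in the candidate set. -/
def inCand (x : ℕ) : Test := .eq (.get aCand (.var x)) (.lit 1)

/-- The set held by an array. -/
def arrSet (a : ℕ) (s : State) : Set ℕ := {x | s.natArr a x = 1}

/-- Computes the numbers of neighbours in and outside the candidate set, the vertices in bad order, and
the cost of the candidate set. -/
def evalBase : Program :=
  .setNat vBad (.lit 0) ;; .setReal rBase .zero ;;
  forComp (
    scan vX (.not (inCand vU)) ;; .storeNat aOut (.var vX) (.var vCnt) ;;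
    scan vX (inCand vU) ;; .storeNat aIn (.var vX) (.var vCnt) ;;
    .ite (inCand vX) (.setReal rBase (.add (.var rBase) (.var rSum))) .skip ;;
    .ite (.or (.and (.not (inCand vX)) (.eq (.get aOut (.var vX)) (.lit 0)))
        (.and (inCand vX) (.or (.eq (.get aIn (.var vX)) (.lit 1))
          (.and (.eq (.get aOut (.var vX)) (.lit 0)) (.not (.eq (.get aIn (.var vX)) (.lit 0)))))))
      (.storeNat aBad (.var vX) (.lit 0))
      (.storeNat aBad (.var vX) (.lit 1) ;; .setNat vBad (.succ (.var vBad))))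

/-- The numbers computed by `evalBase`, for the vertices in `D`. -/
structure IsEvalBase (g : Net) (D : Finset ℕ) (N : Set ℕ) (s : State) : Prop where
  numIn : ∀ x ∈ D, s.natArr aIn x = g.count x (· ∈ N)
  numOut : ∀ x ∈ D, s.natArr aOut x = g.count x (· ∉ N)
  bad : ∀ x ∈ D, (s.natArr aBad x = 1 ↔ ¬ CoverGood g.H N x)
  numBad : s.nat vBad = (D.filter fun u => ¬ CoverGood g.H N u).card
  base : s.real rBase = g.cost D N

theorem evalBase_spec {g : Net} {C : Finset ℕ} {s : State} {N : Set ℕ} (hs : HoldsComp g C s)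
    (hN : arrSet aCand s = N) :
    Tri evalBase s (g.size C) (IsEvalBase g C N) := by
  have hmem : ∀ u, s.natArr aCand u = 1 ↔ u ∈ N := fun u => by rw [← hN]; rfl
  refine Tri.setNat_seq (Tri.setReal_seq ?_)
  refine Tri.forComp (fun D s' => IsEvalBase g D N s') (g := g) (C := C) ?_ rfl rfl
    (fun _ _ _ h => ⟨h.numIn, h.numOut, h.bad, h.numBad, h.base⟩)
    (fun _ _ _ h => ⟨h.numIn, h.numOut, h.bad, h.numBad, h.base⟩) ?_ ?_ (fun _ _ h => h)
  · exact ⟨⟨hs.size, hs.off, hs.nbr, hs.wt⟩, hs.closed, hs.queue⟩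
  · constructor <;> simp [Net.cost]
  · rintro D x s₁ hF - hxC hxD hX hc I
    have hxn := hc.closed.lt x hxC
    have eC : ∀ u, s₁.natArr aCand u = 1 ↔ u ∈ N := fun u => by
      rw [hF.natArr aCand rfl]; exact hmem u
    refine (scan_spec (· ∉ N) hc.toHolds hX hxn rfl (fun s' h _ => ?_)).bind
      fun s₂ hF2 ⟨h1, _, _⟩ => ?_
    · simp [inCand, h, eC]
    have hX2 : s₂.nat vX = x := (hF2.nat _ rfl).trans hX
    refine Tri.storeNat_seq ?_
    simp only [NatExp.eval, hX2, h1]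
    generalize hs3 : s₂.storeNat aOut x (g.count x (· ∉ N)) = s₃
    have eC3 : ∀ u, s₃.natArr aCand u = 1 ↔ u ∈ N := fun u => by
      subst hs3; rw [← eC u, ← hF2.natArr aCand rfl]; rfl
    have hc3 : Holds g s₃ := by
      have h := hc.toHolds.frame hF2 rfl
      subst hs3; exact ⟨h.size, h.off, h.nbr, h.wt⟩
    have hX3 : s₃.nat vX = x := by subst hs3; exact hX2
    refine (scan_spec (· ∈ N) hc3 hX3 hxn rfl (fun s' h _ => ?_)).bind
      fun s₄ hF4 ⟨h2, _, h3⟩ => ?_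
    · simp [inCand, h, eC3]
    have hX4 : s₄.nat vX = x := (hF4.nat _ rfl).trans hX3
    refine Tri.storeNat_seq ?_
    simp only [NatExp.eval, hX4, h2]
    generalize hs5 : s₄.storeNat aIn x (g.count x (· ∈ N)) = s₅
    have eC5 : s₅.natArr aCand x = 1 ↔ x ∈ N := by
      subst hs5; rw [← eC3 x, ← hF4.natArr aCand rfl]; rfl
    have e4 : ∀ a, s₄.natArr a = s₃.natArr a := fun a => hF4.natArr a rfl
    have e2 : ∀ a, s₂.natArr a = s₁.natArr a := fun a => hF2.natArr a rfl
    have eIn : s₅.natArr aIn = Function.update (s₁.natArr aIn) x (g.count x (· ∈ N)) := by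
      subst hs5; simp only [storeNat_natArr, if_true, e4]; subst hs3; simp [e2]
    have eOut : s₅.natArr aOut = Function.update (s₁.natArr aOut) x (g.count x (· ∉ N)) := by
      subst hs5; simp only [storeNat_natArr, e4]; subst hs3; simp [e2]
    have eBad : s₅.natArr aBad = s₁.natArr aBad := by
      subst hs5; simp only [storeNat_natArr, e4]; subst hs3; simp [e2]
    have eX : s₅.nat vX = x := by subst hs5; exact hX4
    have eB : s₅.nat vBad = s₁.nat vBad := by
      subst hs5; rw [storeNat_nat, hF4.nat _ rfl]; subst hs3; rw [storeNat_nat, hF2.nat _ rfl]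
    have eR : s₅.real rBase = s₁.real rBase := by
      subst hs5; rw [storeNat_real, hF4.real _ rfl]; subst hs3; rw [storeNat_real, hF2.real _ rfl]
    have eS : s₅.real rSum = g.sum x (· ∈ N) := by subst hs5; exact h3
    clear hs5 hs3
    have hbase : g.cost (insert x D) N = if x ∈ N then g.cost D N + g.sum x (· ∈ N) else g.cost D N := by
      unfold Net.cost
      rw [Finset.filter_insert]
      split_ifs with h
      · rw [Finset.sum_insert (by simp [hxD]), add_comm]
      · rfl
    refine Tri.bind (Q := fun s' => s'.natArr = s₅.natArr ∧ s'.nat = s₅.nat ∧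
      s'.real rBase = g.cost (insert x D) N) ?_ ?_
    · refine Tri.ite (fun h => Tri.setReal ⟨rfl, rfl, ?_⟩) (fun h => Tri.skip ⟨rfl, rfl, ?_⟩) <;>
        simp only [inCand, Test.eval, NatExp.eval, eX, eC5] at h <;> rw [hbase]
      · simp [h, eR, eS, I.base]
      · simp [h, eR, I.base]
    rintro s₆ - ⟨hA, hn, hr⟩
    have hupd : ∀ (f : ℕ → ℕ) (k y : ℕ), y ∈ D → Function.update f x k y = f y := fun f k y hy =>
      Function.update_of_ne (by rintro rfl; exact hxD hy) _ _
    have hIn : ∀ y ∈ insert x D, s₅.natArr aIn y = g.count y (· ∈ N) := by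
      intro y hy
      rw [eIn]
      rcases Finset.mem_insert.1 hy with rfl | hy
      · rw [Function.update_self]
      · rw [hupd _ _ _ hy, I.numIn y hy]
    have hOut : ∀ y ∈ insert x D, s₅.natArr aOut y = g.count y (· ∉ N) := by
      intro y hy
      rw [eOut]
      rcases Finset.mem_insert.1 hy with rfl | hy
      · rw [Function.update_self]
      · rw [hupd _ _ _ hy, I.numOut y hy]
    have hin := hIn x (Finset.mem_insert_self _ _)
    have hout := hOut x (Finset.mem_insert_self _ _)
    refine Tri.ite (fun h => ?_) (fun h => ?_)
    · have hgood : CoverGood g.H N x := by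
        rw [coverGood_iff]
        simpa [inCand, hA, hn, eX, eC5, hin, hout, OkCounts] using h
      refine Tri.storeNat ⟨?_, ?_, ?_, ?_, ?_⟩
      · simpa [hA] using hIn
      · simpa [hA] using hOut
      · intro y hy
        simp only [NatExp.eval, storeNat_natArr, if_true, hn, eX, hA, eBad]
        rcases Finset.mem_insert.1 hy with rfl | hy
        · simp [hgood]
        · rw [hupd _ _ _ hy, I.bad y hy]
      · rw [Finset.filter_insert, if_neg (by simpa using hgood)]
        simp [hn, eB, I.numBad]
      · exact hr
    · have hgood : ¬ CoverGood g.H N x := by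
        rw [coverGood_iff]
        simpa only [inCand, Test.eval, NatExp.eval, hA, hn, eX, eC5, hin, hout, OkCounts] using h
      refine Tri.storeNat_seq (Tri.setNat ⟨?_, ?_, ?_, ?_, ?_⟩)
      · simpa [hA] using hIn
      · simpa [hA] using hOut
      · intro y hy
        simp only [NatExp.eval, storeNat_natArr, setNat_natArr, if_true, hn, eX, hA, eBad]
        rcases Finset.mem_insert.1 hy with rfl | hy
        · simp [hgood]
        · rw [hupd _ _ _ hy, I.bad y hy]
      · rw [Finset.filter_insert, if_pos hgood, Finset.card_insert_of_notMem (by simp [hxD])]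
        simp [hn, eB, I.numBad]
      · exact hr

/-- Decides whether the candidate set together with the vertex `vX` is in good order, and computes its
cost. -/
def evalAdd : Program :=
  .ite (inCand vX)
    (.ite (.eq (.var vBad) (.lit 0)) (.setNat vOk (.lit 1)) (.setNat vOk (.lit 0)) ;;
      .setReal rCost (.var rBase))
    (scan vX (.eq (.get aBad (.var vU)) (.lit 1)) ;;
      .ite (.eq (.get aBad (.var vX)) (.lit 1)) (.setNat vCnt (.succ (.var vCnt))) .skip ;;
      .ite (.eq (.var vCnt) (.var vBad)) (.setNat vOk (.lit 1)) (.setNat vOk (.lit 0)) ;;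
      scan vX (.not (.or (.and (.not (inCand vU)) (.eq (.get aOut (.var vU)) (.lit 1)))
        (.and (inCand vU) (.or (.eq (.get aIn (.var vU)) (.lit 0))
          (.eq (.get aOut (.var vU)) (.lit 1)))))) ;;
      .ite (.eq (.var vCnt) (.lit 0)) .skip (.setNat vOk (.lit 0)) ;;
      .ite (.or (.eq (.get aIn (.var vX)) (.lit 1))
          (.and (.eq (.get aOut (.var vX)) (.lit 0)) (.not (.eq (.get aIn (.var vX)) (.lit 0)))))
        .skip (.setNat vOk (.lit 0)) ;;
      scan vX (inCand vU) ;; .setReal rCost (.add (.add (.var rBase) (.var rSum)) (.var rSum)))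

/-- If `m` is already in the set, the tabulated answer applies. Otherwise the three clauses of
`Net.good_insert_iff` are tested in turn, each by at most one scan of the neighbourhood of `m`. -/
theorem evalAdd_spec {g : Net} {C : Finset ℕ} {s : State} {N : Set ℕ} {m : ℕ}
    (hs : HoldsComp g C s) (hN : arrSet aCand s = N) (hE : IsEvalBase g C N s)
    (hX : s.nat vX = m) (hm : m ∈ C) :
    Tri evalAdd s (g.nb m).card fun s' => (s'.nat vOk = 1 ↔ g.Good C (insert m N)) ∧
      s'.real rCost = g.cost C (insert m N) := by
  have hmem : ∀ u, s.natArr aCand u = 1 ↔ u ∈ N := fun u => by rw [← hN]; rfl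
  have hmn := hs.closed.lt m hm
  refine Tri.ite (fun h => ?_) (fun h => ?_)
  · simp only [inCand, Test.eval, NatExp.eval, hX, hmem] at h
    rw [Set.insert_eq_of_mem h]
    have hgood : s.nat vBad = 0 ↔ g.Good C N := by
      rw [hE.numBad, Finset.card_eq_zero, Finset.filter_eq_empty_iff]
      simp [Net.Good]
    refine Tri.bind (Q := fun s' => (s'.nat vOk = 1 ↔ g.Good C N) ∧ s'.real = s.real) ?_ ?_
    · refine Tri.ite (fun h => Tri.setNat ⟨?_, rfl⟩) (fun h => Tri.setNat ⟨?_, rfl⟩) <;>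
        simp only [Test.eval, NatExp.eval, hgood] at h <;> simp [h]
    · rintro s₁ - ⟨h1, h2⟩
      refine Tri.setReal ⟨h1, ?_⟩
      simp [h2, hE.base]
  · simp only [inCand, Test.eval, NatExp.eval, hX, hmem] at h
    refine (scan_spec (fun u => s.natArr aBad u = 1) hs.toHolds hX hmn rfl
      (fun s' h _ => by simp [h])).bind fun s₁ hF1 ⟨h1, _, _⟩ => ?_
    have hc1 := hs.toHolds.frame hF1 rfl
    have hA1 : ∀ a, s₁.natArr a = s.natArr a := fun a => hF1.natArr a rfl
    have hX1 : s₁.nat vX = m := (hF1.nat _ rfl).trans hX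
    have hcnt : s₁.nat vCnt = g.count m fun u => ¬ CoverGood g.H N u :=
      h1.trans (g.count_congr fun u hu => hE.bad u (hs.closed.adj m hm u hu))
    refine Tri.bind (Q := fun s' => s'.nat vCnt = (g.count m (fun u => ¬ CoverGood g.H N u) +
      if CoverGood g.H N m then 0 else 1)) ?_ ?_
    · refine Tri.ite (fun h => Tri.setNat ?_) (fun h => Tri.skip ?_) <;>
        simp only [Test.eval, NatExp.eval, hX1, hA1, hE.bad m hm, not_not] at h <;> simp [h, hcnt]
    intro s₂ hF2 h2
    refine Tri.bind (Q := fun s' => (s'.nat vOk = 1 ↔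
      (g.count m (fun u => ¬ CoverGood g.H N u) + if CoverGood g.H N m then 0 else 1) =
        (C.filter fun u => ¬ CoverGood g.H N u).card)) ?_ ?_
    · have hb : s₂.nat vBad = (C.filter fun u => ¬ CoverGood g.H N u).card := by
        rw [hF2.nat _ rfl, hF1.nat _ rfl, hE.numBad]
      refine Tri.ite (fun h => Tri.setNat ?_) (fun h => Tri.setNat ?_) <;>
        simp only [Test.eval, NatExp.eval, h2, hb] at h <;> simp [h]
    intro s₃ hF3 h3
    have hc3 := (hc1.frame hF2 rfl).frame hF3 rfl
    have hA3 : ∀ a, s₃.natArr a = s.natArr a := fun a =>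
      ((hF3.natArr a rfl).trans (hF2.natArr a rfl)).trans (hA1 a)
    have hX3 : s₃.nat vX = m := ((hF3.nat _ rfl).trans (hF2.nat _ rfl)).trans hX1
    refine (scan_spec (fun u => ¬ ((u ∉ N ∧ s.natArr aOut u = 1) ∨
        (u ∈ N ∧ (s.natArr aIn u = 0 ∨ s.natArr aOut u = 1)))) hc3 hX3 hmn rfl
      (fun s' h _ => by
        simp only [inCand, Test.eval, NatExp.eval, h, hA3, hmem])).bind fun s₄ hF4 ⟨h4, _, _⟩ => ?_
    have hz : s₄.nat vCnt = 0 ↔ ∀ u, g.H.Adj m u → (u ∉ N ∧ g.count u (· ∉ N) = 1) ∨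
        (u ∈ N ∧ (g.count u (· ∈ N) = 0 ∨ g.count u (· ∉ N) = 1)) := by
      rw [h4, g.count_eq_zero]
      refine forall_congr' fun u => forall_congr' fun hu => ?_
      have hu := hs.closed.adj m hm u hu
      rw [not_not, hE.numIn u hu, hE.numOut u hu]
    have hX4 : s₄.nat vX = m := (hF4.nat _ rfl).trans hX3
    have hA4 : ∀ a, s₄.natArr a = s.natArr a := fun a => (hF4.natArr a rfl).trans (hA3 a)
    have h5 := h3
    rw [← hF4.nat vOk rfl] at h5
    refine Tri.bind (Q := fun s' => (s'.nat vOk = 1 ↔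
      (g.count m (fun u => ¬ CoverGood g.H N u) + if CoverGood g.H N m then 0 else 1) =
        (C.filter fun u => ¬ CoverGood g.H N u).card ∧
      (∀ u, g.H.Adj m u → (u ∉ N ∧ g.count u (· ∉ N) = 1) ∨
        (u ∈ N ∧ (g.count u (· ∈ N) = 0 ∨ g.count u (· ∉ N) = 1))))) ?_ ?_
    · refine Tri.ite (fun h => Tri.skip ?_) (fun h => Tri.setNat ?_) <;>
        simp only [Test.eval, NatExp.eval, hz] at h
      · rw [h5]
        exact ⟨fun h' => ⟨h', h⟩, fun h' => h'.1⟩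
      · simp only [NatExp.eval, setNat_nat, if_true, zero_ne_one, false_iff]
        exact fun h' => h h'.2
    intro s₅ hF5 h6
    have hX5 : s₅.nat vX = m := (hF5.nat _ rfl).trans hX4
    have hA5 : ∀ a, s₅.natArr a = s.natArr a := fun a => (hF5.natArr a rfl).trans (hA4 a)
    refine Tri.bind (Q := fun s' => (s'.nat vOk = 1 ↔ g.Good C (insert m N))) ?_ ?_
    · rw [g.good_insert_iff hs.closed hm h]
      refine Tri.ite (fun h => Tri.skip ?_) (fun h => Tri.setNat ?_) <;>
        simp only [Test.eval, NatExp.eval, hX5, hA5, hE.numIn m hm, hE.numOut m hm] at h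
      · rw [h6]
        exact ⟨fun h' => ⟨h'.1, h'.2, h⟩, fun h' => ⟨h'.1, h'.2.1⟩⟩
      · simp only [NatExp.eval, setNat_nat, if_true, zero_ne_one, false_iff]
        exact fun h' => h h'.2.2
    intro s₆ hF6 h7
    have hc6 := ((hc3.frame hF4 rfl).frame hF5 rfl).frame hF6 rfl
    have hX6 : s₆.nat vX = m := (hF6.nat _ rfl).trans hX5
    have hA6 : ∀ a, s₆.natArr a = s.natArr a := fun a => (hF6.natArr a rfl).trans (hA5 a)
    refine (scan_spec (· ∈ N) hc6 hX6 hmn rfl (fun s' h _ => by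
      simp only [inCand, Test.eval, NatExp.eval, h, hA6, hmem])).bind fun s₇ hF7 ⟨_, _, h8⟩ => ?_
    refine Tri.setReal ⟨?_, ?_⟩
    · rw [setReal_nat, hF7.nat vOk rfl, h7]
    · have hb : s₇.real rBase = g.cost C N := by
        rw [hF7.real _ rfl, hF6.real _ rfl, hF5.real _ rfl, hF4.real _ rfl, hF3.real _ rfl,
          hF2.real _ rfl, hF1.real _ rfl, hE.base]
      rw [g.cost_insert hs.closed hm h]
      simp [h8, hb]

/-- The best covered set found so far is in good order, and its cost is known. -/
def BestOk (g : Net) (C : Finset ℕ) (s : State) : Prop :=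
  s.nat vHas ≠ 0 → g.Good C (arrSet aBest s) ∧ s.real rBest = g.cost C (arrSet aBest s)

/-- The best covered set found so far is at least as good as `M`. -/
def Beats (g : Net) (C : Finset ℕ) (s : State) (M : Set ℕ) : Prop :=
  s.nat vHas ≠ 0 ∧ s.real rBest ≤ g.cost C M

/-- Tries all the sets that consist of the vertices `vX` with the property `t` and one more vertex. -/
def tryCand (t : Test) : Program :=
  forComp (.ite t (.storeNat aCand (.var vX) (.lit 1)) (.storeNat aCand (.var vX) (.lit 0))) ;;
  evalBase ;;
  .setNat vUpd (.lit 0) ;;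
  forComp (evalAdd ;;
    .ite (.and (.eq (.var vOk) (.lit 1))
        (.or (.eq (.var vHas) (.lit 0)) (.realLt (.var rCost) (.var rBest))))
      (.setNat vHas (.lit 1) ;; .setReal rBest (.var rCost) ;; .setNat vBestAdd (.var vX) ;;
        .setNat vUpd (.lit 1))
      .skip) ;;
  .ite (.eq (.var vUpd) (.lit 1))
    (forComp (.storeNat aBest (.var vX) (.get aCand (.var vX))) ;;
      .storeNat aBest (.var vBestAdd) (.lit 1))
    .skip

/-- Copying the set at every improvement would take quadratic time. During the pass only the
additional vertex and the cost are recorded, and the set is copied once at the end, if there was an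
improvement. -/
theorem tryCand_spec {g : Net} {C : Finset ℕ} {s : State} {t : Test} (p : ℕ → Prop)
    (hs : HoldsComp g C s) (hbest : BestOk g C s)
    (ht : ∀ s₁, Frame (tryCand t) s s₁ → s₁.nat vX ∈ C → (t.eval s₁ ↔ p (s₁.nat vX))) :
    Tri (tryCand t) s (g.size C) fun s' => BestOk g C s' ∧
      (∀ x, x ∉ C → s'.natArr aBest x = s.natArr aBest x) ∧
      (∀ M, Beats g C s M → Beats g C s' M) ∧
      ∀ m ∈ C, ∀ M : Set ℕ, (∀ x ∈ C, x ∈ M ↔ p x ∨ x = m) → g.Good C M → Beats g C s' M := by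
  have hC := hs.closed
  refine Tri.bind (Q := fun s' => ∀ x ∈ C, s'.natArr aCand x = 1 ↔ p x) ?_ ?_
  · refine Tri.forComp (fun D s' => ∀ x ∈ D, s'.natArr aCand x = 1 ↔ p x) hs rfl rfl
      (fun _ _ _ h => h) (fun _ _ _ h => h) (by simp) ?_ (fun _ _ h => h)
    rintro D x s₁ hF - hxC - hX - hI
    have hev := ht s₁ (hF.mono (Frame.Le.left _ _)) (hX ▸ hxC)
    rw [hX] at hev
    refine Tri.ite (fun h => Tri.storeNat fun y hy => ?_) (fun h => Tri.storeNat fun y hy => ?_) <;>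
      rw [hev] at h <;>
      simp only [NatExp.eval, storeNat_natArr, if_true, hX, Function.update_apply] <;>
      split_ifs with hyx
    · simp [hyx, h]
    · exact hI y (by simpa [hyx] using hy)
    · simp [hyx, h]
    · exact hI y (by simpa [hyx] using hy)
  intro s₁ hF1 hcand
  have hc1 := hs.frame hF1 rfl
  set N := arrSet aCand s₁ with hN
  refine (evalBase_spec hc1 rfl).bind fun s₂ hF2 hE => ?_
  have hc2 := hc1.frame hF2 rfl
  refine Tri.setNat_seq ?_
  simp only [NatExp.eval]
  set s₃ := s₂.setNat vUpd 0 with hs3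
  have hc3 : HoldsComp g C s₃ := ⟨⟨hc2.size, hc2.off, hc2.nbr, hc2.wt⟩, hc2.closed, hc2.queue⟩
  have hE3 : IsEvalBase g C N s₃ := ⟨hE.numIn, hE.numOut, hE.bad, hE.numBad, hE.base⟩
  have hN3 : s₃.natArr aCand = s₁.natArr aCand := hF2.natArr aCand rfl
  have hhas3 : s₃.nat vHas = s.nat vHas := (hF2.nat _ rfl).trans (hF1.nat _ rfl)
  have hbest3 : s₃.real rBest = s.real rBest := (hF2.real _ rfl).trans (hF1.real _ rfl)
  -- Either nothing better has turned up and the record is as before, or the record stands for the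
  -- present candidate set with `vBestAdd` added.
  refine Tri.bind (Q := fun s' =>
    ((s'.nat vUpd = 0 ∧ s'.nat vHas = s.nat vHas ∧ s'.real rBest = s.real rBest) ∨
      (s'.nat vUpd = 1 ∧ s'.nat vHas = 1 ∧ s'.nat vBestAdd ∈ C ∧
        g.Good C (insert (s'.nat vBestAdd) N) ∧
        s'.real rBest = g.cost C (insert (s'.nat vBestAdd) N) ∧
        (s.nat vHas ≠ 0 → s'.real rBest ≤ s.real rBest))) ∧
    ∀ m ∈ C, g.Good C (insert m N) → s'.nat vHas ≠ 0 ∧ s'.real rBest ≤ g.cost C (insert m N)) ?_ ?_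
  · refine Tri.forComp (fun D s' =>
      ((s'.nat vUpd = 0 ∧ s'.nat vHas = s.nat vHas ∧ s'.real rBest = s.real rBest) ∨
        (s'.nat vUpd = 1 ∧ s'.nat vHas = 1 ∧ s'.nat vBestAdd ∈ C ∧
          g.Good C (insert (s'.nat vBestAdd) N) ∧
          s'.real rBest = g.cost C (insert (s'.nat vBestAdd) N) ∧
          (s.nat vHas ≠ 0 → s'.real rBest ≤ s.real rBest))) ∧
      ∀ m ∈ D, g.Good C (insert m N) → s'.nat vHas ≠ 0 ∧
        s'.real rBest ≤ g.cost C (insert m N)) hc3 rfl rfl (fun _ _ _ h => h) (fun _ _ _ h => h)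
      ⟨Or.inl ⟨rfl, hhas3, hbest3⟩, by simp⟩ ?_ (fun _ _ h => h)
    rintro D m s₄ hF4 - hmC - hX hc ⟨hI, hI'⟩
    have hE4 : IsEvalBase g C N s₄ := by
      refine ⟨?_, ?_, ?_, ?_, ?_⟩
      · rw [hF4.natArr aIn rfl]; exact hE3.numIn
      · rw [hF4.natArr aOut rfl]; exact hE3.numOut
      · rw [hF4.natArr aBad rfl]; exact hE3.bad
      · rw [hF4.nat vBad rfl]; exact hE3.numBad
      · rw [hF4.real rBase rfl]; exact hE3.base
    have hN4 : arrSet aCand s₄ = N := by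
      rw [hN, arrSet, arrSet, hF4.natArr aCand rfl, hN3]
    refine (evalAdd_spec hc hN4 hE4 hX hmC).bind fun s₅ hF5 ⟨h1, h2⟩ => ?_
    have e1 : s₅.nat vUpd = s₄.nat vUpd := hF5.nat _ rfl
    have e2 : s₅.nat vHas = s₄.nat vHas := hF5.nat _ rfl
    have e3 : s₅.nat vBestAdd = s₄.nat vBestAdd := hF5.nat _ rfl
    have e4 : s₅.real rBest = s₄.real rBest := hF5.real _ rfl
    have e5 : s₅.nat vX = m := (hF5.nat _ rfl).trans hX
    refine Tri.ite (fun h => ?_) (fun h => ?_)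
    · simp only [Test.eval, NatExp.eval, RealExp.eval, h1, h2, e2, e4] at h
      refine Tri.setNat_seq (Tri.setReal_seq (Tri.setNat_seq (Tri.setNat ?_)))
      simp only [NatExp.eval, RealExp.eval, setNat_nat, setReal_nat, setNat_real, setReal_real,
        Nat.reduceEqDiff, if_true, if_false, e5, h2]
      have hle : s₄.nat vHas ≠ 0 → g.cost C (insert m N) ≤ s₄.real rBest := fun h0 =>
        (h.2.resolve_left h0).le
      refine ⟨Or.inr ⟨trivial, trivial, hmC, h.1, trivial, fun h0 => ?_⟩, fun y hy hg => ⟨one_ne_zero, ?_⟩⟩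
      · rcases hI with ⟨_, i2, i3⟩ | ⟨_, i2, _, _, _, i3⟩
        · rw [← i3]; exact hle (i2 ▸ h0)
        · exact (hle (by omega)).trans (i3 h0)
      · rcases Finset.mem_insert.1 hy with rfl | hy
        · exact le_rfl
        · obtain ⟨i1, i2⟩ := hI' y hy hg
          exact (hle i1).trans i2
    · simp only [Test.eval, NatExp.eval, RealExp.eval, h1, h2, e2, e4, not_and, not_or, not_lt] at h
      refine Tri.skip ?_
      rw [e1, e2, e3, e4]
      refine ⟨hI, fun y hy hg => ?_⟩
      rcases Finset.mem_insert.1 hy with rfl | hy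
      · exact h hg
      · exact hI' y hy hg
  rintro s₄ hF4 ⟨hI, hI'⟩
  have hc4 := hc3.frame hF4 rfl
  have hN4 : s₄.natArr aCand = s₁.natArr aCand := (hF4.natArr _ rfl).trans hN3
  have hB4 : s₄.natArr aBest = s.natArr aBest :=
    ((hF4.natArr _ rfl).trans (hF2.natArr _ rfl)).trans (hF1.natArr _ rfl)
  have hNp : ∀ x ∈ C, x ∈ N ↔ p x := hcand
  -- the claims on costs follow from those on the variables
  have hfin : ∀ s' : State, s'.nat vHas = s₄.nat vHas → s'.real rBest = s₄.real rBest →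
      (∀ M, Beats g C s M → Beats g C s' M) ∧
      ∀ m ∈ C, ∀ M : Set ℕ, (∀ x ∈ C, x ∈ M ↔ p x ∨ x = m) → g.Good C M → Beats g C s' M := by
    intro s' h1 h2
    unfold Beats
    rw [h1, h2]
    constructor
    · rintro M ⟨h3, h4⟩
      rcases hI with ⟨_, i2, i3⟩ | ⟨_, i2, _, _, _, i3⟩
      · rw [i2, i3]; exact ⟨h3, h4⟩
      · exact ⟨by omega, (i3 h3).trans h4⟩
    · intro m hm M hM hg
      have hcong : ∀ x ∈ C, x ∈ M ↔ x ∈ insert m N := fun x hx => by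
        rw [hM x hx, Set.mem_insert_iff, hNp x hx, or_comm]
      rw [g.cost_congr hC hcong]
      exact hI' m hm ((g.good_congr hC hcong).1 hg)
  refine Tri.ite (fun h => ?_) (fun h => ?_)
  · simp only [Test.eval, NatExp.eval] at h
    obtain ⟨-, i2, i3, i4, i5, i6⟩ := hI.resolve_left (fun h' => by omega)
    refine Tri.bind (Q := fun s' => (∀ x ∈ C, s'.natArr aBest x = s₄.natArr aCand x) ∧
      ∀ x, x ∉ C → s'.natArr aBest x = s₄.natArr aBest x) ?_ ?_
    · refine Tri.forComp (fun D s' => (∀ x ∈ D, s'.natArr aBest x = s₄.natArr aCand x) ∧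
        ∀ x, x ∉ C → s'.natArr aBest x = s₄.natArr aBest x) hc4 rfl rfl
        (fun _ _ _ h => h) (fun _ _ _ h => h) (by simp) ?_ (fun _ _ h => h)
      rintro D x s₅ hF5 - hxC - hX - ⟨hD, hD'⟩
      have hcd : s₅.natArr aCand = s₄.natArr aCand := hF5.natArr _ rfl
      refine Tri.storeNat ⟨fun y hy => ?_, fun y hy => ?_⟩ <;>
        simp only [NatExp.eval, storeNat_natArr, if_true, hX, hcd, Function.update_apply]
      · split_ifs with hyx
        · rw [hyx]
        · exact hD y (by simpa [hyx] using hy)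
      · rw [if_neg (by rintro rfl; exact hy hxC)]
        exact hD' y hy
    rintro s₅ hF5 ⟨h5, h6⟩
    have e1 : s₅.nat vBestAdd = s₄.nat vBestAdd := hF5.nat _ rfl
    have e2 : s₅.nat vHas = s₄.nat vHas := hF5.nat _ rfl
    have e3 : s₅.real rBest = s₄.real rBest := hF5.real _ rfl
    refine Tri.storeNat ⟨fun _ => ?_, fun x hx => ?_, hfin _ e2 e3⟩
    · have hcong : ∀ x ∈ C, x ∈ insert (s₄.nat vBestAdd) N ↔
          x ∈ arrSet aBest (s₅.storeNat aBest (s₅.nat vBestAdd) 1) := by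
        intro x hx
        simp only [arrSet, Set.mem_ofPred_eq, storeNat_natArr, if_true, e1, Function.update_apply,
          Set.mem_insert_iff]
        split_ifs with hxb
        · simp [hxb]
        · rw [h5 x hx, hN4]
          simp [hxb, hN, arrSet]
      simp only [NatExp.eval]
      rw [← g.cost_congr hC hcong]
      exact ⟨(g.good_congr hC hcong).1 i4, e3.trans i5⟩
    · simp only [NatExp.eval, storeNat_natArr, if_true, Function.update_apply]
      rw [if_neg (by rintro rfl; exact hx (e1 ▸ i3)), h6 x hx, hB4]
  · simp only [Test.eval, NatExp.eval] at h
    obtain ⟨-, i2, i3⟩ := hI.resolve_right (fun h' => h h'.1)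
    refine Tri.skip ⟨?_, fun x _ => by rw [hB4], hfin _ rfl rfl⟩
    unfold BestOk arrSet
    rw [hB4, i2, i3]
    exact hbest

/-! ## The search for the root -/

/-- Extremal choices by counting are used only through this: they exclude proper inclusions of
neighbourhoods. -/
theorem Net.count_lt {g : Net} {y y' : ℕ} {p : ℕ → Prop}
    (h : ∀ u, g.H.Adj y u → p u → g.H.Adj y' u) (h' : ∃ u, g.H.Adj y' u ∧ p u ∧ ¬ g.H.Adj y u) :
    g.count y p < g.count y' p := by
  obtain ⟨u, h1, h2, h3⟩ := h'
  refine Finset.card_lt_card ⟨fun x hx => ?_, fun hsub => ?_⟩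
  · rw [Finset.mem_filter, g.mem_nb] at hx ⊢
    exact ⟨h x hx.1 hx.2, hx.2⟩
  · have : u ∈ (g.nb y).filter p := hsub (Finset.mem_filter.2 ⟨g.mem_nb.2 h1, h2⟩)
    rw [Finset.mem_filter, g.mem_nb] at this
    exact h3 this.1

theorem IsBfs.par_mem {g : Net} {C : Finset ℕ} {v : ℕ} {L P : ℕ → ℕ} (h : IsBfs g C v L P)
    (hC : g.Closed C) {x : ℕ} (hx : x ∈ C) : P x ∈ C := by
  by_cases hxv : x = v
  · rw [hxv, h.start_par]; exact h.start_mem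
  · exact hC.adj x hx _ (h.par x hx hxv).1

/-- Looks for a vertex of level at least four. -/
def testLevels : Program :=
  .setNat vFar (.var vStart) ;;
  forComp (.ite (.lt (.lit 4) (.get aLev (.var vX))) (.setNat vFar (.var vX)) .skip) ;;
  .setNat vAnc1 (.get aPar (.var vFar)) ;; .setNat vAnc2 (.get aPar (.var vAnc1)) ;;
  .setNat vAnc3 (.get aPar (.var vAnc2)) ;; .setNat vAnc4 (.get aPar (.var vAnc3)) ;;
  tryP5 vFar vAnc1 vAnc2 vAnc3 vAnc4

/-- One vertex that is too far away suffices, since its chain of parents is the path. The start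
vertex is its own parent, so the chain stays in `C` even when it is short. -/
theorem testLevels_spec {g : Net} {C : Finset ℕ} {s : State} {v : ℕ} (hs : HoldsComp g C s)
    (hP : StoresP5 g s) (hv : s.nat vStart = v)
    (hB : IsBfs g C v (s.natArr aLev) (s.natArr aPar)) :
    Tri testLevels s (g.size C) fun s' => StoresP5 g s' ∧
      (s'.nat vFlag = 0 → s.nat vFlag = 0 ∧ ∀ x ∈ C, s.natArr aLev x ≤ 4) := by
  refine Tri.setNat_seq ?_
  simp only [NatExp.eval, hv]
  have hc0 : HoldsComp g C (s.setNat vFar v) :=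
    ⟨⟨hs.size, hs.off, hs.nbr, hs.wt⟩, hs.closed, hs.queue⟩
  refine Tri.bind (Q := fun s' => s'.nat vFar ∈ C ∧
    ((∀ x ∈ C, s.natArr aLev x ≤ 4) ∨ 4 < s.natArr aLev (s'.nat vFar))) ?_ ?_
  · refine Tri.forComp (fun D s' => s'.nat vFar ∈ C ∧
      ((∀ x ∈ D, s.natArr aLev x ≤ 4) ∨ 4 < s.natArr aLev (s'.nat vFar))) hc0 rfl rfl
      (fun _ _ _ h => h) (fun _ _ _ h => h) ⟨by simpa using hB.start_mem, by simp⟩ ?_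
      (fun _ _ h => h)
    rintro D x s₁ hF - hxC - hX - ⟨h1, h2⟩
    have hL : s₁.natArr aLev = s.natArr aLev := hF.natArr _ rfl
    refine Tri.ite (fun h => Tri.setNat ?_) (fun h => Tri.skip ?_) <;>
      simp only [Test.eval, NatExp.eval, hX, hL] at h
    · simp only [NatExp.eval, setNat_nat, if_true, hX]
      exact ⟨hxC, Or.inr h⟩
    · refine ⟨h1, h2.imp_left fun h2 y hy => ?_⟩
      rcases Finset.mem_insert.1 hy with rfl | hy
      · omega
      · exact h2 y hy
  rintro s₁ hF1 ⟨h1, h2⟩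
  have hc1 := hc0.frame hF1 rfl
  have hP1 : StoresP5 g s₁ := StoresP5.frame (p := forComp _) (s := s.setNat vFar v) hP hF1 rfl
  have hflag : s₁.nat vFlag = s.nat vFlag := hF1.nat _ rfl
  have hpar : s₁.natArr aPar = s.natArr aPar := hF1.natArr _ rfl
  refine Tri.setNat_seq (Tri.setNat_seq (Tri.setNat_seq (Tri.setNat_seq ?_)))
  simp only [NatExp.eval, setNat_nat, setNat_natArr, Nat.reduceEqDiff, if_true, if_false, hpar]
  obtain ⟨z, hz⟩ : ∃ z, z = s₁.nat vFar := ⟨_, rfl⟩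
  rw [← hz] at h1 h2 ⊢
  generalize hs2 : (State.setNat (State.setNat (State.setNat (State.setNat s₁ vAnc1 (s.natArr aPar z))
    vAnc2 _) vAnc3 _) vAnc4 _) = s₂
  have hc2 : Holds g s₂ := by subst hs2; exact ⟨hc1.size, hc1.off, hc1.nbr, hc1.wt⟩
  have hP2 : StoresP5 g s₂ := by subst hs2; exact hP1
  have n2 : s₂.nat vFlag = s.nat vFlag ∧ s₂.nat vFar = z ∧ s₂.nat vAnc1 = s.natArr aPar z ∧
      s₂.nat vAnc2 = s.natArr aPar (s.natArr aPar z) ∧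
      s₂.nat vAnc3 = s.natArr aPar (s.natArr aPar (s.natArr aPar z)) ∧
      s₂.nat vAnc4 = s.natArr aPar (s.natArr aPar (s.natArr aPar (s.natArr aPar z))) := by
    subst hs2; simp [hflag, hz]
  clear hs2
  obtain ⟨e1, e2, e3, e4, e5, e6⟩ := n2
  have m1 := hB.par_mem hs.closed h1
  have m2 := hB.par_mem hs.closed m1
  have m3 := hB.par_mem hs.closed m2
  have m4 := hB.par_mem hs.closed m3
  refine (tryP5_spec (C := C) hs.closed hc2 hP2
    ⟨by omega, e2 ▸ h1⟩ ⟨by omega, e3 ▸ m1⟩ ⟨by omega, e4 ▸ m2⟩ ⟨by omega, e5 ▸ m3⟩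
    ⟨by omega, e6 ▸ m4⟩).wk le_rfl fun s₃ _ ⟨h3, h4⟩ => ⟨h3, fun h0 => ?_⟩
  rw [e1, e2, e3, e4, e5, e6] at h4
  obtain ⟨h5, h6⟩ := h4 h0
  refine ⟨h5, h2.resolve_right fun h4 => h6 ?_⟩
  -- The array holds levels plus one; the truncated subtraction is harmless because the entries are
  -- positive on `C`.
  refine isP5_of_level (H := g.H) (C := (C : Set ℕ)) (lev := fun x => s.natArr aLev x - 1)
    (par := s.natArr aPar) (v := v) (fun x hx => hs.closed.adj x hx) (by simp [hB.start]) ?_ ?_ h1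
    (by show 4 ≤ s.natArr aLev z - 1; omega)
  · intro x hx u hu
    have := hB.adj x hx u hu
    have := hB.pos x hx
    show s.natArr aLev u - 1 ≤ s.natArr aLev x - 1 + 1
    omega
  · intro x hx hxv
    have := hB.par x hx hxv
    have h' := hB.pos _ (hB.par_mem hs.closed hx)
    refine ⟨this.1, ?_⟩
    show s.natArr aLev (s.natArr aPar x) - 1 + 1 = s.natArr aLev x - 1
    omega

/-- Chooses a vertex `vA` of level two with the largest number of neighbours of level three, and a
neighbour `vRoot` of level one of `vA` with the largest number of neighbours of level two. -/
def chooseRoot : Program :=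
  argBest true (.eq (.get aLev (.var vX)) (.lit 3)) (.eq (.get aLev (.var vU)) (.lit 4)) ;;
  .setNat vA (.var vArg) ;; mark vA ;;
  argBest true (.and (.eq (.get aLev (.var vX)) (.lit 2)) (.eq (.get aMark (.var vX)) (.lit 1)))
    (.eq (.get aLev (.var vU)) (.lit 3)) ;;
  .setNat vRoot (.var vArg)

/-- The values `2`, `3` and `4` in the array stand for the levels one, two and three. -/
theorem chooseRoot_spec {g : Net} {C : Finset ℕ} {s : State} {v : ℕ} (hs : HoldsComp g C s)
    (hv : s.nat vStart = v) (hnb : ∃ u, g.H.Adj v u)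
    {L : ℕ → ℕ} (hL : s.natArr aLev = L) (hB : IsBfs g C v L (s.natArr aPar)) :
    Tri chooseRoot s (g.size C) fun s' => s'.nat vA ∈ C ∧ s'.nat vRoot ∈ C ∧
      ((∃ a ∈ C, L a = 3) → L (s'.nat vA) = 3 ∧ ∀ a ∈ C, L a = 3 →
        g.count a (L · = 4) ≤ g.count (s'.nat vA) (L · = 4)) ∧
      L (s'.nat vRoot) = 2 ∧ g.H.Adj (s'.nat vA) (s'.nat vRoot) ∧
      ∀ x ∈ C, L x = 2 → g.H.Adj (s'.nat vA) x →
        g.count x (L · = 3) ≤ g.count (s'.nat vRoot) (L · = 3) := by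
  refine (argBest_spec (L · = 3) (L · = 4) hs (hv ▸ hB.start_mem) (fun s₁ hF => ?_)
    (fun s₁ hF s₂ h _ => ?_)).bind fun s₁ hF1 ⟨h1, h2, h3⟩ => ?_
  · simp [hF.natArr aLev rfl, hL]
  · simp [h, hF.natArr aLev rfl, hL]
  have hc1 := hs.frame hF1 rfl
  refine Tri.setNat_seq ?_
  simp only [NatExp.eval]
  obtain ⟨a, ha⟩ : ∃ a, a = s₁.nat vArg := ⟨_, rfl⟩
  rw [← ha] at h1 h2 h3 ⊢
  -- The second search cannot fail: a vertex of level two has its parent, and if there is none, then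
  -- `a` is the start vertex, all of whose neighbours have level one.
  have hex : ∃ x ∈ C, L x = 2 ∧ g.H.Adj a x := by
    by_cases h : ∃ x ∈ C, L x = 3
    · obtain ⟨ha3, -⟩ := h2 h
      have hav : a ≠ v := by rintro rfl; rw [hB.start] at ha3; omega
      obtain ⟨h4, h5⟩ := hB.par a h1 hav
      exact ⟨_, hs.closed.adj a h1 _ h4, by omega, h4⟩
    · push Not at h
      have hav : a = v := (h3 h).trans hv
      obtain ⟨u, hu⟩ := hnb
      have huC := hs.closed.adj v hB.start_mem u hu
      have h4 := hB.adj v hB.start_mem u hu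
      have h5 := hB.pos u huC
      have h6 : L u ≠ 1 := fun h => hu.ne (hB.eq_start u huC h).symm
      rw [hB.start] at h4
      exact ⟨u, huC, by omega, hav ▸ hu⟩
  have hc2 : HoldsComp g C (s₁.setNat vA a) :=
    ⟨⟨hc1.size, hc1.off, hc1.nbr, hc1.wt⟩, hc1.closed, hc1.queue⟩
  refine (mark_spec hc2 (x := vA) (v := a) (by simp) h1 rfl).bind fun s₃ hF3 hmark => ?_
  have hc3 := hc2.frame hF3 rfl
  have hL3 : s₃.natArr aLev = L := ((hF3.natArr _ rfl).trans (hF1.natArr _ rfl)).trans hL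
  have hA3 : s₃.nat vA = a := by rw [hF3.nat vA rfl]; simp
  have hS3 : s₃.nat vStart ∈ C := by
    rw [hF3.nat vStart rfl, setNat_nat, if_neg (by omega), hF1.nat vStart rfl, hv]
    exact hB.start_mem
  refine (argBest_spec (fun x => L x = 2 ∧ s₃.natArr aMark x = 1) (L · = 3) hc3 hS3
    (fun s₁ hF => ?_) (fun s₁ hF s₂ h _ => ?_)).bind fun s₄ hF4 ⟨h5, h6, _⟩ => ?_
  · simp [hF.natArr aLev rfl, hF.natArr aMark rfl, hL3]
  · simp [h, hF.natArr aLev rfl, hL3]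
  have hm : ∀ x ∈ C, s₃.natArr aMark x = 1 ↔ g.H.Adj a x := fun x hx => by
    rw [hmark x hx]; split_ifs with h <;> simp [h]
  have hA4 : s₄.nat vA = a := (hF4.nat _ rfl).trans hA3
  obtain ⟨⟨h7, h8⟩, h9⟩ := h6 (by
    obtain ⟨x, h1, h2, h3⟩ := hex
    exact ⟨x, h1, h2, (hm x h1).2 h3⟩)
  refine Tri.setNat ?_
  simp only [NatExp.eval, setNat_nat, if_true, if_false, Nat.reduceEqDiff, hA4]
  exact ⟨h1, h5, h2, h7, (hm _ h5).1 h8, fun x hx h h' => h9 x hx ⟨h, (hm x hx).2 h'⟩⟩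

/-- Computes the distances from `vRoot` and a vertex `vA₀` not adjacent to `vRoot` with the smallest
number of common neighbours with `vRoot`; if there is none, `vA₀` is `vRoot`. -/
def setDist : Program :=
  fill aDist 2 ;; setNbrs aDist vRoot 1 ;; .storeNat aDist (.var vRoot) (.lit 0) ;;
  argBest false (.eq (.get aDist (.var vX)) (.lit 2)) (.eq (.get aDist (.var vU)) (.lit 1)) ;;
  .ite (.eq (.get aDist (.var vArg)) (.lit 2)) (.setNat vA₀ (.var vArg)) (.setNat vA₀ (.var vRoot))

/-- Minimality of the common neighbourhood serves twice: it lets one vertex decide whether the root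
has eccentricity at most two, and it is the hypothesis `hmin` of `cover_cases_root_uncovered`. -/
theorem setDist_spec {g : Net} {C : Finset ℕ} {s : State} {r : ℕ} (hs : HoldsComp g C s)
    (hv : s.nat vStart ∈ C) (hr : s.nat vRoot = r) (hrC : r ∈ C) :
    Tri setDist s (g.size C) fun s' => HoldsDist g C r s' ∧ s'.nat vA₀ ∈ C ∧
      ((∀ x ∈ C, x ≠ r → g.H.Adj r x) → s'.nat vA₀ = r) ∧
      ((∃ x ∈ C, x ≠ r ∧ ¬ g.H.Adj r x) → (s'.nat vA₀ ≠ r ∧ ¬ g.H.Adj r (s'.nat vA₀)) ∧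
        ∀ x ∈ C, x ≠ r ∧ ¬ g.H.Adj r x → g.count (s'.nat vA₀) (g.H.Adj r) ≤ g.count x (g.H.Adj r)) := by
  refine (fill_spec hs rfl).bind fun s₁ hF1 h1 => ?_
  have hc1 := hs.frame hF1 rfl
  have hr1 : s₁.nat vRoot = r := (hF1.nat _ rfl).trans hr
  refine ((setNbrs_spec (x := vRoot) hc1.toHolds hr1 (hs.closed.lt r hrC) rfl rfl).wk
    (g.deg_le_size hrC) fun _ _ h => h).bind fun s₂ hF2 h2 => ?_
  have hc2 := hc1.frame hF2 rfl
  have hr2 : s₂.nat vRoot = r := (hF2.nat _ rfl).trans hr1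
  refine Tri.storeNat_seq ?_
  simp only [NatExp.eval, hr2]
  generalize hs3 : s₂.storeNat aDist r 0 = s₃
  have hc3 : HoldsComp g C s₃ := by
    subst hs3; exact ⟨⟨hc2.size, hc2.off, hc2.nbr, hc2.wt⟩, hc2.closed, hc2.queue⟩
  have hd3 : HoldsDist g C r s₃ := by
    intro u hu
    subst hs3
    simp only [storeNat_natArr, if_true, Function.update_apply, h2, h1 u hu]
  have hS3 : s₃.nat vStart ∈ C := by
    subst hs3
    rw [storeNat_nat, hF2.nat vStart rfl, hF1.nat vStart rfl]; exact hv
  refine (argBest_spec (s₃.natArr aDist · = 2) (s₃.natArr aDist · = 1) hc3 hS3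
    (fun s₁ hF => ?_) (fun s₁ hF s₂ h _ => ?_)).bind fun s₄ hF4 ⟨h5, h6, _⟩ => ?_
  · simp [hF.natArr aDist rfl]
  · simp [h, hF.natArr aDist rfl]
  have hd4 : HoldsDist g C r s₄ := fun u hu => by rw [hF4.natArr aDist rfl]; exact hd3 u hu
  have hr4 : s₄.nat vRoot = r := by rw [hF4.nat vRoot rfl]; subst hs3; exact (hF2.nat _ rfl).trans hr1
  refine Tri.ite (fun h => Tri.setNat ?_) (fun h => Tri.setNat ?_) <;>
    simp only [Test.eval, NatExp.eval, hd4.eq_two h5] at h <;>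
    simp only [NatExp.eval, setNat_nat, if_true]
  swap
  · rw [hr4]
    refine ⟨hd4, hrC, fun _ => rfl, ?_⟩
    rintro ⟨x, hx, hx'⟩
    have := (h6 ⟨x, hx, (hd3.eq_two hx).2 hx'⟩).1
    exact absurd ((hd3.eq_two h5).1 this) h
  refine ⟨hd4, h5, fun h' => absurd (h' _ h5 h.1) h.2, ?_⟩
  rintro ⟨x, hx, hx'⟩
  obtain ⟨h7, h8⟩ := h6 ⟨x, hx, (hd3.eq_two hx).2 hx'⟩
  refine ⟨(hd3.eq_two h5).1 h7, fun y hy hy' => ?_⟩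
  have := h8 y hy ((hd3.eq_two hy).2 hy')
  have hcongr : ∀ z ∈ C, g.count z (s₃.natArr aDist · = 1) = g.count z (g.H.Adj r) := fun z hz =>
    g.count_congr fun u hu => hd3.eq_one (hs.closed.adj z hz u hu)
  rw [hcongr y hy, hcongr _ h5] at this
  simpa [ordLe] using this

/-- Looks for an induced path if `vA₀` has no common neighbour with `vRoot`. -/
def testRoot : Program :=
  .setNat vB (.var vStart) ;; .setNat vC (.var vStart) ;;
  .setNat vAnc1 (.get aPar (.var vA₀)) ;; .setNat vAnc2 (.get aPar (.var vAnc1)) ;;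
  mark vAnc1 ;;
  find vA (.and (.eq (.get aLev (.var vU)) (.lit 4)) (.eq (.get aMark (.var vU)) (.lit 0))) vC ;;
  find vRoot (.and (.eq (.get aLev (.var vU)) (.lit 3)) (.eq (.get aMark (.var vU)) (.lit 0))) vB ;;
  tryP5 vA₀ vAnc1 vStart vRoot vB ;; tryP5 vStart vRoot vA vC vA₀ ;;
  tryP5 vStart vRoot vA vAnc1 vA₀ ;; tryP5 vC vA vAnc2 vAnc1 vA₀ ;;
  tryP5 vC vA vRoot vAnc2 vAnc1 ;; tryP5 vC vA vRoot vStart vAnc2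

/-- Only the single vertex `z` is examined, with the six paths of `eccentricity_le_two`. When a
search for `b` or `c` fails, the default vertex is tested instead; this is allowed because the lemma
asks for these vertices only if they exist. -/
theorem testRoot_spec {g : Net} {C : Finset ℕ} {s : State} {v a x z : ℕ} (hs : HoldsComp g C s)
    (hP : StoresP5 g s) (hv : s.nat vStart = v) (ha : s.nat vA = a) (haC : a ∈ C)
    (hx : s.nat vRoot = x) (hxC : x ∈ C) (hz : s.nat vA₀ = z) (hzC : z ∈ C)
    {L P : ℕ → ℕ} (hL : s.natArr aLev = L) (hPar : s.natArr aPar = P) (hB : IsBfs g C v L P)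
    (hamax : (∃ a ∈ C, L a = 3) → L a = 3 ∧ ∀ a' ∈ C, L a' = 3 →
        g.count a' (L · = 4) ≤ g.count a (L · = 4))
    (hLx : L x = 2) (hax : g.H.Adj a x)
    (hxmax : ∀ x' ∈ C, L x' = 2 → g.H.Adj a x' → g.count x' (L · = 3) ≤ g.count x (L · = 3)) :
    Tri testRoot s (g.size C) fun s' => StoresP5 g s' ∧ (s'.nat vFlag = 0 → s.nat vFlag = 0 ∧
      ((∀ y ∈ C, L y ≤ 4) → z = x ∨ g.H.Adj x z ∨ ∃ y, g.H.Adj x y ∧ g.H.Adj z y)) := by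
  have hp := hB.par_mem hs.closed hzC
  have hq := hB.par_mem hs.closed hp
  have hvC := hB.start_mem
  refine Tri.setNat_seq (Tri.setNat_seq (Tri.setNat_seq (Tri.setNat_seq ?_)))
  simp only [NatExp.eval, setNat_nat, setNat_natArr, Nat.reduceEqDiff, if_true, if_false, hPar, hz, hv]
  generalize hs1 : (State.setNat (State.setNat (State.setNat (State.setNat s vB v) vC v) vAnc1
    (P z)) vAnc2 (P (P z))) = s₁
  have hc1 : HoldsComp g C s₁ := by
    subst hs1; exact ⟨⟨hs.size, hs.off, hs.nbr, hs.wt⟩, hs.closed, hs.queue⟩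
  have hP1 : StoresP5 g s₁ := by subst hs1; exact hP
  have n1 : s₁.nat vStart = v ∧ s₁.nat vA = a ∧ s₁.nat vRoot = x ∧ s₁.nat vA₀ = z ∧
      s₁.nat vAnc1 = P z ∧ s₁.nat vAnc2 = P (P z) ∧ s₁.nat vB = v ∧ s₁.nat vC = v ∧
      s₁.nat vFlag = s.nat vFlag ∧ s₁.natArr aLev = L := by
    subst hs1; simp [hv, ha, hx, hz, hL]
  clear hs1
  obtain ⟨e1, e2, e3, e4, e5, e6, e7, e8, e9, e10⟩ := n1
  refine (mark_spec hc1 e5 hp rfl).bind fun s₂ hF2 hmark => ?_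
  have hm : ∀ u ∈ C, s₂.natArr aMark u = 0 ↔ ¬ g.H.Adj (P z) u := fun u hu => by
    rw [hmark u hu]; split_ifs with h <;> simp [h]
  have hc2 := hc1.frame hF2 rfl
  have hL2 : s₂.natArr aLev = L := (hF2.natArr _ rfl).trans e10
  refine ((find_spec (fun u => L u = 4 ∧ s₂.natArr aMark u = 0) hc2.toHolds (x := vA) (v := a)
    (out := vC) ((hF2.nat _ rfl).trans e2) (hs.closed.lt a haC) rfl rfl
    (fun s' h _ => by simp [h, hL2])).wk (g.deg_le_size haC) fun _ _ h => h).bind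
    fun s₃ hF3 ⟨hc, hc'⟩ => ?_
  have hc3 := hc2.frame hF3 rfl
  refine ((find_spec (fun u => L u = 3 ∧ s₂.natArr aMark u = 0) hc3.toHolds (x := vRoot) (v := x)
    (out := vB) (((hF3.nat _ rfl).trans (hF2.nat _ rfl)).trans e3) (hs.closed.lt x hxC) rfl rfl
    (fun s' h _ => by simp [h, hF3.natArr aLev rfl, hF3.natArr aMark rfl, hL2])).wk
    (g.deg_le_size hxC) fun _ _ h => h).bind fun s₄ hF4 ⟨hb, hb'⟩ => ?_
  have hc4 := hc3.frame hF4 rfl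
  have hP4 : StoresP5 g s₄ := ((hP1.frame hF2 rfl).frame hF3 rfl).frame hF4 rfl
  obtain ⟨c, hcdef⟩ : ∃ c, c = s₃.nat vC := ⟨_, rfl⟩
  obtain ⟨b, hbdef⟩ : ∃ b, b = s₄.nat vB := ⟨_, rfl⟩
  rw [← hcdef] at hc hc'
  rw [← hbdef] at hb hb'
  have hcC : c ∈ C := by
    rcases hc' with h | h
    · rw [h, hF2.nat vC rfl, e8]; exact hvC
    · exact hs.closed.adj a haC c h
  have hbC : b ∈ C := by
    rcases hb' with h | h
    · rw [h, hF3.nat vB rfl, hF2.nat vB rfl, e7]; exact hvC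
    · exact hs.closed.adj x hxC b h
  -- the variables during the tests
  have vals : ∀ s' : State, (∀ i, 16 < i → s'.nat i = s₄.nat i) → s'.nat vStart = v ∧ s'.nat vA = a ∧
      s'.nat vRoot = x ∧ s'.nat vA₀ = z ∧ s'.nat vAnc1 = P z ∧ s'.nat vAnc2 = P (P z) ∧
      s'.nat vB = b ∧ s'.nat vC = c := by
    intro s' h
    refine ⟨?_, ?_, ?_, ?_, ?_, ?_, ?_, ?_⟩ <;> rw [h _ (by omega)]
    · rw [hF4.nat _ rfl, hF3.nat _ rfl, hF2.nat _ rfl, e1]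
    · rw [hF4.nat _ rfl, hF3.nat _ rfl, hF2.nat _ rfl, e2]
    · rw [hF4.nat _ rfl, hF3.nat _ rfl, hF2.nat _ rfl, e3]
    · rw [hF4.nat _ rfl, hF3.nat _ rfl, hF2.nat _ rfl, e4]
    · rw [hF4.nat _ rfl, hF3.nat _ rfl, hF2.nat _ rfl, e5]
    · rw [hF4.nat _ rfl, hF3.nat _ rfl, hF2.nat _ rfl, e6]
    · exact hbdef.symm
    · rw [hF4.nat _ rfl, hcdef]
  have hfl : s₄.nat vFlag = s.nat vFlag := by
    rw [hF4.nat _ rfl, hF3.nat _ rfl, hF2.nat _ rfl, e9]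
  -- one test, given the outcome `R` of the previous ones
  have keep : ∀ {a b c d e : ℕ} {s s' : State}, Frame (tryP5 a b c d e) s s' →
      ∀ i, 16 < i → s'.nat i = s.nat i := by
    intro a b c d e s s' hF i hi
    refine hF.nat i ?_
    simp [tryP5, checkAdj, scan, forNbr, Program.modNat]
    omega
  have step : ∀ (i₁ i₂ i₃ i₄ i₅ u₁ u₂ u₃ u₄ u₅ : ℕ) (R : Prop) (s₅ : State),
      (Holds g s₅ ∧ StoresP5 g s₅ ∧ (∀ i, 16 < i → s₅.nat i = s₄.nat i) ∧
        (s₅.nat vFlag = 0 → R)) →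
      (16 < i₁ ∧ 16 < i₂ ∧ 16 < i₃ ∧ 16 < i₄ ∧ 16 < i₅) →
      (s₅.nat i₁ = u₁ ∧ s₅.nat i₂ = u₂ ∧ s₅.nat i₃ = u₃ ∧ s₅.nat i₄ = u₄ ∧ s₅.nat i₅ = u₅) →
      (u₁ ∈ C ∧ u₂ ∈ C ∧ u₃ ∈ C ∧ u₄ ∈ C ∧ u₅ ∈ C) →
      Tri (tryP5 i₁ i₂ i₃ i₄ i₅) s₅ (g.size C) fun s₆ => Holds g s₆ ∧ StoresP5 g s₆ ∧
        (∀ i, 16 < i → s₆.nat i = s₄.nat i) ∧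
        (s₆.nat vFlag = 0 → R ∧ ¬ IsP5 g.H u₁ u₂ u₃ u₄ u₅) := by
    rintro i₁ i₂ i₃ i₄ i₅ _ _ _ _ _ R s₅ ⟨h1, h2, h3, h4⟩ ⟨l1, l2, l3, l4, l5⟩
      ⟨rfl, rfl, rfl, rfl, rfl⟩ ⟨m1, m2, m3, m4, m5⟩
    refine (tryP5_spec hs.closed h1 h2 ⟨l1, m1⟩ ⟨l2, m2⟩ ⟨l3, m3⟩ ⟨l4, m4⟩ ⟨l5, m5⟩).wk le_rfl
      fun s₆ hF6 ⟨h5, h6⟩ => ⟨?_, h5, fun i hi => (keep hF6 i hi).trans (h3 i hi),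
        fun h0 => ⟨h4 (h6 h0).1, (h6 h0).2⟩⟩
    refine h1.frame hF6 ?_
    simp [Program.keepsInput, tryP5, checkAdj, scan, forNbr, Program.modNat, Program.modNatArr,
      Program.modRealArr]
  obtain ⟨f1, f2, f3, f4, f5, f6, f7, f8⟩ := vals s₄ fun _ _ => rfl
  refine (step vA₀ vAnc1 vStart vRoot vB z (P z) v x b (s.nat vFlag = 0) s₄
    ⟨hc4.toHolds, hP4, fun _ _ => rfl, fun h => hfl ▸ h⟩ (by omega) ⟨f4, f5, f1, f3, f7⟩
    ⟨hzC, hp, hvC, hxC, hbC⟩).bind fun s₅ _ h5 => ?_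
  obtain ⟨f1, f2, f3, f4, f5, f6, f7, f8⟩ := vals s₅ h5.2.2.1
  refine (step vStart vRoot vA vC vA₀ v x a c z _ s₅ h5 (by omega) ⟨f1, f3, f2, f8, f4⟩
    ⟨hvC, hxC, haC, hcC, hzC⟩).bind fun s₆ _ h6 => ?_
  obtain ⟨f1, f2, f3, f4, f5, f6, f7, f8⟩ := vals s₆ h6.2.2.1
  refine (step vStart vRoot vA vAnc1 vA₀ v x a (P z) z _ s₆ h6 (by omega) ⟨f1, f3, f2, f5, f4⟩
    ⟨hvC, hxC, haC, hp, hzC⟩).bind fun s₇ _ h7 => ?_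
  obtain ⟨f1, f2, f3, f4, f5, f6, f7, f8⟩ := vals s₇ h7.2.2.1
  refine (step vC vA vAnc2 vAnc1 vA₀ c a (P (P z)) (P z) z _ s₇ h7 (by omega)
    ⟨f8, f2, f6, f5, f4⟩ ⟨hcC, haC, hq, hp, hzC⟩).bind fun s₈ _ h8 => ?_
  obtain ⟨f1, f2, f3, f4, f5, f6, f7, f8⟩ := vals s₈ h8.2.2.1
  refine (step vC vA vRoot vAnc2 vAnc1 c a x (P (P z)) (P z) _ s₈ h8 (by omega)
    ⟨f8, f2, f3, f6, f5⟩ ⟨hcC, haC, hxC, hq, hp⟩).bind fun s₉ _ h9 => ?_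
  obtain ⟨f1, f2, f3, f4, f5, f6, f7, f8⟩ := vals s₉ h9.2.2.1
  refine (step vC vA vRoot vStart vAnc2 c a x v (P (P z)) _ s₉ h9 (by omega)
    ⟨f8, f2, f3, f1, f6⟩ ⟨hcC, haC, hxC, hvC, hq⟩).wk le_rfl
    fun s' _ ⟨_, hP', _, hfin⟩ => ⟨hP', fun h0 => ?_⟩
  obtain ⟨⟨⟨⟨⟨⟨h0, k1⟩, k2⟩, k3⟩, k4⟩, k5⟩, k6⟩ := hfin h0
  refine ⟨h0, fun hle => ?_⟩
  have hpos := hB.pos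
  refine eccentricity_le_two (H := g.H) (C := (C : Set ℕ)) (lev := fun y => L y - 1) (par := P)
    (v := v) (a := a) (x := x) (z := z) (c := c) (b := b)
    (cnt3 := fun y => g.count y (L · = 4)) (cnt2 := fun y => g.count y (L · = 3))
    (fun x hx => hs.closed.adj x hx) ?_ (by simp [hB.start]) ?_ ?_ ?_ ?_ ?_ ?_ hxC (by simp [hLx])
    hax ?_ hzC ?_ ?_ k1 k2 k3 k4 k5 k6
  · intro y hy h
    have := hpos y hy
    exact hB.eq_start y hy (by omega)
  · intro y hy u hu
    have := hB.adj y hy u hu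
    have := hpos y hy
    omega
  · intro y hy hyv
    have := hB.par y hy hyv
    have h' := hpos _ (hB.par_mem hs.closed hy)
    refine ⟨this.1, ?_⟩
    omega
  · intro y hy
    have := hle y hy
    omega
  · intro y y' h ⟨u, h1, h2, h3⟩
    exact g.count_lt (fun u hu h4 => h u hu (by simp [h4])) ⟨u, h1, by omega, h3⟩
  · intro y y' h ⟨u, h1, h2, h3⟩
    exact g.count_lt (fun u hu h4 => h u hu (by simp [h4])) ⟨u, h1, by omega, h3⟩
  · rintro ⟨a', h1, h2⟩
    obtain ⟨h3, h4⟩ := hamax ⟨a', h1, by omega⟩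
    exact ⟨haC, by simp [h3], fun a'' h5 h6 => h4 a'' h5 (by omega)⟩
  · intro x' h1 h2 h3
    exact hxmax x' h1 (by omega) h3
  · rintro ⟨c', h1, h2, h3⟩
    obtain ⟨h4, h5, h6⟩ := hc ⟨c', h1, by omega,
      (hm c' (hs.closed.adj a haC c' h1)).2 h3⟩
    exact ⟨h4, by simp [h5], (hm c hcC).1 h6⟩
  · rintro ⟨c', h1, h2, h3⟩
    obtain ⟨h4, h5, h6⟩ := hb ⟨c', h1, by omega, by
      rw [hm c' (hs.closed.adj x hxC c' h1)]; exact h3⟩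
    exact ⟨h4, by simp [h5], (hm b hbC).1 h6⟩

/-! ## The anchors of the candidates -/

/-- Finds a neighbour of the vertex held by `x` that passes the test; the start vertex if there is
none. -/
def findFrom (x : ℕ) (t : Test) (out : ℕ) : Program :=
  .setNat out (.var vStart) ;; find x t out

/-- Thanks to the default, `out` lies in `C` even if the search fails, and it can be handed on
without a case distinction. -/
theorem findFrom_spec {g : Net} {C : Finset ℕ} {s : State} {x v out : ℕ} {t : Test} (p : ℕ → Prop)
    (hs : HoldsComp g C s) (hst : s.nat vStart ∈ C) (hx : 16 < x) (ho : 16 < out) (hxo : x ≠ out)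
    (hv : s.nat x = v) (hvC : v ∈ C)
    (ht : ∀ s₁ : State, s₁.natArr = s.natArr → (∀ y, 16 < y → y ≠ out → s₁.nat y = s.nat y) →
      (t.eval s₁ ↔ p (s₁.nat vU))) :
    Tri (findFrom x t out) s (g.size C) fun s' => HoldsComp g C s' ∧ s'.natArr = s.natArr ∧
      (∀ y, 16 < y → y ≠ out → s'.nat y = s.nat y) ∧ (∀ y, y ≤ 6 → s'.nat y = s.nat y) ∧
      s'.nat out ∈ C ∧
      ((∃ u, g.H.Adj v u ∧ p u) → g.H.Adj v (s'.nat out) ∧ p (s'.nat out)) := by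
  refine Tri.setNat_seq ?_
  simp only [NatExp.eval]
  have hmod : ∀ z, 10 < z → (scan x t).modNat z = false := by
    intro z hz
    simp [scan, forNbr, Program.modNat]
    omega
  have hmod' : ∀ z, 10 < z → z ≠ out → (find x t out).modNat z = false := by
    intro z hz hzo
    simp [find, Program.modNat, hmod z hz, hzo]
  have hmod'' : ∀ z, z ≤ 6 → (find x t out).modNat z = false := by
    intro z hz
    simp [find, scan, forNbr, Program.modNat]
    omega
  have hc : HoldsComp g C (s.setNat out (s.nat vStart)) := by
    refine ⟨⟨?_, hs.off, hs.nbr, hs.wt⟩, hs.closed, ?_⟩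
    · rw [setNat_nat, if_neg (by omega)]; exact hs.size
    · rw [setNat_nat, setNat_nat, if_neg (by omega), if_neg (by omega)]; exact hs.queue
  refine ((find_spec p hc.toHolds (x := x) (v := v)
    (by rw [setNat_nat, if_neg hxo, hv]) (hs.closed.lt v hvC) (hmod x (by omega))
    (hmod out (by omega)) (fun s₁ h h' => ?_)).wk (g.deg_le_size hvC)) fun s₂ hF ⟨h1, h2⟩ => ?_
  · refine ht s₁ (funext h) fun y hy hyo => ?_
    rw [h' y (by omega) (by omega) (by omega) (by omega) (by omega), setNat_nat, if_neg hyo]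
  · refine ⟨⟨hc.toHolds.frame hF ?_, hs.closed, ?_⟩, funext fun a => hF.natArr a rfl,
      fun y hy hyo => ?_, fun y hy => ?_, ?_, h1⟩
    · simp [Program.keepsInput, find, Program.modNat, scan, forNbr, Program.modNatArr,
        Program.modRealArr]
      omega
    · rw [hF.nat vLo (hmod' _ (by omega) (by omega)), hF.nat vHi (hmod' _ (by omega) (by omega)),
        hF.natArr aQueue rfl]
      exact hc.queue
    · rw [hF.nat y (hmod' y (by omega) hyo), setNat_nat, if_neg hyo]
    · rw [hF.nat y (hmod'' y hy), setNat_nat, if_neg (by omega)]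
    · rcases h2 with h2 | h2
      · rw [h2, setNat_nat, if_pos rfl]; exact hst
      · exact hs.closed.adj v hvC _ h2

/-- The vertices from which the candidates are built. -/
structure Anchors (g : Net) (C : Finset ℕ) (r a₀ y₀ b₀ c₀ p y₁ y₂ : ℕ) : Prop where
  closed : g.Closed C
  root : r ∈ C
  nbr : ∃ x, g.H.Adj r x
  ecc : ∀ b ∈ C, b ≠ r → ¬ g.H.Adj r b → ∃ x, g.H.Adj r x ∧ g.H.Adj b x
  far : (∃ b ∈ C, b ≠ r ∧ ¬ g.H.Adj r b) → a₀ ∈ C ∧ a₀ ≠ r ∧ ¬ g.H.Adj r a₀ ∧ g.H.Adj r y₀ ∧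
    g.H.Adj a₀ y₀ ∧ NoPathThrough g.H C r a₀ y₀
  far_mem : a₀ ∈ C
  far_min : ∀ b ∈ C, b ≠ r → ¬ g.H.Adj r b → (∀ x, g.H.Adj r x → g.H.Adj b x → g.H.Adj a₀ x) →
    ∀ x, g.H.Adj r x → g.H.Adj a₀ x → g.H.Adj b x
  second : (∃ b, ¬ g.H.Adj r b ∧ g.H.Adj a₀ b) → ¬ g.H.Adj r b₀ ∧ g.H.Adj a₀ b₀ ∧
    g.H.Adj r y₁ ∧ g.H.Adj b₀ y₁ ∧ NoPathThrough g.H C r b₀ y₁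
  third : (∃ b, ¬ g.H.Adj r b ∧ g.H.Adj a₀ b ∧ b ≠ b₀) → ¬ g.H.Adj r c₀ ∧ g.H.Adj a₀ c₀ ∧
    c₀ ≠ b₀ ∧ g.H.Adj r y₂ ∧ g.H.Adj c₀ y₂
  common : (∃ x, g.H.Adj r x ∧ g.H.Adj y₀ x) → g.H.Adj r p ∧ g.H.Adj y₀ p

/-- `M` is on `C` the set of the vertices with the property `p` and one more vertex. -/
def IsCand (C : Finset ℕ) (p : ℕ → Prop) (M : Set ℕ) : Prop :=
  ∃ m ∈ C, ∀ x ∈ C, x ∈ M ↔ p x ∨ x = m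

/-- A set that needs no additional vertex fits the common pattern by repeating one of its members.
-/
theorem IsCand.of_iff {C : Finset ℕ} {p : ℕ → Prop} {M : Set ℕ} {m : ℕ} (hm : m ∈ C)
    (h : ∀ x ∈ C, x ∈ M ↔ p x) (hp : p m) : IsCand C p M :=
  ⟨m, hm, fun x hx => (h x hx).trans ⟨Or.inl, by rintro (h | rfl) <;> assumption⟩⟩

/-- The structure theorem behind the algorithm: a bounded number of families, each with one free
vertex, contains every admissible covered set of the component. -/
theorem Anchors.isCand {g : Net} {C : Finset ℕ} {r a₀ y₀ b₀ c₀ p y₁ y₂ : ℕ}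
    (h : Anchors g C r a₀ y₀ b₀ c₀ p y₁ y₂) {M : Set ℕ} (hM : g.Good C M) :
    IsCand C (fun _ => True) M ∨
    IsCand C (fun x => ¬ (x ≠ r ∧ ¬ g.H.Adj r x ∧ g.H.Adj a₀ x)) M ∨
    IsCand C (fun x => x = r ∨ g.H.Adj r x ∨ g.H.Adj a₀ x) M ∨
    IsCand C (g.H.Adj r) M ∨
    IsCand C (fun x => g.H.Adj r x ∨ x = a₀ ∨ (x ≠ r ∧ ¬ g.H.Adj r x ∧ g.H.Adj a₀ x)) M ∨
    IsCand C (fun x => ¬ g.H.Adj r x) M ∨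
    ∃ u, (u = y₀ ∨ u = p ∨ u = y₁ ∨ u = y₂) ∧
      IsCand C (fun x => x = r ∨ x = u ∨ (x ≠ r ∧ ¬ g.H.Adj r x ∧ ¬ g.H.Adj u x)) M := by
  have hcl : ∀ x ∈ (C : Set ℕ), ∀ u, g.H.Adj x u → u ∈ (C : Set ℕ) :=
    fun x hx => h.closed.adj x hx
  have hr := h.root
  by_cases hrM : r ∈ M
  · by_cases hfull : ∀ x, g.H.Adj r x → x ∈ M
    · rcases cover_cases_root_full (C := (C : Set ℕ)) hcl hr h.ecc hM h.far hrM hfull with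
        h1 | h1 | h1
      · exact Or.inl (.of_iff hr (fun x hx => iff_of_true (h1 x hx) trivial) trivial)
      · exact Or.inr (Or.inl (.of_iff hr h1 (by simp)))
      · exact Or.inr (Or.inr (Or.inl (.of_iff hr h1 (Or.inl rfl))))
    · obtain ⟨⟨u, hru, hu⟩, huniq⟩ := (hM r hr).2 hrM
      have huniq := huniq.resolve_left hfull
      rcases cover_cases_root_mate (C := (C : Set ℕ)) hcl hr h.ecc hM h.far
        (fun h' => ⟨(h.second h').1, (h.second h').2.1, (h.second h').2.2.1,
          (h.second h').2.2.2.1⟩) h.third h.common hrM hru hu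
        (fun x hx hxM => huniq x u hx hxM hru hu) with h1 | ⟨h1, h2⟩
      · exact Or.inr (Or.inr (Or.inr (Or.inr (Or.inr (Or.inl
          ⟨u, h.closed.adj r hr u hru, h1⟩)))))
      · exact Or.inr (Or.inr (Or.inr (Or.inr (Or.inr (Or.inr
          ⟨u, h1, .of_iff hr h2 (Or.inl rfl)⟩)))))
  · rcases cover_cases_root_uncovered (C := (C : Set ℕ)) hcl hr h.ecc hM h.nbr h.far h.far_min
      h.second hrM with h1 | h1
    · exact Or.inr (Or.inr (Or.inr (Or.inl h1)))
    · exact Or.inr (Or.inr (Or.inr (Or.inr (Or.inl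
        (.of_iff h.far_mem h1 (Or.inr (Or.inl rfl)))))))

/-- Finds the anchors. -/
def helpers : Program :=
  findFrom vA₀ (.eq (.get aDist (.var vU)) (.lit 1)) vY₀ ;;
  findFrom vA₀ (.eq (.get aDist (.var vU)) (.lit 2)) vB₀ ;;
  findFrom vA₀ (.and (.eq (.get aDist (.var vU)) (.lit 2)) (.not (.eq (.var vU) (.var vB₀)))) vC₀ ;;
  findFrom vY₀ (.eq (.get aDist (.var vU)) (.lit 1)) vP ;;
  findFrom vB₀ (.eq (.get aDist (.var vU)) (.lit 1)) vY₁ ;;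
  findFrom vC₀ (.eq (.get aDist (.var vU)) (.lit 1)) vY₂ ;;
  checkPaths vA₀ vY₀ ;; checkPaths vB₀ vY₁

/-- The anchors are found whether or not they make sense. Their properties are claimed only if both
path checks have failed and `a` is known to be within distance two of the root. -/
theorem helpers_spec {g : Net} {C : Finset ℕ} {s : State} {r a : ℕ} (hs : HoldsComp g C s)
    (hP : StoresP5 g s) (hst : s.nat vStart ∈ C) (hr : s.nat vRoot = r) (hrC : r ∈ C)
    (hd : HoldsDist g C r s) (ha : s.nat vA₀ = a) (haC : a ∈ C) (hnb : ∃ x, g.H.Adj r x)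
    (hnone : (∀ x ∈ C, x ≠ r → g.H.Adj r x) → a = r)
    (hmin : (∃ x ∈ C, x ≠ r ∧ ¬ g.H.Adj r x) → (a ≠ r ∧ ¬ g.H.Adj r a) ∧
        ∀ x ∈ C, x ≠ r ∧ ¬ g.H.Adj r x → g.count a (g.H.Adj r) ≤ g.count x (g.H.Adj r)) :
    Tri helpers s (g.size C) fun s' => HoldsComp g C s' ∧ StoresP5 g s' ∧
      s'.natArr aDist = s.natArr aDist ∧ s'.nat vA₀ = a ∧
      (s'.nat vY₀ ∈ C ∧ s'.nat vP ∈ C ∧ s'.nat vY₁ ∈ C ∧ s'.nat vY₂ ∈ C) ∧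
      (s'.nat vFlag = 0 → s.nat vFlag = 0 ∧
        ((a = r ∨ g.H.Adj r a ∨ ∃ y, g.H.Adj r y ∧ g.H.Adj a y) →
          Anchors g C r a (s'.nat vY₀) (s'.nat vB₀) (s'.nat vC₀) (s'.nat vP) (s'.nat vY₁)
            (s'.nat vY₂))) := by
  have e1 : ∀ s₁ : State, s₁.natArr = s.natArr → ((Test.eq (.get aDist (.var vU)) (.lit 1)).eval s₁ ↔
      s.natArr aDist (s₁.nat vU) = 1) := fun s₁ h => by simp [h]
  refine (findFrom_spec (s.natArr aDist · = 1) hs hst (by omega) (by omega) (by omega) ha haC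
    (fun s₁ h _ => e1 _ h)).bind fun s₁ _ ⟨c1, A1, u1, l1, m1, f1⟩ => ?_
  refine (findFrom_spec (s.natArr aDist · = 2) c1 (u1 vStart (by omega) (by omega) ▸ hst) (by omega)
    (by omega) (by omega) ((u1 vA₀ (by omega) (by omega)).trans ha) haC
    (fun s' h _ => by simp [h, A1])).bind fun s₂ _ ⟨c2, A2, u2, l2, m2, f2⟩ => ?_
  have v2 : ∀ y, 16 < y → y ≠ vY₀ → y ≠ vB₀ → s₂.nat y = s.nat y := fun y h h1 h2 =>
    (u2 y h h2).trans (u1 y h h1)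
  have A2 := A2.trans A1
  obtain ⟨b₀, hb₀⟩ : ∃ b, b = s₂.nat vB₀ := ⟨_, rfl⟩
  obtain ⟨y₀, hy₀⟩ : ∃ b, b = s₁.nat vY₀ := ⟨_, rfl⟩
  rw [← hy₀] at m1 f1
  rw [← hb₀] at m2 f2
  refine (findFrom_spec (fun u => s.natArr aDist u = 2 ∧ u ≠ b₀) c2
    (v2 vStart (by omega) (by omega) (by omega) ▸ hst) (by omega)
    (by omega) (by omega) ((v2 vA₀ (by omega) (by omega) (by omega)).trans ha) haC
    (fun s' h h' => by simp [h, A2, h' vB₀ (by omega) (by omega), ← hb₀])).bind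
    fun s₃ _ ⟨c3, A3, u3, l3, m3, f3⟩ => ?_
  have v3 : ∀ y, 16 < y → y ≠ vY₀ → y ≠ vB₀ → y ≠ vC₀ → s₃.nat y = s.nat y := fun y h h1 h2 h3 =>
    (u3 y h h3).trans (v2 y h h1 h2)
  have A3 := A3.trans A2
  obtain ⟨c₀, hc₀⟩ : ∃ b, b = s₃.nat vC₀ := ⟨_, rfl⟩
  rw [← hc₀] at m3 f3
  have hy3 : s₃.nat vY₀ = y₀ := by
    rw [u3 vY₀ (by omega) (by omega), u2 vY₀ (by omega) (by omega), hy₀]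
  have hb3 : s₃.nat vB₀ = b₀ := by rw [u3 vB₀ (by omega) (by omega), hb₀]
  refine (findFrom_spec (s.natArr aDist · = 1) c3
    (v3 vStart (by omega) (by omega) (by omega) (by omega) ▸ hst) (by omega)
    (by omega) (by omega) hy3 m1 (fun s' h _ => e1 _ (h.trans A3))).bind
    fun s₄ _ ⟨c4, A4, u4, l4, m4, f4⟩ => ?_
  have A4 := A4.trans A3
  refine (findFrom_spec (s.natArr aDist · = 1) c4
    ((u4 vStart (by omega) (by omega)).trans (v3 vStart (by omega) (by omega) (by omega) (by omega))
      ▸ hst) (by omega) (by omega) (by omega) ((u4 vB₀ (by omega) (by omega)).trans hb3) m2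
    (fun s' h _ => e1 _ (h.trans A4))).bind fun s₅ _ ⟨c5, A5, u5, l5, m5, f5⟩ => ?_
  have A5 := A5.trans A4
  have v5 : ∀ y, 16 < y → y ≠ vP → y ≠ vY₁ → s₅.nat y = s₃.nat y := fun y h h1 h2 =>
    (u5 y h h2).trans (u4 y h h1)
  refine (findFrom_spec (s.natArr aDist · = 1) c5
    ((v5 vStart (by omega) (by omega) (by omega)).trans (v3 vStart (by omega) (by omega) (by omega)
      (by omega)) ▸ hst) (by omega) (by omega) (by omega)
      ((v5 vC₀ (by omega) (by omega) (by omega)).trans hc₀.symm) m3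
    (fun s' h _ => e1 _ (h.trans A5))).bind fun s₆ _ ⟨c6, A6, u6, l6, m6, f6⟩ => ?_
  have A6 := A6.trans A5
  have l : ∀ y, y ≤ 6 → s₆.nat y = s.nat y := fun y h => by
    rw [l6 y h, l5 y h, l4 y h, l3 y h, l2 y h, l1 y h]
  have v6 : ∀ y, 16 < y → y ≠ vP → y ≠ vY₁ → y ≠ vY₂ → s₆.nat y = s₃.nat y := fun y h h1 h2 h3 =>
    (u6 y h h3).trans (v5 y h h1 h2)
  obtain ⟨p, hp⟩ : ∃ b, b = s₄.nat vP := ⟨_, rfl⟩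
  obtain ⟨y₁, hy₁⟩ : ∃ b, b = s₅.nat vY₁ := ⟨_, rfl⟩
  obtain ⟨y₂, hy₂⟩ : ∃ b, b = s₆.nat vY₂ := ⟨_, rfl⟩
  rw [← hp] at m4 f4
  rw [← hy₁] at m5 f5
  rw [← hy₂] at m6 f6
  have n6 : s₆.nat vStart = s.nat vStart ∧ s₆.nat vRoot = r ∧ s₆.nat vA₀ = a ∧ s₆.nat vY₀ = y₀ ∧
      s₆.nat vB₀ = b₀ ∧ s₆.nat vC₀ = c₀ ∧ s₆.nat vP = p ∧ s₆.nat vY₁ = y₁ ∧ s₆.nat vY₂ = y₂ := by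
    refine ⟨?_, ?_, ?_, ?_, ?_, ?_, ?_, ?_, hy₂.symm⟩
    · rw [v6 _ (by omega) (by omega) (by omega) (by omega),
        v3 _ (by omega) (by omega) (by omega) (by omega)]
    · rw [v6 _ (by omega) (by omega) (by omega) (by omega),
        v3 _ (by omega) (by omega) (by omega) (by omega), hr]
    · rw [v6 _ (by omega) (by omega) (by omega) (by omega),
        v3 _ (by omega) (by omega) (by omega) (by omega), ha]
    · rw [v6 _ (by omega) (by omega) (by omega) (by omega), hy3]
    · rw [v6 _ (by omega) (by omega) (by omega) (by omega), hb3]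
    · rw [v6 _ (by omega) (by omega) (by omega) (by omega), hc₀]
    · rw [u6 vP (by omega) (by omega), u5 vP (by omega) (by omega), hp]
    · rw [u6 vY₁ (by omega) (by omega), hy₁]
  have hP6 : StoresP5 g s₆ := by
    unfold StoresP5
    rw [l _ (by omega), l _ (by omega), l _ (by omega), l _ (by omega), l _ (by omega),
      l _ (by omega)]
    exact hP
  have hd6 : HoldsDist g C r s₆ := fun u hu => by rw [A6]; exact hd u hu
  have hfl := l vFlag (by omega)
  clear l v6 v5 v3 v2 u6 u5 u4 u3 u2 u1 l1 l2 l3 l4 l5 l6 c1 c2 c3 c4 c5 hb3 hy3 hp hy₁ hy₂ hb₀ hc₀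
    hy₀ A1 A2 A3 A4 A5 e1
  obtain ⟨n1, n2, n3, n4, n5, n6, n7, n8, n9⟩ := n6
  refine (checkPaths_spec (a := vA₀) (y := vY₀) c6 hP6 (n1 ▸ hst) n2 hrC hd6 (n3 ▸ haC) (n4 ▸ m1)
    ⟨by omega, rfl⟩ ⟨by omega, rfl⟩).bind fun s₇ F7 ⟨hP7, K1⟩ => ?_
  have hd7 : HoldsDist g C r s₇ := fun u hu => by rw [F7.natArr aDist rfl]; exact hd6 u hu
  refine (checkPaths_spec (a := vB₀) (y := vY₁) (c6.frame F7 rfl) hP7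
    (by rw [F7.nat vStart rfl, n1]; exact hst) ((F7.nat vRoot rfl).trans n2) hrC hd7
    (by rw [F7.nat vB₀ rfl, n5]; exact m2) (by rw [F7.nat vY₁ rfl, n8]; exact m5)
    ⟨by omega, rfl⟩ ⟨by omega, rfl⟩).wk le_rfl fun s₈ F8 ⟨hP8, K2⟩ => ?_
  have w : ∀ y, (checkPaths vA₀ vY₀).modNat y = false → (checkPaths vB₀ vY₁).modNat y = false →
      s₈.nat y = s₆.nat y := fun y h h' => (F8.nat y h').trans (F7.nat y h)
  rw [w vA₀ rfl rfl, w vY₀ rfl rfl, w vB₀ rfl rfl, w vC₀ rfl rfl, w vP rfl rfl, w vY₁ rfl rfl,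
    w vY₂ rfl rfl, n3, n4, n5, n6, n7, n8, n9]
  rw [F7.nat vB₀ rfl, F7.nat vY₁ rfl, n5, n8] at K2
  rw [n3, n4] at K1
  refine ⟨(c6.frame F7 rfl).frame F8 rfl, hP8, ?_, rfl, ⟨m1, m4, m5, m6⟩, fun h0 => ?_⟩
  · rw [F8.natArr aDist rfl, F7.natArr aDist rfl, A6]
  obtain ⟨h0, K2⟩ := K2 h0
  obtain ⟨h0, K1⟩ := K1 h0
  refine ⟨hfl ▸ h0, fun hecc => ?_⟩
  have hcl := hs.closed.adj
  have two : ∀ x u, x ∈ C → g.H.Adj x u → (s.natArr aDist u = 2 ↔ u ≠ r ∧ ¬ g.H.Adj r u) :=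
    fun x u hx hu => hd.eq_two (hcl x hx u hu)
  have one : ∀ x u, x ∈ C → g.H.Adj x u → (s.natArr aDist u = 1 ↔ g.H.Adj r u) :=
    fun x u hx hu => hd.eq_one (hcl x hx u hu)
  have hara : ¬ g.H.Adj r a := by
    by_cases h : ∃ x ∈ C, x ≠ r ∧ ¬ g.H.Adj r x
    · exact (hmin h).1.2
    · push Not at h
      rw [hnone h]; exact g.H.irrefl
  -- The vertex `a` has a common neighbour with the root, and no other such vertex has fewer.
  have ecc : ∀ b ∈ C, b ≠ r → ¬ g.H.Adj r b → ∃ x, g.H.Adj r x ∧ g.H.Adj b x := by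
    intro b hb hbr hrb
    obtain ⟨⟨h1, h2⟩, h3⟩ := hmin ⟨b, hb, hbr, hrb⟩
    obtain ⟨y, hy⟩ := (hecc.resolve_left h1).resolve_left h2
    have h4 := h3 b hb ⟨hbr, hrb⟩
    have h5 : g.count a (g.H.Adj r) ≠ 0 := fun h => g.count_eq_zero.1 h y hy.2 hy.1
    have h6 : g.count b (g.H.Adj r) ≠ 0 := by omega
    rw [Ne, g.count_eq_zero] at h6
    push Not at h6
    obtain ⟨x, h7, h8⟩ := h6
    exact ⟨x, h8, h7⟩
  have hrb : ∀ b, ¬ g.H.Adj r b → g.H.Adj a b → b ≠ r := by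
    rintro b - hab rfl; exact hara hab.symm
  have eccn : ∀ b ∈ C, b ≠ r → ¬ g.H.Adj r b → ∃ x, g.H.Adj b x ∧ s.natArr aDist x = 1 := by
    intro b hb h1 h2
    obtain ⟨x, h3, h4⟩ := ecc b hb h1 h2
    exact ⟨x, h4, (one b x hb h4).2 h3⟩
  have get : ∀ b y, b ∈ C → b ≠ r → ¬ g.H.Adj r b →
      ((∃ u, g.H.Adj b u ∧ s.natArr aDist u = 1) → g.H.Adj b y ∧ s.natArr aDist y = 1) →
      g.H.Adj r y ∧ g.H.Adj b y := by
    intro b y hb h1 h2 h3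
    obtain ⟨h4, h5⟩ := h3 (eccn b hb h1 h2)
    exact ⟨(one b y hb h4).1 h5, h4⟩
  refine ⟨hs.closed, hrC, hnb, ecc, fun h => ?_, haC, ?_, ?_, ?_, ?_⟩
  · have h1 := (hmin h).1
    obtain ⟨h2, h3⟩ := get a y₀ haC h1.1 h1.2 f1
    exact ⟨haC, h1.1, h1.2, h2, h3, K1 h2 h3 h1.2⟩
  -- A proper inclusion would give `b` fewer common neighbours with the root than `a` has.
  · intro b hb hbr hrb' hsub x hrx hax
    by_contra hbx
    have := (hmin ⟨b, hb, hbr, hrb'⟩).2 b hb ⟨hbr, hrb'⟩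
    have := g.count_lt (y := b) (y' := a) (p := g.H.Adj r) (fun u hu hru => hsub u hru hu)
      ⟨x, hax, hrx, hbx⟩
    omega
  · rintro ⟨b, hb1, hb2⟩
    obtain ⟨h1, h2⟩ := f2 ⟨b, hb2, (two a b haC hb2).2 ⟨hrb b hb1 hb2, hb1⟩⟩
    obtain ⟨h3, h4⟩ := (two a b₀ haC h1).1 h2
    obtain ⟨h5, h6⟩ := get b₀ y₁ m2 h3 h4 f5
    exact ⟨h4, h1, h5, h6, K2 h5 h6 h4⟩
  · rintro ⟨b, hb1, hb2, hb3⟩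
    obtain ⟨h1, h2, h2'⟩ := f3 ⟨b, hb2, (two a b haC hb2).2 ⟨hrb b hb1 hb2, hb1⟩, hb3⟩
    obtain ⟨h3, h4⟩ := (two a c₀ haC h1).1 h2
    obtain ⟨h5, h6⟩ := get c₀ y₂ m3 h3 h4 f6
    exact ⟨h4, h1, h2', h5, h6⟩
  · rintro ⟨x, h1, h2⟩
    obtain ⟨h3, h4⟩ := f4 ⟨x, h2, (one y₀ x m1 h2).2 h1⟩
    exact ⟨(one y₀ p m1 h3).1 h4, h3⟩

/-! ## The best candidate in a component -/

/-- The search for the best covered set of `C` beats all covered sets in `S`, and it has not changed the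
entries of `aBest` outside `C`. -/
structure Search (g : Net) (C : Finset ℕ) (B : ℕ → ℕ) (S : Set (Set ℕ)) (s : State) : Prop where
  ok : BestOk g C s
  outside : ∀ x, x ∉ C → s.natArr aBest x = B x
  beats : ∀ M ∈ S, g.Good C M → Beats g C s M

theorem Search.frame {g : Net} {C : Finset ℕ} {B : ℕ → ℕ} {S : Set (Set ℕ)} {s s' : State}
    {p : Program} (h : Search g C B S s) (F : Frame p s s') (h1 : p.modNat vHas = false)
    (h2 : p.modNatArr aBest = false) (h3 : p.modReal rBest = false) : Search g C B S s' := by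
  have e1 := F.nat _ h1
  have e2 := F.natArr _ h2
  have e3 := F.real _ h3
  have e4 : arrSet aBest s' = arrSet aBest s := by unfold arrSet; rw [e2]
  refine ⟨?_, ?_, ?_⟩
  · unfold BestOk; rw [e1, e3, e4]; exact h.ok
  · rw [e2]; exact h.outside
  · unfold Beats; rw [e1, e3]; exact h.beats

/-- The state of the memory while the candidates are tried: the component, the distances from the root,
and the values of the variables from `vAnc1` on, as in the state `s₀`. -/
structure Ready (g : Net) (C : Finset ℕ) (r : ℕ) (s₀ s : State) : Prop where
  comp : HoldsComp g C s
  dist : HoldsDist g C r s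
  nat : ∀ y, 25 < y → s.nat y = s₀.nat y

theorem Ready.frame {g : Net} {C : Finset ℕ} {r : ℕ} {s₀ s s' : State} {p : Program}
    (h : Ready g C r s₀ s) (F : Frame p s s') (h1 : p.keepsComp = true)
    (h2 : p.modNatArr aDist = false) (h3 : ∀ y, 25 < y → p.modNat y = false) :
    Ready g C r s₀ s' :=
  ⟨h.comp.frame F h1, fun u hu => by rw [F.natArr _ h2]; exact h.dist u hu,
    fun y hy => (F.nat y (h3 y hy)).trans (h.nat y hy)⟩

/-- `S` accumulates the families treated so far, so that after the last one it can be compared with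
the list in `Anchors.isCand`. -/
theorem tryCand_step {g : Net} {C : Finset ℕ} {B : ℕ → ℕ} {S : Set (Set ℕ)} {s₀ s : State} {r : ℕ}
    {t : Test} (p : ℕ → Prop) (hs : Ready g C r s₀ s) (hS : Search g C B S s)
    (ht : ∀ s₁ : State, (∀ x ∈ C, s₁.natArr aDist x = s.natArr aDist x) →
      s₁.natArr aMark = s.natArr aMark → (∀ y, 25 < y → s₁.nat y = s₀.nat y) →
      s₁.nat vX ∈ C → (t.eval s₁ ↔ p (s₁.nat vX))) :
    Tri (tryCand t) s (g.size C) fun s' => Ready g C r s₀ s' ∧ Search g C B (S ∪ {M | IsCand C p M}) s' ∧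
      s'.natArr aMark = s.natArr aMark := by
  have hmod : ∀ y, 25 < y → (tryCand t).modNat y = false := by
    intro y hy
    simp [tryCand, evalBase, evalAdd, scan, forComp, forNbr, Program.modNat]
    omega
  refine (tryCand_spec p hs.comp hS.ok fun s₁ F h => ht s₁ (fun x _ => by rw [F.natArr aDist rfl])
    (F.natArr _ rfl) (fun y hy => (F.nat y (hmod y hy)).trans (hs.nat y hy)) h).wk le_rfl
    fun s' F ⟨h1, h2, h3, h4⟩ => ⟨hs.frame F rfl rfl hmod, ⟨h1, fun x hx => (h2 x hx).trans
      (hS.outside x hx), ?_⟩, F.natArr _ rfl⟩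
  rintro M (hM | ⟨m, hm, hM⟩) hg
  · exact h3 M (hS.beats M hM hg)
  · exact h4 m hm M hM hg

theorem mark_step {g : Net} {C : Finset ℕ} {B : ℕ → ℕ} {S : Set (Set ℕ)} {s₀ s : State} {r x : ℕ}
    (hs : Ready g C r s₀ s) (hS : Search g C B S s) (hx : 25 < x) (hxC : s₀.nat x ∈ C) :
    Tri (mark x) s (g.size C) fun s' => Ready g C r s₀ s' ∧ Search g C B S s' ∧
      ∀ u ∈ C, s'.natArr aMark u = if g.H.Adj (s₀.nat x) u then 1 else 0 := by
  have hmod : ∀ y, 25 < y → (mark x).modNat y = false := by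
    intro y hy
    simp [mark, fill, setNbrs, forComp, forNbr, Program.modNat]
    omega
  exact (mark_spec hs.comp (hs.nat x hx) hxC (hmod x hx)).wk le_rfl fun s' F h =>
    ⟨hs.frame F rfl rfl hmod, hS.frame F rfl rfl rfl, h⟩

/-- Tries the candidates with the root and the vertex held by `u` as the ends of an edge. -/
def tryMate (u : ℕ) : Program :=
  mark u ;;
  tryCand (.or (.eq (.get aDist (.var vX)) (.lit 0)) (.or (.eq (.var vX) (.var u))
    (.and (.eq (.get aDist (.var vX)) (.lit 2)) (.eq (.get aMark (.var vX)) (.lit 0)))))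

theorem HoldsDist.eq_zero {g : Net} {C : Finset ℕ} {r : ℕ} {s : State} (h : HoldsDist g C r s)
    {u : ℕ} (hu : u ∈ C) : s.natArr aDist u = 0 ↔ u = r := by
  rw [h u hu]; split_ifs <;> simp_all

theorem tryMate_step {g : Net} {C : Finset ℕ} {B : ℕ → ℕ} {S : Set (Set ℕ)} {s₀ s : State} {r u : ℕ}
    (hs : Ready g C r s₀ s) (hS : Search g C B S s) (hu : 25 < u) (huC : s₀.nat u ∈ C) :
    Tri (tryMate u) s (g.size C) fun s' => Ready g C r s₀ s' ∧ Search g C B (S ∪ {M | IsCand C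
      (fun x => x = r ∨ x = s₀.nat u ∨ (x ≠ r ∧ ¬ g.H.Adj r x ∧ ¬ g.H.Adj (s₀.nat u) x)) M}) s' := by
  refine (mark_step hs hS hu huC).bind fun s₁ _ ⟨h1, h2, h3⟩ => ?_
  refine (tryCand_step (fun x => x = r ∨ x = s₀.nat u ∨
    (x ≠ r ∧ ¬ g.H.Adj r x ∧ ¬ g.H.Adj (s₀.nat u) x)) h1 h2 (fun s₂ e1 e2 e3 hX => ?_)).wk le_rfl
    fun s' _ ⟨h4, h5, _⟩ => ⟨h4, h5⟩
  have hm : s₂.natArr aMark (s₂.nat vX) = 0 ↔ ¬ g.H.Adj (s₀.nat u) (s₂.nat vX) := by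
    rw [e2, h3 _ hX]; split_ifs with h <;> simp [h]
  simp only [Test.eval, NatExp.eval, e1 _ hX, h1.dist.eq_zero hX, h1.dist.eq_two hX, hm, e3 u hu,
    and_assoc]

/-- Tries all candidates. -/
def tryAll : Program :=
  .setNat vHas (.lit 0) ;;
  tryCand (.eq (.lit 0) (.lit 0)) ;;
  tryCand (.eq (.get aDist (.var vX)) (.lit 1)) ;;
  tryCand (.not (.eq (.get aDist (.var vX)) (.lit 1))) ;;
  mark vA₀ ;;
  tryCand (.not (.and (.eq (.get aDist (.var vX)) (.lit 2)) (.eq (.get aMark (.var vX)) (.lit 1)))) ;;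
  tryCand (.or (.eq (.get aDist (.var vX)) (.lit 0)) (.or (.eq (.get aDist (.var vX)) (.lit 1))
    (.eq (.get aMark (.var vX)) (.lit 1)))) ;;
  tryCand (.or (.eq (.get aDist (.var vX)) (.lit 1)) (.or (.eq (.var vX) (.var vA₀))
    (.and (.eq (.get aDist (.var vX)) (.lit 2)) (.eq (.get aMark (.var vX)) (.lit 1))))) ;;
  tryMate vY₀ ;; tryMate vP ;; tryMate vY₁ ;; tryMate vY₂

/-- The anchors `b` and `c` influence the candidates only through the vertices held by `vY₁` and
`vY₂`, hence they may be arbitrary in the conclusion. -/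
theorem tryAll_spec {g : Net} {C : Finset ℕ} {s : State} {r a : ℕ} (hs : HoldsComp g C s)
    (hd : HoldsDist g C r s) (ha : s.nat vA₀ = a) (haC : a ∈ C)
    (hm : s.nat vY₀ ∈ C ∧ s.nat vP ∈ C ∧ s.nat vY₁ ∈ C ∧ s.nat vY₂ ∈ C)
    (hnb : ∀ x ∈ C, ∃ u, g.H.Adj x u) :
    Tri tryAll s (g.size C) fun s' => HoldsComp g C s' ∧
      (∀ x, x ∉ C → s'.natArr aBest x = s.natArr aBest x) ∧
      ∀ b c, Anchors g C r a (s.nat vY₀) b c (s.nat vP) (s.nat vY₁) (s.nat vY₂) →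
        g.Good C (arrSet aBest s') ∧
          ∀ M, g.Good C M → g.cost C (arrSet aBest s') ≤ g.cost C M := by
  refine Tri.setNat_seq ?_
  have R0 : Ready g C r s (s.setNat vHas (NatExp.eval s (.lit 0))) := by
    refine ⟨⟨⟨hs.size, hs.off, hs.nbr, hs.wt⟩, hs.closed, hs.queue⟩, hd, fun y hy => ?_⟩
    rw [setNat_nat, if_neg (by omega)]
  have S0 : Search g C (s.natArr aBest) ∅ (s.setNat vHas (NatExp.eval s (.lit 0))) :=
    ⟨fun h => absurd rfl h, fun _ _ => rfl, fun _ h => h.elim⟩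
  refine (tryCand_step (fun _ => True) R0 S0 fun s₁ _ _ _ _ => by simp).bind
    fun s₁ _ ⟨R1, S1, _⟩ => ?_
  refine (tryCand_step (g.H.Adj r) R1 S1 fun s₂ e1 _ _ hX => by
    simp [e1 _ hX, R1.dist.eq_one hX]).bind fun s₂ _ ⟨R2, S2, _⟩ => ?_
  refine (tryCand_step (fun x => ¬ g.H.Adj r x) R2 S2 fun s₃ e1 _ _ hX => by
    simp [e1 _ hX, R2.dist.eq_one hX]).bind fun s₃ _ ⟨R3, S3, _⟩ => ?_
  refine (mark_step R3 S3 (x := vA₀) (by omega) (ha ▸ haC)).bind fun s₄ _ ⟨R4, S4, m4⟩ => ?_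
  rw [ha] at m4
  have m4 : ∀ x ∈ C, s₄.natArr aMark x = 1 ↔ g.H.Adj a x := fun x hx => by
    rw [m4 x hx]; split_ifs with h <;> simp [h]
  refine (tryCand_step (fun x => ¬ (x ≠ r ∧ ¬ g.H.Adj r x ∧ g.H.Adj a x)) R4 S4
    fun s₅ e1 e2 _ hX => by
      simp only [Test.eval, NatExp.eval, e1 _ hX, R4.dist.eq_two hX, e2, m4 _ hX, and_assoc]).bind
    fun s₅ _ ⟨R5, S5, m5⟩ => ?_
  refine (tryCand_step (fun x => x = r ∨ g.H.Adj r x ∨ g.H.Adj a x) R5 S5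
    fun s₆ e1 e2 _ hX => by
      simp only [Test.eval, NatExp.eval, e1 _ hX, R5.dist.eq_zero hX, R5.dist.eq_one hX, e2, m5,
        m4 _ hX]).bind
    fun s₆ _ ⟨R6, S6, m6⟩ => ?_
  refine (tryCand_step (fun x => g.H.Adj r x ∨ x = a ∨ (x ≠ r ∧ ¬ g.H.Adj r x ∧ g.H.Adj a x)) R6 S6
    fun s₇ e1 e2 e3 hX => by
      simp only [Test.eval, NatExp.eval, e1 _ hX, R6.dist.eq_one hX, R6.dist.eq_two hX, e2, m6, m5,
        m4 _ hX, e3 vA₀ (by omega), ha, and_assoc]).bind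
    fun s₇ _ ⟨R7, S7, _⟩ => ?_
  refine (tryMate_step R7 S7 (by omega) hm.1).bind fun s₈ _ ⟨R8, S8⟩ => ?_
  refine (tryMate_step R8 S8 (by omega) hm.2.1).bind fun s₉ _ ⟨R9, S9⟩ => ?_
  refine (tryMate_step R9 S9 (by omega) hm.2.2.1).bind fun s₁₀ _ ⟨R10, S10⟩ => ?_
  refine (tryMate_step R10 S10 (by omega) hm.2.2.2).wk le_rfl fun s' _ ⟨R, S⟩ =>
    ⟨R.comp, S.outside, fun b c hA => ?_⟩
  have key : ∀ M, g.Good C M → Beats g C s' M := by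
    intro M hM
    refine S.beats M ?_ hM
    simp only [Set.mem_union, Set.mem_ofPred_eq, Set.mem_empty_iff_false, false_or]
    rcases hA.isCand hM with h | h | h | h | h | h | ⟨u, rfl | rfl | rfl | rfl, h⟩ <;>
      simp only [h, true_or, or_true]
  -- Covering everything is admissible as no vertex of `C` is isolated, so at least one candidate
  -- has succeeded and the record is meaningful.
  have hall : g.Good C Set.univ := fun x hx => by
    obtain ⟨u, hu⟩ := hnb x hx
    exact ⟨fun h => absurd trivial h, fun _ => ⟨⟨u, hu, trivial⟩, Or.inl fun _ _ => trivial⟩⟩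
  obtain ⟨h1, h2⟩ := S.ok (key _ hall).1
  exact ⟨h1, fun M hM => h2 ▸ (key M hM).2⟩

/-! ## One component -/

/-- Finds an optimal covered set of the component of `vStart`, or an induced path. -/
def component : Program :=
  bfs ;; testLevels ;; chooseRoot ;; setDist ;; testRoot ;; helpers ;; tryAll

theorem component_spec {g : Net} {s : State} {C D : Finset ℕ} {v : ℕ} (hs : Holds g s)
    (hP : StoresP5 g s) (hv : s.nat vStart = v) (hvC : v ∈ C) (hC : g.Closed C) (hD : g.Closed D)
    (hvD : v ∉ D) (hnb : ∃ u, g.H.Adj v u)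
    (hCmin : ∀ S : Set ℕ, v ∈ S → (∀ x ∈ S, ∀ u, g.H.Adj x u → u ∈ S) → ∀ x ∈ C, x ∈ S)
    (hseen : ∀ x, s.natArr aLev x ≠ 0 ↔ x ∈ D) :
    Tri component s (g.size C) fun s' => Holds g s' ∧ StoresP5 g s' ∧ Disjoint D C ∧
      (∀ x, s'.natArr aLev x ≠ 0 ↔ x ∈ D ∪ C) ∧
      (∀ x, x ∉ C → s'.natArr aBest x = s.natArr aBest x) ∧
      (s'.nat vFlag = 0 → s.nat vFlag = 0 ∧ g.Good C (arrSet aBest s') ∧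
        ∀ M, g.Good C M → g.cost C (arrSet aBest s') ≤ g.cost C M) := by
  refine (bfs_spec hs hv hvC hC hD hvD hCmin hseen).bind fun s₁ F1 ⟨c1, hdisj, hlev, hB⟩ => ?_
  obtain ⟨L, hL⟩ : ∃ L, s₁.natArr aLev = L := ⟨_, rfl⟩
  obtain ⟨P, hPar⟩ : ∃ P, s₁.natArr aPar = P := ⟨_, rfl⟩
  have hP1 : StoresP5 g s₁ := hP.frame F1 rfl
  have hv1 : s₁.nat vStart = v := (F1.nat _ rfl).trans hv
  refine (testLevels_spec c1 hP1 hv1 hB).bind fun s₂ F2 ⟨hP2, K2⟩ => ?_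
  rw [hL, hPar] at hB
  rw [hL] at K2 hlev
  have c2 := c1.frame F2 rfl
  have hv2 : s₂.nat vStart = v := (F2.nat _ rfl).trans hv1
  have L2 : s₂.natArr aLev = L := (F2.natArr _ rfl).trans hL
  have P2 : s₂.natArr aPar = P := (F2.natArr _ rfl).trans hPar
  refine (chooseRoot_spec c2 hv2 hnb L2 (P2.symm ▸ hB)).bind
    fun s₃ F3 ⟨haC, hrC, hamax, hLr, har, hrmax⟩ => ?_
  have c3 := c2.frame F3 rfl
  have hP3 : StoresP5 g s₃ := hP2.frame F3 rfl
  have hv3 : s₃.nat vStart = v := (F3.nat _ rfl).trans hv2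
  have L3 : s₃.natArr aLev = L := (F3.natArr _ rfl).trans L2
  have P3 : s₃.natArr aPar = P := (F3.natArr _ rfl).trans P2
  obtain ⟨r, hr3⟩ : ∃ r, s₃.nat vRoot = r := ⟨_, rfl⟩
  obtain ⟨a, ha3⟩ : ∃ a, s₃.nat vA = a := ⟨_, rfl⟩
  rw [hr3] at hrC hLr har hrmax
  rw [ha3] at haC hamax har hrmax
  refine (setDist_spec c3 (hv3 ▸ hvC) hr3 hrC).bind fun s₄ F4 ⟨hd4, hzC, hz0, hzmin⟩ => ?_
  have c4 := c3.frame F4 rfl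
  have hP4 : StoresP5 g s₄ := hP3.frame F4 rfl
  have hv4 : s₄.nat vStart = v := (F4.nat _ rfl).trans hv3
  have hr4 : s₄.nat vRoot = r := (F4.nat _ rfl).trans hr3
  obtain ⟨z, hz4⟩ : ∃ z, s₄.nat vA₀ = z := ⟨_, rfl⟩
  rw [hz4] at hzC hz0 hzmin
  refine (testRoot_spec c4 hP4 hv4 ((F4.nat vA rfl).trans ha3) haC hr4 hrC hz4 hzC
    ((F4.natArr _ rfl).trans L3) ((F4.natArr _ rfl).trans P3) hB hamax hLr har hrmax).bind
    fun s₅ F5 ⟨hP5, K5⟩ => ?_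
  have c5 := c4.frame F5 rfl
  have hd5 : HoldsDist g C r s₅ := fun u hu => by rw [F5.natArr aDist rfl]; exact hd4 u hu
  refine (helpers_spec c5 hP5 (by rw [F5.nat vStart rfl, hv4]; exact hvC)
    ((F5.nat _ rfl).trans hr4) hrC hd5 ((F5.nat _ rfl).trans hz4) hzC ⟨_, har.symm⟩ hz0 hzmin).bind
    fun s₆ F6 ⟨c6, hP6, hd6, hz6, hm6, K6⟩ => ?_
  refine (tryAll_spec c6 (r := r) (fun u hu => by rw [hd6]; exact hd5 u hu) hz6 hzC hm6
    fun x hx => ?_).wk le_rfl fun s' F7 ⟨c7, hout, K7⟩ => ?_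
  · by_cases hxv : x = v
    · exact hxv ▸ hnb
    · exact ⟨_, (hB.par x hx hxv).1⟩
  refine ⟨c7.toHolds, hP6.frame F7 rfl, hdisj, fun x => ?_, fun x hx => ?_, fun h0 => ?_⟩
  · rw [F7.natArr aLev rfl, F6.natArr aLev rfl, F5.natArr aLev rfl, F4.natArr aLev rfl, L3]
    exact hlev x
  · rw [hout x hx, F6.natArr aBest rfl, F5.natArr aBest rfl, F4.natArr aBest rfl,
      F3.natArr aBest rfl, F2.natArr aBest rfl, F1.natArr aBest rfl]
  -- A flag that is zero at the end was zero throughout, so all tests failed: this bounds the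
  -- levels, then the eccentricity of the root, and then validates the anchors.
  · rw [F7.nat vFlag rfl] at h0
    obtain ⟨h5, hA⟩ := K6 h0
    obtain ⟨h4, hE⟩ := K5 h5
    rw [F4.nat vFlag rfl, F3.nat vFlag rfl] at h4
    obtain ⟨h1, hle⟩ := K2 h4
    rw [F1.nat vFlag rfl] at h1
    exact ⟨h1, K7 _ _ (hA (hE hle))⟩

/-! ## All components -/

theorem Net.cost_union (g : Net) {D C : Finset ℕ} (h : Disjoint D C) (N : Set ℕ) :
    g.cost (D ∪ C) N = g.cost D N + g.cost C N := by
  unfold Net.cost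
  rw [Finset.filter_union, Finset.sum_union (Finset.disjoint_filter_filter h)]

theorem Net.Good.union {g : Net} {D C : Finset ℕ} {N : Set ℕ} (h : g.Good D N) (h' : g.Good C N) :
    g.Good (D ∪ C) N := fun x hx => (Finset.mem_union.1 hx).elim (h x) (h' x)

/-- The set `N` is a covered set of `D` of the least possible cost. -/
def Net.Optimal (g : Net) (D : Finset ℕ) (N : Set ℕ) : Prop :=
  g.Good D N ∧ ∀ M, g.Good D M → g.cost D N ≤ g.cost D M

/-- Validity and cost on `D` depend only on the part of the set inside `D`, so optimal choices on
disjoint closed parts combine. -/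
theorem Net.Optimal.union {g : Net} {D C : Finset ℕ} {N N' : Set ℕ} (hD : g.Closed D)
    (hdisj : Disjoint D C) (h : g.Optimal D N) (hN : ∀ x ∈ D, x ∈ N ↔ x ∈ N')
    (h' : g.Optimal C N') : g.Optimal (D ∪ C) N' := by
  refine ⟨(h.1.congr hD hN).union h'.1, fun M hM => ?_⟩
  rw [g.cost_union hdisj, g.cost_union hdisj, ← Net.cost_congr hD hN]
  exact add_le_add (h.2 M fun x hx => hM x (Finset.mem_union_left _ hx))
    (h'.2 M fun x hx => hM x (Finset.mem_union_right _ hx))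

/-- An isolated vertex satisfies the condition vacuously when it is uncovered, and it adds nothing
to any cost. Such vertices are skipped, as they offer no root with a neighbour. -/
theorem Net.Optimal.of_isolated {g : Net} {D U : Finset ℕ} {N : Set ℕ} (hDU : D ⊆ U)
    (h : g.Optimal D N) (hiso : ∀ x ∈ U, (∃ u, g.H.Adj x u) → x ∈ D) (hN : ∀ x, x ∉ D → x ∉ N) :
    g.Optimal U N := by
  have hcost : ∀ M, g.cost U M = g.cost D M := by
    intro M
    unfold Net.cost
    symm
    refine Finset.sum_subset (Finset.filter_subset_filter _ hDU) fun x hx hxD => ?_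
    rw [Finset.mem_filter] at hx
    have : ∀ u, ¬ g.H.Adj x u := fun u hu =>
      hxD (Finset.mem_filter.2 ⟨hiso x hx.1 ⟨u, hu⟩, hx.2⟩)
    unfold Net.sum
    refine Finset.sum_eq_zero fun u hu => ?_
    exact absurd (g.mem_nb.1 (Finset.mem_filter.1 hu).1) (this u)
  refine ⟨fun x hx => ?_, fun M hM => ?_⟩
  · by_cases hxD : x ∈ D
    · exact h.1 x hxD
    · exact ⟨fun _ u hu => absurd (hiso x hx ⟨u, hu⟩) hxD, fun h => absurd h (hN x hxD)⟩
  · rw [hcost, hcost]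
    exact h.2 M fun x hx => hM x (hDU hx)

/-- Finds an optimal covered set, or an induced path. -/
def allComponents : Program :=
  .setNat vStart (.lit 0) ;;
  .while (.lt (.var vStart) (.var 0))
    (.ite (.and (.eq (.get aLev (.var vStart)) (.lit 0))
        (.lt (.get 0 (.var vStart)) (.get 0 (.succ (.var vStart)))))
      component .skip ;;
    .setNat vStart (.succ (.var vStart)))

/-- The loop does not stop when a path is found. The remaining components are still treated within
the same budget, and only the claim of optimality depends on the flag. -/
theorem allComponents_spec {g : Net} {s : State} (hs : Holds g s) (hflag : s.nat vFlag = 0)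
    (hlev : ∀ x, s.natArr aLev x = 0) (hbest : ∀ x, s.natArr aBest x = 0) :
    Tri allComponents s (g.size (range g.n) + g.n) fun s' => Holds g s' ∧ StoresP5 g s' ∧
      (s'.nat vFlag = 0 → g.Optimal (range g.n) (arrSet aBest s')) := by
  refine Tri.setNat_seq ?_
  simp only [NatExp.eval]
  generalize hs0 : s.setNat vStart 0 = s₀
  have h0 : Holds g s₀ := by subst hs0; exact ⟨hs.size, hs.off, hs.nbr, hs.wt⟩
  have n0 : s₀.nat vStart = 0 ∧ s₀.nat vFlag = 0 ∧ s₀.natArr aLev = s.natArr aLev ∧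
      s₀.natArr aBest = s.natArr aBest := by subst hs0; simp [hflag]
  clear hs0
  obtain ⟨e1, e2, e3, e4⟩ := n0
  -- `D` is the union of the components treated so far. The budget holds the size of the rest, and
  -- one unit for each start vertex still to be tried.
  refine Tri.while (I := fun s' φ => ∃ D : Finset ℕ, g.Closed D ∧ Holds g s' ∧ StoresP5 g s' ∧
    (∀ x, s'.natArr aLev x ≠ 0 ↔ x ∈ D) ∧ (∀ x, x ∉ D → s'.natArr aBest x = 0) ∧
    (∀ x < s'.nat vStart, (∃ u, g.H.Adj x u) → x ∈ D) ∧
    φ = g.size (range g.n \ D) + (g.n - s'.nat vStart) ∧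
    (s'.nat vFlag = 0 → g.Optimal D (arrSet aBest s'))) s₀ ?_ ?_ _ ?_
  · rintro s₁ φ - ⟨D, hD, hs₁, hP, hL, hB, hiso, rfl, hopt⟩ hlt
    obtain ⟨v, hv⟩ : ∃ v, s₁.nat vStart = v := ⟨_, rfl⟩
    simp only [Test.eval, NatExp.eval, hv, hs₁.size] at hlt
    rw [hv] at hiso ⊢
    have hbij := g.bij v hlt
    have hdeg : g.off v < g.off (v + 1) ↔ ∃ u, g.H.Adj v u := by
      constructor
      · intro h
        exact ⟨_, g.mem_nb.1 (by exact_mod_cast hbij.mapsTo ⟨le_rfl, h⟩)⟩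
      · rintro ⟨u, hu⟩
        obtain ⟨j, hj, -⟩ := hbij.surjOn (show u ∈ (g.nb v : Set ℕ) from g.mem_nb.2 hu)
        exact lt_of_le_of_lt hj.1 hj.2
    have hev : (Test.and (.eq (.get aLev (.var vStart)) (.lit 0))
        (.lt (.get 0 (.var vStart)) (.get 0 (.succ (.var vStart))))).eval s₁ ↔
        v ∉ D ∧ ∃ u, g.H.Adj v u := by
      simp only [Test.eval, NatExp.eval, hv, hs₁.off, hdeg, ← hL, not_not]
    by_cases hcase : v ∉ D ∧ ∃ u, g.H.Adj v u
    · obtain ⟨hvD, hnb⟩ := hcase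
      obtain ⟨C, hC, hvC, hCmin⟩ := g.exists_component hlt
      have hdisj : Disjoint D C := by
        rw [Finset.disjoint_right]
        exact hCmin {x | x ∉ D} hvD fun x hx u hu huD => hx (hD.adj u huD x hu.symm)
      refine ⟨g.size C, g.size (range g.n \ (D ∪ C)) + (g.n - (v + 1)), ?_, ?_⟩
      · have h1 : g.size (range g.n \ D) = g.size (range g.n \ (D ∪ C)) + g.size C := by
          unfold Net.size
          rw [← Finset.sum_union]
          · congr 1
            ext x
            have h1 := hC.lt x
            have h2 : x ∈ C → x ∉ D := fun hx => Finset.disjoint_right.1 hdisj hx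
            simp only [Finset.mem_sdiff, Finset.mem_union, Finset.mem_range]
            tauto
          · rw [Finset.disjoint_left]
            intro x hx hx'
            simp [hx'] at hx
        omega
      · refine Tri.bind (Q := fun s' => (Holds g s' ∧ StoresP5 g s' ∧ Disjoint D C ∧
          (∀ x, s'.natArr aLev x ≠ 0 ↔ x ∈ D ∪ C) ∧
          (∀ x, x ∉ C → s'.natArr aBest x = s₁.natArr aBest x) ∧
          (s'.nat vFlag = 0 → s₁.nat vFlag = 0 ∧ g.Good C (arrSet aBest s') ∧
            ∀ M, g.Good C M → g.cost C (arrSet aBest s') ≤ g.cost C M)))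
          (Tri.ite (fun _ => component_spec hs₁ hP hv hvC hC hD hvD hnb hCmin hL)
            (fun h => absurd (hev.2 ⟨hvD, hnb⟩) h)) ?_
        rintro s₂ F ⟨h1, h2, -, h4, h5, h6⟩
        have hv2 : s₂.nat vStart = v := (F.nat _ rfl).trans hv
        refine Tri.setNat ?_
        simp only [NatExp.eval, hv2, setNat_nat, if_true, if_false, Nat.reduceEqDiff, setNat_natArr]
        refine ⟨D ∪ C, ⟨fun x hx => (Finset.mem_union.1 hx).elim (hD.lt x) (hC.lt x),
          fun x hx u hu => Finset.mem_union.2 ((Finset.mem_union.1 hx).imp (hD.adj x · u hu)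
          (hC.adj x · u hu))⟩, ⟨h1.size, h1.off, h1.nbr, h1.wt⟩, h2, h4, fun x hx => ?_,
          fun x hx hx' => ?_, rfl, fun h0 => ?_⟩
        · rw [Finset.mem_union, not_or] at hx
          rw [h5 x hx.2, hB x hx.1]
        · rcases Nat.lt_succ_iff_lt_or_eq.1 hx with hx | rfl
          · exact Finset.mem_union_left _ (hiso x hx hx')
          · exact Finset.mem_union_right _ hvC
        · obtain ⟨h7, h8⟩ := h6 h0
          refine (hopt h7).union hD hdisj (fun x hx => ?_) h8
          show s₁.natArr aBest x = 1 ↔ s₂.natArr aBest x = 1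
          rw [h5 x (Finset.disjoint_left.1 hdisj hx)]
    · refine ⟨0, g.size (range g.n \ D) + (g.n - (v + 1)), by omega, ?_⟩
      refine Tri.bind (Q := fun s' => s' = s₁) (Tri.ite (fun h => absurd (hev.1 h) hcase)
        (fun _ => Tri.skip rfl)) ?_
      rintro _ - rfl
      refine Tri.setNat ?_
      simp only [NatExp.eval, hv, setNat_nat, if_true, if_false, Nat.reduceEqDiff, setNat_natArr]
      refine ⟨D, hD, ⟨hs₁.size, hs₁.off, hs₁.nbr, hs₁.wt⟩, hP, hL, hB, fun x hx hx' => ?_, rfl, hopt⟩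
      rcases Nat.lt_succ_iff_lt_or_eq.1 hx with hx | rfl
      · exact hiso x hx hx'
      · by_contra h
        exact hcase ⟨h, hx'⟩
  · rintro s₁ φ - ⟨D, hD, hs₁, hP, hL, hB, hiso, -, hopt⟩ hlt
    simp only [Test.eval, NatExp.eval, hs₁.size] at hlt
    refine ⟨hs₁, hP, fun h => (hopt h).of_isolated (fun x hx => Finset.mem_range.2 (hD.lt x hx))
      (fun x hx => hiso x (by rw [Finset.mem_range] at hx; omega)) fun x hx h => ?_⟩
    have h : s₁.natArr aBest x = 1 := h
    rw [hB x hx] at h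
    omega
  · refine ⟨∅, ⟨by simp, by simp⟩, h0, Or.inl e2, ?_, ?_, ?_, ?_, fun _ => ⟨by simp [Net.Good], ?_⟩⟩
    · simp [e3, hlev]
    · simp [e4, hbest]
    · simp [e1]
    · simp [e1]
    · intro M _
      simp [Net.cost]

/-! ## The output -/

/-- The edges between the vertices in `N`, as far as they have been listed when the neighbours in `D` of
`x` have been treated. -/
def Net.listed (g : Net) (N : Set ℕ) (x : ℕ) (D : Finset ℕ) : Set (Sym2 ℕ) :=
  {e | ∃ y u, e = s(y, u) ∧ y < u ∧ g.H.Adj y u ∧ y ∈ N ∧ u ∈ N ∧ (y < x ∨ y = x ∧ u ∈ D)}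

theorem Net.listed_insert {g : Net} {N : Set ℕ} {x u : ℕ} {D : Finset ℕ}
    (h : x < u ∧ x ∈ N ∧ u ∈ N) (hu : g.H.Adj x u) :
    g.listed N x (insert u D) = insert s(x, u) (g.listed N x D) := by
  ext e
  simp only [Net.listed, Set.mem_ofPred_eq, Set.mem_insert_iff, Finset.mem_insert]
  constructor
  · rintro ⟨y, z, rfl, h1, h2, h3, h4, h5 | ⟨rfl, rfl | h5⟩⟩
    · exact Or.inr ⟨y, z, rfl, h1, h2, h3, h4, Or.inl h5⟩
    · exact Or.inl rfl
    · exact Or.inr ⟨y, z, rfl, h1, h2, h3, h4, Or.inr ⟨rfl, h5⟩⟩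
  · rintro (rfl | ⟨y, z, rfl, h1, h2, h3, h4, h5⟩)
    · exact ⟨x, u, rfl, h.1, hu, h.2.1, h.2.2, Or.inr ⟨rfl, Or.inl rfl⟩⟩
    · exact ⟨y, z, rfl, h1, h2, h3, h4, h5.imp_right fun h => ⟨h.1, Or.inr h.2⟩⟩

theorem Net.listed_insert_of_not {g : Net} {N : Set ℕ} {x u : ℕ} {D : Finset ℕ}
    (h : ¬ (x < u ∧ x ∈ N ∧ u ∈ N)) : g.listed N x (insert u D) = g.listed N x D := by
  ext e
  simp only [Net.listed, Set.mem_ofPred_eq, Finset.mem_insert]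
  constructor
  · rintro ⟨y, z, rfl, h1, h2, h3, h4, h5 | ⟨rfl, rfl | h5⟩⟩
    · exact ⟨y, z, rfl, h1, h2, h3, h4, Or.inl h5⟩
    · exact absurd ⟨h1, h3, h4⟩ h
    · exact ⟨y, z, rfl, h1, h2, h3, h4, Or.inr ⟨rfl, h5⟩⟩
  · rintro ⟨y, z, rfl, h1, h2, h3, h4, h5⟩
    exact ⟨y, z, rfl, h1, h2, h3, h4, h5.imp_right fun h => ⟨h.1, Or.inr h.2⟩⟩

/-- An edge is listed only from its smaller endpoint, so visiting it from the other side cannot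
produce a repetition. -/
theorem Net.listed_not_mem {g : Net} {N : Set ℕ} {x u : ℕ} {D : Finset ℕ} (hxu : x < u)
    (hu : u ∉ D) : s(x, u) ∉ g.listed N x D := by
  rintro ⟨y, z, h, h1, -, -, -, h5⟩
  rw [Sym2.eq_iff] at h
  rcases h with ⟨rfl, rfl⟩ | ⟨rfl, rfl⟩
  · rcases h5 with h5 | h5
    · omega
    · exact hu h5.2
  · omega

theorem Net.listed_succ {g : Net} {N : Set ℕ} {x : ℕ} :
    g.listed N x (g.nb x) = g.listed N (x + 1) ∅ := by
  ext e
  simp only [Net.listed, Set.mem_ofPred_eq, g.mem_nb]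
  constructor
  · rintro ⟨y, z, rfl, h1, h2, h3, h4, h5⟩
    exact ⟨y, z, rfl, h1, h2, h3, h4, Or.inl (by omega)⟩
  · rintro ⟨y, z, rfl, h1, h2, h3, h4, h5 | h5⟩
    · refine ⟨y, z, rfl, h1, h2, h3, h4, ?_⟩
      rcases Nat.lt_succ_iff_lt_or_eq.1 h5 with h5 | rfl
      · exact Or.inl h5
      · exact Or.inr ⟨rfl, h2⟩
    · simp at h5

/-- The edges listed in the state `s` are those in `S`. -/
def Lists (s : State) (S : Set (Sym2 ℕ)) : Prop :=
  Set.BijOn (fun i => s(s.natArr 2 i, s.natArr 3 i)) (Set.Iio (s.nat vOut)) S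

/-- Lists the edges between the vertices held by `aBest`. -/
def output : Program :=
  .setNat vOut (.lit 0) ;; .setNat vX (.lit 0) ;;
  .while (.lt (.var vX) (.var 0))
    (forNbr vX (.ite (.and (.lt (.var vX) (.var vU))
        (.and (.eq (.get aBest (.var vX)) (.lit 1)) (.eq (.get aBest (.var vU)) (.lit 1))))
      (.storeNat 2 (.var vOut) (.var vX) ;; .storeNat 3 (.var vOut) (.var vU) ;;
        .setNat vOut (.succ (.var vOut)))
      .skip) ;;
    .setNat vX (.succ (.var vX)))

theorem output_spec {g : Net} {s : State} (hs : Holds g s) :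
    Tri output s (g.size (range g.n)) fun s' =>
      Lists s' {e | ∃ y u, e = s(y, u) ∧ g.H.Adj y u ∧ y ∈ arrSet aBest s ∧ u ∈ arrSet aBest s} := by
  obtain ⟨N, hN⟩ : ∃ N, arrSet aBest s = N := ⟨_, rfl⟩
  rw [hN]
  refine Tri.setNat_seq (Tri.setNat_seq ?_)
  simp only [NatExp.eval]
  generalize hs0 : (s.setNat vOut 0).setNat vX 0 = s₀
  have h0 : Holds g s₀ := by subst hs0; exact ⟨hs.size, hs.off, hs.nbr, hs.wt⟩
  have n0 : s₀.nat vX = 0 ∧ s₀.nat vOut = 0 ∧ s₀.natArr aBest = s.natArr aBest := by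
    subst hs0; simp
  clear hs0
  obtain ⟨e1, e2, e3⟩ := n0
  have hmem : ∀ u, s₀.natArr aBest u = 1 ↔ u ∈ N := fun u => by rw [← hN, e3]; rfl
  refine Tri.while (I := fun s' φ => Lists s' (g.listed N (s'.nat vX) ∅) ∧
    φ = g.size (Finset.Ico (s'.nat vX) g.n)) s₀ ?_ ?_ _ ?_
  · rintro s₁ φ hF ⟨hI, rfl⟩ hlt
    have hs₁ := h0.frame hF rfl
    obtain ⟨x, hx⟩ : ∃ x, s₁.nat vX = x := ⟨_, rfl⟩
    simp only [Test.eval, NatExp.eval, hx, hs₁.size] at hlt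
    rw [hx] at hI ⊢
    refine ⟨(g.nb x).card, g.size (Finset.Ico (x + 1) g.n), ?_, ?_⟩
    · have : Finset.Ico x g.n = insert x (Finset.Ico (x + 1) g.n) := by
        ext y; simp only [Finset.mem_insert, Finset.mem_Ico]; omega
      rw [this]
      unfold Net.size
      rw [Finset.sum_insert (by simp)]
      omega
    refine Tri.bind (Q := fun s' => Lists s' (g.listed N (x + 1) ∅)) ?_ ?_
    · refine Tri.forNbr (fun D s' => Lists s' (g.listed N x D)) hs₁ hx hlt rfl rfl rfl
        (fun _ _ _ h => h) (fun _ _ _ h => h) hI ?_ (fun s' h => g.listed_succ ▸ h)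
      rintro D u s₂ hF2 - hu huD hU - hI2
      have hX2 : s₂.nat vX = x := (hF2.nat _ rfl).trans hx
      have hev : (Test.and (.lt (.var vX) (.var vU))
          (.and (.eq (.get aBest (.var vX)) (.lit 1))
            (.eq (.get aBest (.var vU)) (.lit 1)))).eval s₂ ↔ x < u ∧ x ∈ N ∧ u ∈ N := by
        simp only [Test.eval, NatExp.eval, hX2, hU, hF2.natArr aBest rfl, hF.natArr aBest rfl, hmem]
      refine Tri.ite (fun h => ?_) (fun h => ?_)
      · rw [hev] at h
        rw [g.listed_insert h (g.mem_nb.1 hu)]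
        refine Tri.storeNat_seq (Tri.storeNat_seq (Tri.setNat ?_))
        simp only [NatExp.eval, storeNat_nat, hX2, hU]
        obtain ⟨k, hk⟩ : ∃ k, s₂.nat vOut = k := ⟨_, rfl⟩
        unfold Lists at hI2 ⊢
        simp only [hk, setNat_nat, setNat_natArr, storeNat_natArr, if_true, if_false,
          Nat.reduceEqDiff] at hI2 ⊢
        have hIio : Set.Iio (k + 1) = insert k (Set.Iio k) := by
          ext i; simp only [Set.mem_Iio, Set.mem_insert_iff]; omega
        rw [hIio]
        have h1 : Set.BijOn (fun i => s(Function.update (s₂.natArr 2) k x i,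
            Function.update (s₂.natArr 3) k u i)) (Set.Iio k) (g.listed N x D) := by
          refine hI2.congr fun i hi => ?_
          have : i ≠ k := by simp only [Set.mem_Iio] at hi; omega
          simp [this]
        have h2 := h1.insert (a := k) (by simpa using g.listed_not_mem h.1 huD)
        simpa using h2
      · rw [hev] at h
        rw [g.listed_insert_of_not h]
        exact Tri.skip hI2
    · intro s₂ F h
      have hX2 : s₂.nat vX = x := (F.nat _ rfl).trans hx
      refine Tri.setNat ?_
      simp only [NatExp.eval, hX2, setNat_nat, if_true]
      exact ⟨h, trivial⟩
  · rintro s₁ φ hF ⟨hI, -⟩ hlt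
    have hs₁ := h0.frame hF rfl
    simp only [Test.eval, NatExp.eval, hs₁.size] at hlt
    convert hI using 1
    ext e
    simp only [Net.listed, Set.mem_ofPred_eq]
    constructor
    · rintro ⟨y, u, rfl, h1, h2, h3⟩
      rcases lt_or_gt_of_ne h1.ne with h | h
      · exact ⟨y, u, rfl, h, h1, h2, h3, Or.inl (by have := g.lt h1; omega)⟩
      · exact ⟨u, y, Sym2.eq_swap, h, h1.symm, h3, h2, Or.inl (by have := g.lt h1.symm; omega)⟩
    · rintro ⟨y, u, rfl, -, h1, h2, h3, -⟩
      exact ⟨y, u, rfl, h1, h2, h3⟩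
  · refine ⟨?_, by rw [e1, Finset.range_eq_Ico]⟩
    unfold Lists
    rw [e1, e2]
    have : g.listed N 0 ∅ = ∅ := by
      ext e
      simp [Net.listed]
    rw [this]
    simp [Set.BijOn, Set.MapsTo, Set.InjOn, Set.SurjOn]

/-- The algorithm. -/
def perfectEdgeDomination : Program :=
  allComponents ;;
  .ite (.eq (.var vFlag) (.lit 1)) (.setNat 0 (.lit 1))
    (output ;; .setNat 1 (.var vOut) ;; .setNat 0 (.lit 0))

/-- A path that was found is already in the output variables `1` to `5`. Variable `0` holds the
number of vertices during the computation and is overwritten last. -/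
theorem perfectEdgeDomination_spec {g : Net} {s : State} (hs : Holds g s) (hflag : s.nat vFlag = 0)
    (hlev : ∀ x, s.natArr aLev x = 0) (hbest : ∀ x, s.natArr aBest x = 0) :
    Tri perfectEdgeDomination s (g.size (range g.n) + g.n) fun s' =>
      (s'.nat 0 = 0 ∧ ∃ N, g.Optimal (range g.n) N ∧
        Set.BijOn (fun i => s(s'.natArr 2 i, s'.natArr 3 i)) (Set.Iio (s'.nat 1))
          {e | ∃ y u, e = s(y, u) ∧ g.H.Adj y u ∧ y ∈ N ∧ u ∈ N}) ∨
      (s'.nat 0 = 1 ∧ IsP5 g.H (s'.nat 1) (s'.nat 2) (s'.nat 3) (s'.nat 4) (s'.nat 5)) := by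
  refine (allComponents_spec hs hflag hlev hbest).bind fun s₁ _ ⟨h1, h2, h3⟩ =>
    Tri.ite (fun h => ?_) (fun h => ?_)
  · simp only [Test.eval, NatExp.eval] at h
    refine Tri.setNat (Or.inr ?_)
    simp only [NatExp.eval, setNat_nat, if_true, if_false, OfNat.ofNat_ne_zero,
      one_ne_zero]
    exact ⟨trivial, (h2.resolve_left (by omega)).2⟩
  · simp only [Test.eval, NatExp.eval] at h
    refine ((output_spec h1).wk (Nat.le_add_right _ _) fun _ _ h => h).bind fun s₂ _ h4 => ?_
    refine Tri.setNat_seq (Tri.setNat (Or.inl ?_))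
    simp only [NatExp.eval, setNat_nat, if_true, if_false, Nat.reduceEqDiff, one_ne_zero,
      setNat_natArr]
    exact ⟨trivial, _, h3 (h2.resolve_right fun h' => h h'.1), h4⟩

end RealRAM

section Cover

open Finset
open scoped Classical

variable {V : Type*} {G : SimpleGraph V}

/-- The edges between the vertices in `N` form a perfect edge dominating set. -/
theorem isPerfectEdgeDominatingSet_of_coverGood {N : Set V} (h : ∀ x, CoverGood G N x)
    {P : Finset (Sym2 V)} (hP : ∀ a b, s(a, b) ∈ P ↔ G.Adj a b ∧ a ∈ N ∧ b ∈ N) :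
    IsPerfectEdgeDominatingSet G P := by
  -- The end `a` is covered and has the uncovered neighbour `b`, so it has a single covered
  -- neighbour `z`, and the edge from `a` to `z` is the only one that dominates.
  have key : ∀ a b, G.Adj a b → b ∉ N → ∃! f, f ∈ P ∧ EdgeDominates f s(a, b) := by
    intro a b hab hb
    have ha : a ∈ N := (h b).1 hb a hab.symm
    obtain ⟨⟨z, haz, hz⟩, h2⟩ := (h a).2 ha
    have huniq := h2.resolve_left fun h => hb (h b hab)
    refine ⟨s(a, z), ⟨(hP a z).2 ⟨haz, ha, hz⟩, a, Sym2.mem_mk_left _ _, Sym2.mem_mk_left _ _⟩, ?_⟩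
    rintro f ⟨hf, v, hvf, hv⟩
    obtain ⟨z', rfl⟩ := hvf
    rw [hP] at hf
    rcases Sym2.mem_iff.1 hv with rfl | rfl
    · rw [huniq z z' haz hz hf.1 hf.2.2]
    · exact absurd hf.2.1 hb
  refine ⟨fun e he => ?_, fun e he heP => ?_⟩
  · induction e with | _ a b => exact ((hP a b).1 he).1
  · induction e with
    | _ a b =>
      by_cases hb : b ∈ N
      · have ha : a ∉ N := fun ha => heP ((hP a b).2 ⟨he, ha, hb⟩)
        rw [Sym2.eq_swap]
        exact key b a (G.adj_symm he) ha
      · exact key a b he hb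

/-- The vertices covered by a set of edges. -/
def coveredSet (Q : Finset (Sym2 V)) : Set V := {x | ∃ e ∈ Q, x ∈ e}

/-- An edge outside `Q` with both ends covered is dominated by an edge of `Q` at either end. By
uniqueness these are the same edge, which then has the same two ends and is the given one. -/
theorem IsPerfectEdgeDominatingSet.mem_iff {Q : Finset (Sym2 V)}
    (hQ : IsPerfectEdgeDominatingSet G Q) (a b : V) :
    s(a, b) ∈ Q ↔ G.Adj a b ∧ a ∈ coveredSet Q ∧ b ∈ coveredSet Q := by
  constructor
  · exact fun h => ⟨hQ.1 _ h, ⟨_, h, Sym2.mem_mk_left _ _⟩, ⟨_, h, Sym2.mem_mk_right _ _⟩⟩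
  · rintro ⟨hab, ⟨e, he, hae⟩, ⟨e', he', hbe⟩⟩
    by_contra hn
    have := (hQ.2 _ hab hn).unique ⟨he, a, hae, Sym2.mem_mk_left _ _⟩
      ⟨he', b, hbe, Sym2.mem_mk_right _ _⟩
    subst this
    exact hn ((Sym2.mem_and_mem_iff hab.ne).1 ⟨hae, hbe⟩ ▸ he)

/-- An edge at an uncovered vertex must be dominated from its other end. An edge from a covered
vertex to an uncovered one has a single dominator, so only one edge of `Q` is left at the covered
vertex. -/
theorem IsPerfectEdgeDominatingSet.coverGood {Q : Finset (Sym2 V)}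
    (hQ : IsPerfectEdgeDominatingSet G Q) (x : V) : CoverGood G (coveredSet Q) x := by
  refine ⟨fun hx u hu => ?_, fun hx => ⟨?_, ?_⟩⟩
  · obtain ⟨f, ⟨hf, v, hvf, hv⟩, -⟩ := hQ.2 s(x, u) hu fun h => hx ((hQ.mem_iff x u).1 h).2.1
    rcases Sym2.mem_iff.1 hv with rfl | rfl
    · exact absurd ⟨f, hf, hvf⟩ hx
    · exact ⟨f, hf, hvf⟩
  · obtain ⟨e, he, u, rfl⟩ := hx
    have := (hQ.mem_iff x u).1 he
    exact ⟨u, this.1, this.2.2⟩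
  · by_contra! hn
    obtain ⟨⟨y, hxy, hy⟩, u, u', hu, huN, hu', huN', hne⟩ := hn
    have := (hQ.2 s(x, y) hxy fun h => hy ((hQ.mem_iff x y).1 h).2.2).unique
      ⟨(hQ.mem_iff x u).2 ⟨hu, hx, huN⟩, x, Sym2.mem_mk_left _ _, Sym2.mem_mk_left _ _⟩
      ⟨(hQ.mem_iff x u').2 ⟨hu', hx, huN'⟩, x, Sym2.mem_mk_left _ _, Sym2.mem_mk_left _ _⟩
    exact hne (Sym2.congr_right.1 this)

/-- The handshake lemma with weights: an unordered pair off the diagonal has two orderings,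
exchanged by the swap. It serves for the number of edges and for the cost. -/
theorem sum_sum_sym2 {n : ℕ} {M : Type*} [AddCommMonoid M] (p : Sym2 (Fin n) → M)
    (hp : ∀ a, p s(a, a) = 0) : ∑ a, ∑ b, p s(a, b) = 2 • ∑ e, p e := by
  have h1 : ∑ e, p e = ∑ i ∈ (univ : Finset (Fin n)).offDiag with i.1 < i.2, p s(i.1, i.2) := by
    rw [← Finset.sum_sym2_filter_not_isDiag, Finset.sym2_univ, Finset.sum_filter]
    refine Finset.sum_congr rfl fun e _ => ?_
    induction e with | _ a b =>
    by_cases h : a = b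
    · subst h; simp [hp]
    · simp [h]
  have h2 : ∑ i ∈ (univ : Finset (Fin n)).offDiag with ¬ i.1 < i.2, p s(i.1, i.2) =
      ∑ i ∈ (univ : Finset (Fin n)).offDiag with i.1 < i.2, p s(i.1, i.2) := by
    refine Finset.sum_nbij' Prod.swap Prod.swap ?_ ?_ (fun _ _ => rfl) (fun _ _ => rfl)
      (fun i _ => by rw [Sym2.eq_swap]; rfl)
    · rintro ⟨a, b⟩ h
      simp only [Finset.mem_filter, Finset.mem_offDiag, Finset.mem_univ, true_and, Prod.swap] at h ⊢
      exact ⟨h.1.symm, by omega⟩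
    · rintro ⟨a, b⟩ h
      simp only [Finset.mem_filter, Finset.mem_offDiag, Finset.mem_univ, true_and, Prod.swap] at h ⊢
      exact ⟨h.1.symm, by omega⟩
  rw [h1, two_nsmul]
  nth_rewrite 2 [← h2]
  rw [Finset.sum_filter_add_sum_filter_not, ← Fintype.sum_prod_type' (f := fun a b => p s(a, b))]
  symm
  refine Finset.sum_subset (Finset.subset_univ _) ?_
  rintro ⟨a, b⟩ - h
  have : a = b := by simpa using h
  subst this
  exact hp a

end Cover

namespace RealRAM

open Finset
open scoped Classical

/-! ## The input as a graph on the natural numbers -/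

theorem map_val_adj {n : ℕ} {G : SimpleGraph (Fin n)} {a b : Fin n} :
    (G.map Fin.valEmbedding).Adj a b ↔ G.Adj a b := by
  rw [SimpleGraph.map_adj]
  constructor
  · rintro ⟨a', b', h, ha, hb⟩
    rwa [← Fin.ext ha, ← Fin.ext hb]
  · exact fun h => ⟨a, b, h, rfl, rfl⟩

theorem exists_of_map_val_adj {n : ℕ} {G : SimpleGraph (Fin n)} {x u : ℕ}
    (h : (G.map Fin.valEmbedding).Adj x u) : ∃ a b : Fin n, G.Adj a b ∧ (a : ℕ) = x ∧ (b : ℕ) = u := by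
  rw [SimpleGraph.map_adj] at h
  exact h

/-- The network given by an input state. -/
noncomputable def IsInput.net {n : ℕ} {G : SimpleGraph (Fin n)} {w : Sym2 (Fin n) → ℝ} {s : State}
    (h : IsInput G w s) : Net where
  n := n
  H := G.map Fin.valEmbedding
  nb x := (range n).filter ((G.map Fin.valEmbedding).Adj x)
  w x u := if h : x < n ∧ u < n then w s(⟨x, h.1⟩, ⟨u, h.2⟩) else 0
  off := s.natArr 0
  nbr := s.natArr 1
  wt := s.realArr 0
  mem_nb {x u} := by
    rw [Finset.mem_filter, Finset.mem_range, and_iff_right_iff_imp]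
    intro hx
    obtain ⟨a, b, -, -, rfl⟩ := exists_of_map_val_adj hx
    exact b.2
  lt {x u} hx := by
    obtain ⟨a, b, -, rfl, -⟩ := exists_of_map_val_adj hx
    exact a.2
  w_comm x u := by
    by_cases hx : x < n <;> by_cases hu : u < n <;> simp [hx, hu, Sym2.eq_swap]
  mono x hx := h.mono ⟨x, hx⟩
  bij x hx := by
    convert h.neighbours ⟨x, hx⟩ using 1
    ext u
    simp only [Finset.coe_filter, Finset.mem_range, Set.mem_ofPred_eq, Set.mem_image,
      SimpleGraph.mem_neighborSet]
    constructor
    · rintro ⟨hu, h⟩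
      exact ⟨⟨u, hu⟩, map_val_adj.1 h, rfl⟩
    · rintro ⟨u, h, rfl⟩
      exact ⟨u.2, (map_val_adj (a := ⟨x, hx⟩)).2 h⟩
  wt_eq x hx j hj := by
    obtain ⟨u, -, hu⟩ := (h.neighbours ⟨x, hx⟩).mapsTo hj
    have hun : s.natArr 1 j < n := hu ▸ u.2
    rw [dif_pos ⟨hx, hun⟩]
    exact h.weights ⟨x, hx⟩ ⟨_, hun⟩ j hj rfl

/-! ### Size, cost and covered sets in terms of the input graph. -/

section Input

variable {n : ℕ} {G : SimpleGraph (Fin n)} {w : Sym2 (Fin n) → ℝ} {s : State} (h : IsInput G w s)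

theorem IsInput.net_n : h.net.n = n := rfl

theorem IsInput.net_adj {a b : Fin n} : h.net.H.Adj a b ↔ G.Adj a b := map_val_adj

theorem IsInput.sum_nb {M : Type*} [AddCommMonoid M] (a : Fin n) (f : ℕ → M) (q : ℕ → Prop) :
    ∑ u ∈ (h.net.nb a).filter q, f u = ∑ b : Fin n, if G.Adj a b ∧ q b then f b else 0 := by
  have : (h.net.nb a).filter q = (range n).filter fun u => h.net.H.Adj a u ∧ q u := by
    ext u
    rw [Finset.mem_filter, h.net.mem_nb, Finset.mem_filter, Finset.mem_range]
    constructor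
    · exact fun h' => ⟨h.net.lt h'.1.symm, h'⟩
    · exact fun h' => h'.2
  rw [this, Finset.sum_filter, Finset.sum_range]
  refine Finset.sum_congr rfl fun b _ => ?_
  rw [h.net_adj]

/-- Every edge appears in two adjacency lists; this turns the budgets into a bound in n and m. -/
theorem IsInput.size_eq : h.net.size (range h.net.n) = n + 2 * G.edgeSet.ncard := by
  have h1 : ∑ x ∈ range n, (h.net.nb x).card = 2 • ∑ e : Sym2 (Fin n), if e ∈ G.edgeSet then 1 else 0 := by
    rw [← sum_sum_sym2 _ (by simp), Finset.sum_range]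
    refine Finset.sum_congr rfl fun a _ => ?_
    have := h.sum_nb a (fun _ => 1) (fun _ => True)
    simpa using this
  have h2 : G.edgeSet.ncard = ∑ e : Sym2 (Fin n), if e ∈ G.edgeSet then 1 else 0 := by
    rw [← Finset.card_filter, ← Set.ncard_coe_finset]
    congr 1
    ext e
    simp
  rw [Net.size, h.net_n, Finset.sum_add_distrib, h1, h2, smul_eq_mul, Finset.sum_const,
    Finset.card_range, smul_eq_mul]
  omega

theorem IsInput.cost_eq (N : Set ℕ) (P : Finset (Sym2 (Fin n)))
    (hP : ∀ a b : Fin n, s(a, b) ∈ P ↔ G.Adj a b ∧ (a : ℕ) ∈ N ∧ (b : ℕ) ∈ N) :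
    h.net.cost (range h.net.n) N = 2 • ∑ e ∈ P, w e := by
  have h1 : ∑ e ∈ P, w e = ∑ e, if e ∈ P then w e else 0 := by simp
  rw [h1, ← sum_sum_sym2 _ (by simp [hP]), Net.cost, h.net_n, Finset.sum_filter, Finset.sum_range]
  refine Finset.sum_congr rfl fun a _ => ?_
  by_cases ha : (a : ℕ) ∈ N
  · rw [if_pos ha, Net.sum, h.sum_nb]
    refine Finset.sum_congr rfl fun b _ => ?_
    simp only [hP, ha, true_and]
    congr 1
    exact dif_pos ⟨a.2, b.2⟩
  · simp [hP, ha]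

theorem IsInput.coverGood_iff (N : Set ℕ) (a : Fin n) :
    CoverGood h.net.H N a ↔ CoverGood G {b : Fin n | (b : ℕ) ∈ N} a := by
  have h1 : ∀ q : ℕ → Prop, (∀ u, h.net.H.Adj a u → q u) ↔ ∀ b : Fin n, G.Adj a b → q b := by
    intro q
    constructor
    · exact fun h' b hb => h' b (h.net_adj.2 hb)
    · intro h' u hu
      have hun : u < n := h.net.lt hu.symm
      exact h' ⟨u, hun⟩ (h.net_adj.1 hu)
  have h2 : ∀ q : ℕ → Prop, (∃ u, h.net.H.Adj a u ∧ q u) ↔ ∃ b : Fin n, G.Adj a b ∧ q b := by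
    intro q
    have := not_congr (h1 fun u => ¬ q u)
    push Not at this
    exact this
  have h3 : (∀ u u', h.net.H.Adj a u → u ∈ N → h.net.H.Adj a u' → u' ∈ N → u = u') ↔
      ∀ b b' : Fin n, G.Adj a b → (b : ℕ) ∈ N → G.Adj a b' → (b' : ℕ) ∈ N → b = b' := by
    constructor
    · exact fun h' b b' hb hbN hb' hbN' =>
        Fin.ext (h' b b' (h.net_adj.2 hb) hbN (h.net_adj.2 hb') hbN')
    · intro h' u u' hu huN hu' huN'
      have hun : u < n := h.net.lt hu.symm
      have hun' : u' < n := h.net.lt hu'.symm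
      exact congrArg Fin.val (h' ⟨u, hun⟩ ⟨u', hun'⟩ (h.net_adj.1 hu) huN (h.net_adj.1 hu') huN')
  unfold CoverGood
  rw [h1, h2, h3]
  rfl

theorem IsInput.good_iff (N : Set ℕ) :
    h.net.Good (range h.net.n) N ↔ ∀ a, CoverGood G {b : Fin n | (b : ℕ) ∈ N} a := by
  constructor
  · exact fun h' a => (h.coverGood_iff N a).1 (h' a (Finset.mem_range.2 a.2))
  · intro h' x hx
    exact (h.coverGood_iff N ⟨x, Finset.mem_range.1 hx⟩).2 (h' _)

/-- An optimal covered set gives a perfect edge dominating set of minimum weight. -/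
theorem IsInput.isMinWeight {N : Set ℕ} (hN : h.net.Optimal (range h.net.n) N)
    {P : Finset (Sym2 (Fin n))}
    (hP : ∀ a b : Fin n, s(a, b) ∈ P ↔ G.Adj a b ∧ (a : ℕ) ∈ N ∧ (b : ℕ) ∈ N) :
    IsMinWeightPerfectEdgeDominatingSet G w P := by
  refine ⟨isPerfectEdgeDominatingSet_of_coverGood ((h.good_iff N).1 hN.1) hP, fun Q hQ => ?_⟩
  have hmem : ∀ b : Fin n, (b : ℕ) ∈ Fin.val '' coveredSet Q ↔ b ∈ coveredSet Q := fun b =>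
    Fin.val_injective.mem_set_image
  have := hN.2 (Fin.val '' coveredSet Q) ((h.good_iff _).2 fun a => by
    simp only [hmem]
    exact hQ.coverGood a)
  rw [h.cost_eq N P hP, h.cost_eq _ Q fun a b => by rw [hmem, hmem]; exact hQ.mem_iff a b,
    two_nsmul, two_nsmul] at this
  linarith

end Input

/-! ### From the final memory to the required output. -/

theorem outputsInducedP5_of_isP5 {n : ℕ} {G : SimpleGraph (Fin n)} {s : State} (h0 : s.nat 0 = 1)
    (h : IsP5 (G.map Fin.valEmbedding) (s.nat 1) (s.nat 2) (s.nat 3) (s.nat 4) (s.nat 5)) :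
    OutputsInducedP5 s G := by
  obtain ⟨a, b, -, ha, hb⟩ := exists_of_map_val_adj h.1.1
  obtain ⟨c, d, -, hc, hd⟩ := exists_of_map_val_adj h.1.2.2.1
  obtain ⟨-, e, -, -, he⟩ := exists_of_map_val_adj h.1.2.2.2
  rw [← ha, ← hb, ← hc, ← hd, ← he] at h
  simp only [IsP5, map_val_adj] at h
  obtain ⟨⟨h1, h2, h3, h4⟩, h5, h6, h7, h8, h9, h10⟩ := h
  have hadj : ∀ i j : Fin 5, G.Adj (![a, b, c, d, e] i) (![a, b, c, d, e] j) ↔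
      (SimpleGraph.pathGraph 5).Adj i j := by
    intro i j
    rw [SimpleGraph.pathGraph_adj]
    fin_cases i <;> fin_cases j <;> simp [*, G.adj_comm]
  -- `IsP5` does not ask for distinct vertices. No two vertices of the path on five vertices have
  -- the same neighbours, so the adjacencies alone force injectivity.
  have htwin : ∀ i j : Fin 5, (∀ k : Fin 5, (i.val + 1 = k.val ∨ k.val + 1 = i.val) ↔
      (j.val + 1 = k.val ∨ k.val + 1 = j.val)) → i = j := by decide
  refine ⟨h0, ⟨⟨![a, b, c, d, e], fun i j hij => htwin i j fun k => ?_⟩, hadj _ _⟩, fun i => ?_⟩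
  · rw [← SimpleGraph.pathGraph_adj, ← SimpleGraph.pathGraph_adj, ← hadj, ← hadj, hij]
  · fin_cases i
    · exact ha.symm
    · exact hb.symm
    · exact hc.symm
    · exact hd.symm
    · exact he.symm

theorem outputsEdgeSet_of_bijOn {n : ℕ} {G : SimpleGraph (Fin n)} {s : State} {N : Set ℕ}
    (h0 : s.nat 0 = 0) (h : Set.BijOn (fun i => s(s.natArr 2 i, s.natArr 3 i)) (Set.Iio (s.nat 1))
      {e | ∃ y u, e = s(y, u) ∧ (G.map Fin.valEmbedding).Adj y u ∧ y ∈ N ∧ u ∈ N})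
    {P : Finset (Sym2 (Fin n))}
    (hP : ∀ a b : Fin n, s(a, b) ∈ P ↔ G.Adj a b ∧ (a : ℕ) ∈ N ∧ (b : ℕ) ∈ N) :
    OutputsEdgeSet s P := by
  refine ⟨h0, ?_⟩
  convert h using 1
  ext e
  constructor
  · rintro ⟨e, he, rfl⟩
    induction e with
    | _ a b =>
      have he := (hP a b).1 he
      exact ⟨a, b, rfl, map_val_adj.2 he.1, he.2⟩
  · rintro ⟨y, u, rfl, hyu, hy, hu⟩
    obtain ⟨a, b, hab, rfl, rfl⟩ := exists_of_map_val_adj hyu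
    exact ⟨s(a, b), (hP a b).2 ⟨hab, hy, hu⟩, rfl⟩

end RealRAM

/-! ### The main theorem. -/

theorem mainTheorem5 :
    ∃ (p : RealRAM.Program) (c : ℕ),
      ∀ (n : ℕ) (G : SimpleGraph (Fin n)) (w : Sym2 (Fin n) → ℝ) (s : RealRAM.State),
        RealRAM.IsInput G w s →
          ∃ (t : ℕ) (s' : RealRAM.State),
            RealRAM.Runs p s t s' ∧
            t ≤ c * (n + G.edgeSet.ncard + 1) ∧
            ((∃ P : Finset (Sym2 (Fin n)),
                IsMinWeightPerfectEdgeDominatingSet G w P ∧ RealRAM.OutputsEdgeSet s' P) ∨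
              RealRAM.OutputsInducedP5 s' G) := by
  classical
  -- Each instruction is charged at most (n + 2m) + n + 1 times, which is at most 2(n + m + 1).
  refine ⟨RealRAM.perfectEdgeDomination, RealRAM.perfectEdgeDomination.weight * 2,
    fun n G w s h => ?_⟩
  obtain ⟨t, s', hr, ht, hq⟩ := RealRAM.perfectEdgeDomination_spec (g := h.net) (s := s)
    ⟨h.size, rfl, rfl, rfl⟩ (h.nat_zero _ (by omega)) (h.natArr_zero _ (by omega))
    (h.natArr_zero _ (by omega))
  refine ⟨t, s', hr, ht.trans ?_, ?_⟩
  · rw [h.size_eq, h.net_n, mul_assoc]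
    exact Nat.mul_le_mul_left _ (by omega)
  · rcases hq with ⟨h0, N, hN, hout⟩ | ⟨h0, hP⟩
    · refine Or.inl ⟨Finset.univ.filter fun e => e ∈ G.edgeSet ∧ ∀ a ∈ e, (a : ℕ) ∈ N, ?_⟩
      have hP : ∀ a b : Fin n, s(a, b) ∈ (Finset.univ.filter fun e => e ∈ G.edgeSet ∧
          ∀ a ∈ e, (a : ℕ) ∈ N) ↔ G.Adj a b ∧ (a : ℕ) ∈ N ∧ (b : ℕ) ∈ N := by
        simp
      exact ⟨h.isMinWeight hN hP, RealRAM.outputsEdgeSet_of_bijOn h0 hout hP⟩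
    · exact Or.inr (RealRAM.outputsInducedP5_of_isP5 h0 hP)
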